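/- Let $n\ge 1$, $m>0$. Write $x=(x^0,\mathbf x)\in\mathbb R^{1+n}$, $\mathbf x=(x^1,\dots,x^n)$, $\omega(\mathbf p)=\sqrt{|\mathbf p|^2+m^2}$ for $\mathbf p\in\mathbb R^n$, and let $\kappa(x)=\tilde x=(x^+,x_\perp,x^-)$ with $x^\pm=(x^0\pm x^n)/\sqrt2$, $x_\perp=(x^1,\dots,x^{n-1})$; put $\tilde{\mathbf x}=(x_\perp,x^-)$ and $\tilde{\mathbf p}=(p^+,p_\perp)\in\mathbb R^n$. **Spaces.** $\mathcal S_{p^+}(\mathbb R^n)$ is the space of all $f\in C^\infty(\mathbb R^n,\mathbb C)$ with $\sup_{p^+\ne0}|(p^+)^k p_\perp^\beta\partial^\alpha f(\tilde{\mathbf p})|<\infty$ for all $k\in\mathbb Z$ and all multi-indices $\alpha,\beta$, with the topology given by these seminorms. $\mathcal S_{\partial_-}(\mathbb R^n)=\bigcap_{k\ge0}\partial_{x^-}^k\mathcal S(\mathbb R^n)$, with the topology induced by $\mathcal S(\mathbb R^n)$; $\mathcal S_{\partial_-}(\mathbb R^{1+n})$ is defined in the same way. $\mathcal S'_{p^+}$,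 $\mathcal S'_{\partial_-}$ are the topological duals. The relaxation $u^*$ of $u\in\mathcal S'$ is its restriction to $\mathcal S_{\partial_-}$. **Fourier transforms.** $\hat f(\mathbf p)=\int f(\mathbf x)e^{-i\mathbf x\cdot\mathbf p}\,d\mathbf x$, extended to $\mathcal S'(\mathbb R^n)$ by $(\hat u,f)=(u,\hat f)$. The partial LC Fourier transform is $(\mathcal F_{LC}f)(\tilde{\mathbf p})=\int f(\tilde{\mathbf x})e^{i(x^-p^+-x_\perp\cdot p_\perp)}\,d\tilde{\mathbf x}$, extended to a map $\mathcal S'_{\partial_-}(\mathbb R^n)\to\mathcal S'_{p^+}(\mathbb R^n)$ by transposition: $(\mathcal F_{LC}v,g)=(v,\mathcal F_{LC}^tg)$ with $(\mathcal F_{LC}^tg)(\tilde{\mathbf x})=\int g(\tilde{\mathbf p})e^{i(x^-p^+-x_\perp\cdot p_\perp)}\,d\tilde{\mathbf p}$. **Restrictions.** For $u\in\mathcal S'(\mathbb R^{1+n})$ we write $u|_{x^0=0}=u_0$ if there is a family $(u_t)_{t\in\mathbb R}$ in $\mathcal S'(\mathbb R^n)$, with value $u_0$ at $t=0$, such that $t\mapsto(u_t,g)$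 is $C^\infty$, $t\mapsto(u_t,g)f(t)$ is integrable and $(u,f(x^0)g(\mathbf x))=\int(u_t,g)f(t)\,dt$ for all $f\in\mathcal S(\mathbb R)$, $g\in\mathcal S(\mathbb R^n)$. We write $u|^*_{x^+=0}=w$ (tame restriction) if there are an open neighbourhood $\Omega$ of $0\in\mathbb R$ and a family $(u_t)_{t\in\Omega}$ in $\mathcal S'_{\partial_-}(\mathbb R^n)$, with value $w$ at $t=0$, such that $t\mapsto(u_t,g)$ is $C^\infty$ on $\Omega$ and $(u^*,f(x^+)g(\tilde{\mathbf x}))=\int_\Omega(u_t,g)f(t)\,dt$ for all $f\in\mathcal D(\Omega)$, $g\in\mathcal S_{\partial_-}(\mathbb R^n)$. **Squeezing maps.** Let $\nu_{\gtrless0}:\{\pm p^+>0\}\to\mathbb R^n$ be defined as follows: $\nu_{\gtrless0}(\tilde{\mathbf p})$ is the spatial part of $\kappa^{-1}\bigl(p^+,p_\perp,\tfrac{p_\perp^2+m^2}{2p^+}\bigr)$; and let $\mu_{\gtrless0}(\mathbf p)=(p^+,p_\perp)=\bigl(\tfrac1{\sqrt2}(p^n\pm\omega(\mathbf p)),p^1,\dots,p^{n-1}\bigr)$.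 The pull-backs $\nu^*_{\gtrless0}:\mathcal S'(\mathbb R^n)\to\mathcal S'_{p^+}(\mathbb R^n)$ (composition with $\nu_{\gtrless0}$, extended by zero to the other half space) and $\mu^*_{\gtrless0}:\mathcal S'_{p^+}(\mathbb R^n)\to\mathcal S'(\mathbb R^n)$ (composition with $\mu_{\gtrless0}$) are, by the change of variables formula, $$(\nu^*_{\gtrless0}a,f)=\Bigl(a,\tfrac{|\mu_{\gtrless0}(\mathbf p)^+|}{\omega(\mathbf p)}f(\mu_{\gtrless0}(\mathbf p))\Bigr),\qquad(\mu^*_{\gtrless0}b,g)=\Bigl(b,\Theta(\pm p^+)\tfrac{\omega(\nu_{\gtrless0}(\tilde{\mathbf p}))}{|p^+|}g(\nu_{\gtrless0}(\tilde{\mathbf p}))\Bigr),$$ where $\Theta$ is the Heaviside function. For $M=\tfrac1{2|p^+|}$ and $M=|p^+|\Theta(\pm p^+)$ and $b\in\mathcal S'_{p^+}$, the product $Mb$ is given by $(Mb,f)=(b,Mf)$. **Theorem.** Let $u\in\mathcal S'(\mathbb R^{1+n})$ solve the Klein--Gordon equation $(\partial_0^2-\sum_{i=1}^n\partial_i^2+m^2)u=0$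 and let $\tilde u=u\circ\kappa^{-1}$. Then $u_0=u|_{x^0=0}$, $u_1=(\partial_0u)|_{x^0=0}\in\mathcal S'(\mathbb R^n)$ and $\tilde u_0=\tilde u|^*_{x^+=0}\in\mathcal S'_{\partial_-}(\mathbb R^n)$ exist and are unique, $\mu_{\gtrless0}=\nu_{\gtrless0}^{-1}$ is a bijection of $\mathbb R^n$ onto $\{\pm p^+>0\}$, and $$\mathcal F_{LC}\tilde u_0=\frac1{2|p^+|}\Bigl(\nu^*_{>0}(\omega\hat u_0+i\hat u_1)+\nu^*_{<0}(\omega\hat u_0-i\hat u_1)\Bigr),$$ $$\hat u_0=\frac1\omega\Bigl(\mu^*_{>0}\bigl(|p^+|\Theta(p^+)\mathcal F_{LC}\tilde u_0\bigr)+\mu^*_{<0}\bigl(|p^+|\Theta(-p^+)\mathcal F_{LC}\tilde u_0\bigr)\Bigr),$$ $$\hat u_1=\frac1i\Bigl(\mu^*_{>0}\bigl(|p^+|\Theta(p^+)\mathcal F_{LC}\tilde u_0\bigr)-\mu^*_{<0}\bigl(|p^+|\Theta(-p^+)\mathcal F_{LC}\tilde u_0\bigr)\Bigr).$$ -/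

import Mathlib

open scoped ContDiff SchwartzMap
noncomputable section
namespace LightCone

section Growth
variable {V W F G H : Type} [NormedAddCommGroup V] [NormedSpace ℝ V]
  [NormedAddCommGroup W] [NormedSpace ℝ W] [NormedAddCommGroup F] [NormedSpace ℝ F]
  [NormedAddCommGroup G] [NormedSpace ℝ G] [NormedAddCommGroup H] [NormedSpace ℝ H]

/-- `f` is smooth on `U` and each of its derivatives is bounded there by a multiple of a power
of the weight `ρ`. -/
structure ModerateOn (U : Set V) (ρ : V → ℝ) (f : V → F) : Prop where
  contDiffOn : ContDiffOn ℝ ∞ f U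
  bound : ∀ j : ℕ, ∃ (N : ℕ) (C : ℝ), 0 ≤ C ∧ ∀ i ≤ j, ∀ x ∈ U,
    ‖iteratedFDerivWithin ℝ i f U x‖ ≤ C * ρ x ^ N

theorem ModerateOn.of_bound {U : Set V} {ρ : V → ℝ} (hρ : ∀ x ∈ U, 1 ≤ ρ x) {f : V → F}
    (hf : ContDiffOn ℝ ∞ f U)
    (h : ∀ j : ℕ, ∃ (N : ℕ) (C : ℝ), ∀ x ∈ U,
      ‖iteratedFDerivWithin ℝ j f U x‖ ≤ C * ρ x ^ N) : ModerateOn U ρ f := by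
  refine ⟨hf, fun j => ?_⟩
  induction j with
  | zero =>
    obtain ⟨N, C, h⟩ := h 0
    refine ⟨N, |C|, abs_nonneg _, fun i hi x hx => ?_⟩
    obtain rfl : i = 0 := by omega
    have := hρ x hx
    exact (h x hx).trans (by gcongr; exact le_abs_self C)
  | succ j ih =>
    obtain ⟨N, C, h⟩ := h (j + 1)
    obtain ⟨N', C', hC', h'⟩ := ih
    refine ⟨N + N', |C| + C', by positivity, fun i hi x hx => ?_⟩
    have h1 := hρ x hx
    rcases Nat.lt_or_ge i (j + 1) with hij | hij
    · refine (h' i (by omega) x hx).trans ?_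
      gcongr
      · linarith [abs_nonneg C]
      · omega
    · obtain rfl : i = j + 1 := by omega
      refine (h x hx).trans ?_
      gcongr
      · linarith [le_abs_self C]
      · omega

theorem ModerateOn.of_temperate {U : Set V} (hU : IsOpen U) {ρ : V → ℝ}
    (hρ : ∀ x ∈ U, 1 + ‖x‖ ≤ ρ x) {f : V → F} (hf : f.HasTemperateGrowth) :
    ModerateOn U ρ f := by
  refine .of_bound (fun x hx => by linarith [hρ x hx, norm_nonneg x]) hf.1.contDiffOn fun j => ?_
  obtain ⟨N, C, hC, h⟩ := hf.norm_iteratedFDeriv_le_uniform j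
  refine ⟨N, C, fun x hx => ?_⟩
  rw [iteratedFDerivWithin_of_isOpen j hU hx]
  refine (h j le_rfl x).trans ?_
  have := hρ x hx
  gcongr

theorem ModerateOn.bilin {U : Set V} (hU : IsOpen U) {ρ : V → ℝ} (hρ : ∀ x ∈ U, 1 ≤ ρ x)
    (B : F →L[ℝ] G →L[ℝ] H) {f : V → F} {g : V → G} (hf : ModerateOn U ρ f)
    (hg : ModerateOn U ρ g) : ModerateOn U ρ (fun x => B (f x) (g x)) := by
  refine .of_bound hρ (B.isBoundedBilinearMap.contDiff.comp_contDiffOn (hf.1.prodMk hg.1)) fun j => ?_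
  obtain ⟨N, C, hC, h⟩ := hf.2 j
  obtain ⟨N', C', hC', h'⟩ := hg.2 j
  refine ⟨N + N', ‖B‖ * ∑ i ∈ Finset.range (j + 1), (j.choose i : ℝ) * C * C', fun x hx => ?_⟩
  refine (B.norm_iteratedFDerivWithin_le_of_bilinear hf.1 hg.1 hU.uniqueDiffOn hx
    (n := j) (by exact_mod_cast le_top)).trans ?_
  have := hρ x hx
  rw [mul_assoc, Finset.sum_mul]
  refine mul_le_mul_of_nonneg_left (Finset.sum_le_sum fun i hi => ?_) (norm_nonneg B)
  have hi' := Finset.mem_range.1 hi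
  calc _ ≤ (j.choose i : ℝ) * (C * ρ x ^ N) * (C' * ρ x ^ N') := by
        gcongr
        · exact h i (by omega) x hx
        · exact h' (j - i) (by omega) x hx
    _ = _ := by ring

theorem ModerateOn.add {U : Set V} (hU : IsOpen U) {ρ : V → ℝ} (hρ : ∀ x ∈ U, 1 ≤ ρ x)
    {f g : V → F} (hf : ModerateOn U ρ f) (hg : ModerateOn U ρ g) :
    ModerateOn U ρ (fun x => f x + g x) := by
  refine .of_bound hρ (hf.1.add hg.1) fun j => ?_
  obtain ⟨N, C, hC, h⟩ := hf.2 j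
  obtain ⟨N', C', hC', h'⟩ := hg.2 j
  refine ⟨N + N', C + C', fun x hx => ?_⟩
  have := hρ x hx
  have e : iteratedFDerivWithin ℝ j (fun x => f x + g x) U x =
      iteratedFDerivWithin ℝ j f U x + iteratedFDerivWithin ℝ j g U x :=
    fun_iteratedFDerivWithin_add_apply ((hf.1 x hx).of_le (by exact_mod_cast le_top))
      ((hg.1 x hx).of_le (by exact_mod_cast le_top)) hU.uniqueDiffOn hx
  rw [e]
  calc _ ≤ C * ρ x ^ N + C' * ρ x ^ N' :=
        (norm_add_le _ _).trans (add_le_add (h j le_rfl x hx) (h' j le_rfl x hx))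
    _ ≤ C * ρ x ^ (N + N') + C' * ρ x ^ (N + N') := by
        gcongr <;> omega
    _ = _ := by ring

/-- The basic estimate for weighted compositions `w • (f ∘ φ)`. -/
theorem ModerateOn.weighted_comp_bound {U : Set V} {U' : Set W} (hU : IsOpen U) (hU' : IsOpen U')
    {ρ : V → ℝ} {ρ' : W → ℝ} (hρ : ∀ x ∈ U, 1 ≤ ρ x) (hρ' : ∀ x ∈ U', 1 ≤ ρ' x)
    {φ : V → W} (hφ : ModerateOn U ρ φ) {w : V → ℂ} (hw : ModerateOn U ρ w)
    (hm : Set.MapsTo φ U U') {k : ℕ} {C₀ : ℝ} (hk : ∀ x ∈ U, ρ x ≤ C₀ * ρ' (φ x) ^ k)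
    (j N : ℕ) : ∃ (N' : ℕ) (C : ℝ), 0 ≤ C ∧ ∀ (f : W → ℂ), ContDiffOn ℝ ∞ f U' → ∀ B : ℝ, 0 ≤ B →
      (∀ i ≤ j, ∀ y ∈ U', ρ' y ^ N' * ‖iteratedFDerivWithin ℝ i f U' y‖ ≤ B) →
      ∀ x ∈ U, ρ x ^ N * ‖iteratedFDerivWithin ℝ j (fun x => w x * f (φ x)) U x‖ ≤ C * B := by
  obtain ⟨Nφ, Cφ, hCφ, hφb⟩ := hφ.2 j
  obtain ⟨Nw, Cw, hCw, hwb⟩ := hw.2 j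
  set M := N + Nw + Nφ * j with hM
  refine ⟨k * M, |C₀| ^ M * (2 ^ j * Cw * j.factorial * (Cφ + 1) ^ j), by positivity,
    fun f hf B hB hfB x hx => ?_⟩
  have h1 := hρ x hx
  have h1' := hρ' _ (hm hx)
  have hpos : 0 < ρ' (φ x) ^ (k * M) := by positivity
  set b := B / ρ' (φ x) ^ (k * M) with hb
  have hb0 : 0 ≤ b := by positivity
  set D := (Cφ + 1) * ρ x ^ Nφ with hD
  have hD1 : 1 ≤ D := by
    have : 1 ≤ ρ x ^ Nφ := one_le_pow₀ h1
    nlinarith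
  have hcomp : ∀ i ≤ j, ‖iteratedFDerivWithin ℝ i (f ∘ φ) U x‖ ≤ j.factorial * b * D ^ j := by
    intro i hi
    have := norm_iteratedFDerivWithin_comp_le (n := i) (C := b) (D := D) hf hφ.1
      (by exact_mod_cast le_top) hU'.uniqueDiffOn hU.uniqueDiffOn hm hx
      (fun l hl => by
        rw [hb, le_div_iff₀' hpos]
        exact hfB l (hl.trans hi) _ (hm hx))
      (fun l hl hl' => by
        refine (hφb l (hl'.trans hi) x hx).trans ?_
        have : Cφ * ρ x ^ Nφ ≤ D := by rw [hD]; gcongr; linarith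
        exact this.trans (le_self_pow₀ hD1 (by omega)))
    refine this.trans ?_
    gcongr
  have hprod := norm_iteratedFDerivWithin_mul_le (n := j) hw.1
    (hf.comp hφ.1 hm) hU.uniqueDiffOn hx (by exact_mod_cast le_top)
  have hprod' : ‖iteratedFDerivWithin ℝ j (fun x => w x * f (φ x)) U x‖ ≤
      2 ^ j * (Cw * ρ x ^ Nw) * (j.factorial * b * D ^ j) := by
    refine hprod.trans ?_
    have e : (2 : ℝ) ^ j = ∑ i ∈ Finset.range (j + 1), (j.choose i : ℝ) := by
      exact_mod_cast (Nat.sum_range_choose j).symm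
    rw [e, Finset.sum_mul, Finset.sum_mul]
    gcongr with i hi
    · have := Finset.mem_range.1 hi
      exact hwb i (by omega) x hx
    · exact hcomp _ (by omega)
  have hkM : ρ x ^ M ≤ |C₀| ^ M * ρ' (φ x) ^ (k * M) := by
    rw [pow_mul, ← mul_pow]
    gcongr
    refine (hk x hx).trans ?_
    gcongr
    exact le_abs_self _
  calc ρ x ^ N * _ ≤ ρ x ^ N * (2 ^ j * (Cw * ρ x ^ Nw) * (j.factorial * b * D ^ j)) := by gcongr
    _ = ρ x ^ M * (2 ^ j * Cw * j.factorial * (Cφ + 1) ^ j * b) := by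
        rw [hD, hM, mul_pow, ← pow_mul, pow_add, pow_add]; ring
    _ ≤ |C₀| ^ M * ρ' (φ x) ^ (k * M) * (2 ^ j * Cw * j.factorial * (Cφ + 1) ^ j * b) := by gcongr
    _ = |C₀| ^ M * (2 ^ j * Cw * j.factorial * (Cφ + 1) ^ j) * (ρ' (φ x) ^ (k * M) * b) := by ring
    _ = _ := by rw [hb, mul_div_cancel₀ _ hpos.ne']

theorem ModerateOn.comp {U : Set V} {U' : Set W} (hU : IsOpen U) (hU' : IsOpen U')
    {ρ : V → ℝ} {ρ' : W → ℝ} (hρ : ∀ x ∈ U, 1 ≤ ρ x) (hρ' : ∀ x ∈ U', 1 ≤ ρ' x)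
    {φ : V → W} (hφ : ModerateOn U ρ φ) {f : W → F} (hf : ModerateOn U' ρ' f)
    (hm : Set.MapsTo φ U U') {k : ℕ} {C₀ : ℝ} (hk : ∀ x ∈ U, ρ' (φ x) ≤ C₀ * ρ x ^ k) :
    ModerateOn U ρ (fun x => f (φ x)) := by
  refine .of_bound hρ (hf.1.comp hφ.1 hm) fun j => ?_
  obtain ⟨Nφ, Cφ, hCφ, hφb⟩ := hφ.2 j
  obtain ⟨Nf, Cf, hCf, hfb⟩ := hf.2 j
  refine ⟨k * Nf + Nφ * j, j.factorial * (Cf * |C₀| ^ Nf) * (Cφ + 1) ^ j, fun x hx => ?_⟩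
  have h1 := hρ x hx
  have h1' := hρ' _ (hm hx)
  set D := (Cφ + 1) * ρ x ^ Nφ with hD
  have hD1 : 1 ≤ D := by
    have : 1 ≤ ρ x ^ Nφ := one_le_pow₀ h1
    nlinarith
  have := norm_iteratedFDerivWithin_comp_le (n := j) (C := Cf * (|C₀| * ρ x ^ k) ^ Nf) (D := D)
      hf.1 hφ.1 (by exact_mod_cast le_top) hU'.uniqueDiffOn hU.uniqueDiffOn hm hx
      (fun l hl => by
        refine (hfb l hl _ (hm hx)).trans ?_
        gcongr
        refine (hk x hx).trans ?_
        gcongr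
        exact le_abs_self _)
      (fun l hl hl' => by
        refine (hφb l hl' x hx).trans ?_
        have : Cφ * ρ x ^ Nφ ≤ D := by rw [hD]; gcongr; linarith
        exact this.trans (le_self_pow₀ hD1 (by omega)))
  refine this.trans (le_of_eq ?_)
  rw [hD, mul_pow, mul_pow, ← pow_mul, ← pow_mul, pow_add]; ring

/-- Extension by zero across the hyperplane `ℓ = 0` of a function that is flat there. -/
theorem contDiff_of_flat (ℓ : V →L[ℝ] ℝ) (n : ℕ) : ∀ {F : Type} [NormedAddCommGroup F]
    [NormedSpace ℝ F] (h : V → F), ContDiffOn ℝ ∞ h {q | ℓ q ≠ 0} → (∀ q, ℓ q = 0 → h q = 0) →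
    (∀ j : ℕ, ∃ C : ℝ, ∀ q, ℓ q ≠ 0 →
      ‖iteratedFDerivWithin ℝ j h {q | ℓ q ≠ 0} q‖ ≤ C * |ℓ q| ^ 2) → ContDiff ℝ n h := by
  have hU : IsOpen {q | ℓ q ≠ 0} := isOpen_ne_fun ℓ.continuous continuous_const
  have key : ∀ {F : Type} [NormedAddCommGroup F]
    [NormedSpace ℝ F] (h : V → F), ContDiffOn ℝ ∞ h {q | ℓ q ≠ 0} → (∀ q, ℓ q = 0 → h q = 0) →
    (∀ j : ℕ, ∃ C : ℝ, ∀ q, ℓ q ≠ 0 →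
      ‖iteratedFDerivWithin ℝ j h {q | ℓ q ≠ 0} q‖ ≤ C * |ℓ q| ^ 2) →
      Differentiable ℝ h ∧ ∀ q, ℓ q = 0 → fderiv ℝ h q = 0 := by
    intro F _ _ h h1 h2 h3
    obtain ⟨C, hC⟩ := h3 0
    have h0 : ∀ q, ℓ q = 0 → HasFDerivAt h (0 : V →L[ℝ] F) q := by
      intro q hq
      refine Asymptotics.IsBigO.hasFDerivAt (n := 2) ?_ (by norm_num)
      refine Asymptotics.IsBigO.of_bound (|C| * ‖ℓ‖ ^ 2) (Filter.Eventually.of_forall fun x => ?_)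
      rw [norm_pow, norm_norm, mul_assoc, ← mul_pow]
      by_cases hx : ℓ x = 0
      · rw [h2 x hx, norm_zero]; positivity
      · have := hC x hx
        rw [norm_iteratedFDerivWithin_zero] at this
        refine this.trans ?_
        have e : |ℓ x| ≤ ‖ℓ‖ * ‖x - q‖ := by
          have := ℓ.le_opNorm (x - q)
          rwa [map_sub, hq, sub_zero, Real.norm_eq_abs] at this
        gcongr
        exact le_abs_self _
    refine ⟨fun q => ?_, fun q hq => (h0 q hq).fderiv⟩
    by_cases hq : ℓ q = 0
    · exact (h0 q hq).differentiableAt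
    · exact (h1.differentiableOn (by simp)).differentiableAt (hU.mem_nhds hq)
  induction n with
  | zero =>
    intro F _ _ h h1 h2 h3
    exact contDiff_zero.2 (key h h1 h2 h3).1.continuous
  | succ n ih =>
    intro F _ _ h h1 h2 h3
    obtain ⟨hd, hz⟩ := key h h1 h2 h3
    have : ContDiff ℝ (n + 1 : ℕ∞ω) h := by
      refine contDiff_succ_iff_fderiv.2 ⟨hd, by simp, ih (fderiv ℝ h) ?_ hz fun j => ?_⟩
      · exact h1.fderiv_of_isOpen hU (by simp)
      · obtain ⟨C, hC⟩ := h3 (j + 1)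
        refine ⟨C, fun q hq => ?_⟩
        have e : Set.EqOn (fderiv ℝ h) (fderivWithin ℝ h {q | ℓ q ≠ 0}) {q | ℓ q ≠ 0} :=
          fun x hx => (fderivWithin_of_isOpen hU hx).symm
        rw [iteratedFDerivWithin_congr e hq,
          norm_iteratedFDerivWithin_fderivWithin hU.uniqueDiffOn hq]
        exact hC q hq
    exact_mod_cast this

end Growth
end LightCone

namespace LightCone

/-- Euclidean space `ℝⁿ`. -/
abbrev Eucl (n : ℕ) : Type := EuclideanSpace ℝ (Fin n)

section Squeezed
variable (d : ℕ)

/-- The first coordinate `p⁺` of `(p⁺, p_⊥)`, as a continuous linear form. -/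
def plusForm : Eucl (d + 1) →L[ℝ] ℝ := EuclideanSpace.proj 0

/-- The open set `{p⁺ ≠ 0}`. -/
def offPlane : Set (Eucl (d + 1)) := {p | plusForm d p ≠ 0}

variable {d}

/-- The vector without its zeroth coordinate: the part `p_⊥` of `(p⁺, p_⊥)`, the part `𝐱` of
`x = (x⁰, 𝐱)`, and the part `(x_⊥, x⁻)` of `x̃ = (x⁺, x_⊥, x⁻)`. -/
def tail (p : Eucl (d + 1)) : Eucl d := WithLp.toLp 2 fun i => p i.succ

/-- A weight which is comparable to the maximum of `1 + ‖p‖` and `1 / |p⁺|`. -/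
def squeezeWeight (p : Eucl (d + 1)) : ℝ := 1 + ‖p‖ + |p 0|⁻¹

variable (d)

/-- The smooth functions `f` on `ℝⁿ`, `n = d + 1`, such that
`sup_{p⁺ ≠ 0} |p⁺|ᵏ ‖p_⊥‖ᵇ ‖Dʲ f(p)‖ < ∞` for all `k ∈ ℤ` and `b, j ∈ ℕ`. -/
def squeezedSubmodule : Submodule ℂ (Eucl (d + 1) → ℂ) where
  carrier := {f | ContDiff ℝ ∞ f ∧ ∀ (k : ℤ) (b j : ℕ), ∃ C : ℝ, ∀ p : Eucl (d + 1), p 0 ≠ 0 →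
    |p 0| ^ k * ‖tail p‖ ^ b * ‖iteratedFDeriv ℝ j f p‖ ≤ C}
  zero_mem' := ⟨contDiff_const, fun k b j => ⟨0, fun p _ => by
    simp [show (0 : Eucl (d + 1) → ℂ) = fun _ => 0 from rfl]⟩⟩
  add_mem' := by
    rintro f g ⟨hf, hf'⟩ ⟨hg, hg'⟩
    refine ⟨hf.add hg, fun k b j => ?_⟩
    obtain ⟨C, hC⟩ := hf' k b j
    obtain ⟨C', hC'⟩ := hg' k b j
    refine ⟨C + C', fun p hp => ?_⟩
    rw [iteratedFDeriv_add_apply (hf.contDiffAt.of_le (by exact_mod_cast le_top))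
      (hg.contDiffAt.of_le (by exact_mod_cast le_top))]
    calc _ ≤ |p 0| ^ k * ‖tail p‖ ^ b * (‖iteratedFDeriv ℝ j f p‖ + ‖iteratedFDeriv ℝ j g p‖) := by
          gcongr; exact norm_add_le _ _
      _ ≤ _ := by rw [mul_add]; exact add_le_add (hC p hp) (hC' p hp)
  smul_mem' := by
    rintro c f ⟨hf, hf'⟩
    refine ⟨contDiff_const.smul hf, fun k b j => ?_⟩
    obtain ⟨C, hC⟩ := hf' k b j
    refine ⟨‖c‖ * C, fun p hp => ?_⟩
    rw [iteratedFDeriv_const_smul_apply (hf.contDiffAt.of_le (by exact_mod_cast le_top)),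
      norm_smul, mul_left_comm]
    exact mul_le_mul_of_nonneg_left (hC p hp) (norm_nonneg _)

/-- The squeezed Schwartz space `𝓢_{p⁺}(ℝⁿ)`, `n = d + 1`. -/
def SqueezedSchwartz : Type := squeezedSubmodule d

namespace SqueezedSchwartz
variable {d}

instance : AddCommGroup (SqueezedSchwartz d) := inferInstanceAs (AddCommGroup (squeezedSubmodule d))
instance : Module ℂ (SqueezedSchwartz d) := inferInstanceAs (Module ℂ (squeezedSubmodule d))
instance : FunLike (SqueezedSchwartz d) (Eucl (d + 1)) ℂ where
  coe f := f.1
  coe_injective := Subtype.val_injective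

theorem ext {f g : SqueezedSchwartz d} (h : ∀ p, f p = g p) : f = g := DFunLike.ext _ _ h

theorem coe_add (f g : SqueezedSchwartz d) : ⇑(f + g) = ⇑f + ⇑g := rfl
theorem coe_smul (c : ℂ) (f : SqueezedSchwartz d) : ⇑(c • f) = c • ⇑f := rfl
theorem contDiff (f : SqueezedSchwartz d) : ContDiff ℝ ∞ f := f.2.1
theorem decay (f : SqueezedSchwartz d) (k : ℤ) (b j : ℕ) : ∃ C : ℝ, ∀ p : Eucl (d + 1), p 0 ≠ 0 →
    |p 0| ^ k * ‖tail p‖ ^ b * ‖iteratedFDeriv ℝ j f p‖ ≤ C := f.2.2 k b j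

theorem bddAbove (f : SqueezedSchwartz d) (k : ℤ) (b j : ℕ) :
    BddAbove (Set.range fun p : {p : Eucl (d + 1) // p 0 ≠ 0} =>
      |p.1 0| ^ k * ‖tail p.1‖ ^ b * ‖iteratedFDeriv ℝ j f p.1‖) := by
  obtain ⟨C, hC⟩ := f.decay k b j
  exact ⟨C, by rintro _ ⟨p, rfl⟩; exact hC p.1 p.2⟩

variable (d) in
/-- The seminorm `‖f‖_{k,b,j} = sup_{p⁺ ≠ 0} |p⁺|ᵏ ‖p_⊥‖ᵇ ‖Dʲ f(p)‖`. -/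
def seminorm (i : ℤ × ℕ × ℕ) : Seminorm ℂ (SqueezedSchwartz d) :=
  Seminorm.ofSMulLE
    (fun f => ⨆ p : {p : Eucl (d + 1) // p 0 ≠ 0},
      |p.1 0| ^ i.1 * ‖tail p.1‖ ^ i.2.1 * ‖iteratedFDeriv ℝ i.2.2 f p.1‖)
    (by
      refine le_antisymm (Real.iSup_le (fun p => ?_) le_rfl) (Real.iSup_nonneg fun p => by positivity)
      have : (⇑(0 : SqueezedSchwartz d)) = fun _ => 0 := rfl
      simp [this])
    (fun f g => by
      refine Real.iSup_le (fun p => ?_)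
        (add_nonneg (Real.iSup_nonneg fun p => by positivity) (Real.iSup_nonneg fun p => by positivity))
      rw [coe_add, iteratedFDeriv_add_apply (f.contDiff.contDiffAt.of_le (by exact_mod_cast le_top))
        (g.contDiff.contDiffAt.of_le (by exact_mod_cast le_top))]
      refine le_trans ?_ (add_le_add (le_ciSup (f.bddAbove i.1 i.2.1 i.2.2) p)
        (le_ciSup (g.bddAbove i.1 i.2.1 i.2.2) p))
      rw [← mul_add]
      gcongr
      exact norm_add_le _ _)
    (fun c f => by
      refine Real.iSup_le (fun p => ?_)
        (mul_nonneg (norm_nonneg _) (Real.iSup_nonneg fun p => by positivity))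
      rw [coe_smul, iteratedFDeriv_const_smul_apply
        (f.contDiff.contDiffAt.of_le (by exact_mod_cast le_top)), norm_smul, mul_left_comm]
      exact mul_le_mul_of_nonneg_left (le_ciSup (f.bddAbove i.1 i.2.1 i.2.2) p) (norm_nonneg _))

theorem le_seminorm (f : SqueezedSchwartz d) (k : ℤ) (b j : ℕ) {p : Eucl (d + 1)} (hp : p 0 ≠ 0) :
    |p 0| ^ k * ‖tail p‖ ^ b * ‖iteratedFDeriv ℝ j f p‖ ≤ seminorm d (k, b, j) f :=
  le_ciSup (f.bddAbove k b j) ⟨p, hp⟩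

theorem seminorm_le (f : SqueezedSchwartz d) (k : ℤ) (b j : ℕ) {C : ℝ} (hC : 0 ≤ C)
    (h : ∀ p : Eucl (d + 1), p 0 ≠ 0 →
      |p 0| ^ k * ‖tail p‖ ^ b * ‖iteratedFDeriv ℝ j f p‖ ≤ C) :
    seminorm d (k, b, j) f ≤ C :=
  Real.iSup_le (fun p => h p.1 p.2) hC

variable (d) in
/-- The seminorms defining the topology of the squeezed Schwartz space. -/
def seminormFamily : SeminormFamily ℂ (SqueezedSchwartz d) (ℤ × ℕ × ℕ) := fun i => seminorm d i

instance : TopologicalSpace (SqueezedSchwartz d) := (seminormFamily d).moduleFilterBasis.topology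

theorem withSeminorms : WithSeminorms (seminormFamily d) := ⟨rfl⟩

instance : IsTopologicalAddGroup (SqueezedSchwartz d) := withSeminorms.topologicalAddGroup
instance : ContinuousSMul ℂ (SqueezedSchwartz d) := withSeminorms.continuousSMul

end SqueezedSchwartz

variable {d}

theorem isOpen_offPlane : IsOpen (offPlane d) :=
  isOpen_ne_fun (plusForm d).continuous continuous_const

theorem mem_offPlane {p : Eucl (d + 1)} : p ∈ offPlane d ↔ p 0 ≠ 0 := Iff.rfl

theorem norm_sq_tail (p : Eucl (d + 1)) : ‖p‖ ^ 2 = p 0 ^ 2 + ‖tail p‖ ^ 2 := by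
  simp [EuclideanSpace.norm_sq_eq, Fin.sum_univ_succ, tail]

theorem norm_tail_le (p : Eucl (d + 1)) : ‖tail p‖ ≤ ‖p‖ :=
  abs_le_of_sq_le_sq' (by nlinarith [norm_sq_tail p, sq_nonneg (p 0)]) (norm_nonneg _) |>.2

theorem abs_plus_le (p : Eucl (d + 1)) : |p 0| ≤ ‖p‖ := by
  refine abs_le_of_sq_le_sq (by nlinarith [norm_sq_tail p, sq_nonneg ‖tail p‖]) (norm_nonneg _)

theorem norm_le_plus_tail (p : Eucl (d + 1)) : ‖p‖ ≤ |p 0| + ‖tail p‖ := by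
  refine abs_le_of_sq_le_sq' ?_ (by positivity) |>.2
  nlinarith [norm_sq_tail p, sq_abs (p 0), mul_nonneg (abs_nonneg (p 0)) (norm_nonneg (tail p))]

theorem one_add_norm_le_weight (p : Eucl (d + 1)) : 1 + ‖p‖ ≤ squeezeWeight p := by
  have : 0 ≤ |p 0|⁻¹ := by positivity
  simp only [squeezeWeight]; linarith

theorem one_le_weight (p : Eucl (d + 1)) : 1 ≤ squeezeWeight p := by
  linarith [one_add_norm_le_weight p, norm_nonneg p]

theorem inv_le_weight (p : Eucl (d + 1)) : |p 0|⁻¹ ≤ squeezeWeight p := by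
  simp only [squeezeWeight]; linarith [norm_nonneg p]

theorem iteratedFDerivWithin_offPlane (f : Eucl (d + 1) → ℂ) (j : ℕ) {p : Eucl (d + 1)}
    (hp : p ∈ offPlane d) :
    iteratedFDerivWithin ℝ j f (offPlane d) p = iteratedFDeriv ℝ j f p :=
  iteratedFDerivWithin_of_isOpen j isOpen_offPlane hp

/-- The weights in the seminorms are dominated by powers of `squeezeWeight`. -/
theorem zpow_mul_le_weight (k : ℤ) (b : ℕ) {p : Eucl (d + 1)} (hp : p 0 ≠ 0) :
    |p 0| ^ k * ‖tail p‖ ^ b ≤ squeezeWeight p ^ (k.natAbs + b) := by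
  have h1 := one_add_norm_le_weight p
  have h0 : 0 < |p 0| := abs_pos.2 hp
  rw [pow_add]
  have hb : ‖tail p‖ ≤ squeezeWeight p := by linarith [norm_tail_le p]
  have hk : |p 0| ^ k ≤ squeezeWeight p ^ k.natAbs := by
    rcases Int.natAbs_eq k with h | h
    · rw [h, zpow_natCast, Int.natAbs_natCast]
      gcongr
      linarith [abs_plus_le p]
    · rw [h, zpow_neg, zpow_natCast, Int.natAbs_neg, Int.natAbs_natCast, ← inv_pow]
      gcongr
      exact inv_le_weight p
  have := one_le_weight p
  gcongr

/-- Powers of `squeezeWeight` are dominated by four of the weights in the seminorms. -/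
theorem weight_pow_le (N : ℕ) {p : Eucl (d + 1)} (hp : p 0 ≠ 0) :
    squeezeWeight p ^ N ≤ 4 ^ N * (1 + |p 0| ^ (N : ℤ) + ‖tail p‖ ^ N + |p 0| ^ (-(N : ℤ))) := by
  have h0 : 0 < |p 0| := abs_pos.2 hp
  set M := max (max 1 |p 0|) (max ‖tail p‖ |p 0|⁻¹) with hM
  have h1 : squeezeWeight p ≤ 4 * M := by
    have a1 : 1 ≤ M := (le_max_left _ _).trans (le_max_left _ _)
    have a2 : |p 0| ≤ M := (le_max_right _ _).trans (le_max_left _ _)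
    have a3 : ‖tail p‖ ≤ M := (le_max_left _ _).trans (le_max_right _ _)
    have a4 : |p 0|⁻¹ ≤ M := (le_max_right _ _).trans (le_max_right _ _)
    simp only [squeezeWeight]
    linarith [norm_le_plus_tail p]
  have h2 : M ^ N ≤ 1 + |p 0| ^ (N : ℤ) + ‖tail p‖ ^ N + |p 0| ^ (-(N : ℤ)) := by
    rw [zpow_neg, zpow_natCast, ← inv_pow]
    have b2 : 0 ≤ |p 0| ^ N := by positivity
    have b3 : 0 ≤ ‖tail p‖ ^ N := by positivity
    have b4 : 0 ≤ |p 0|⁻¹ ^ N := by positivity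
    rcases max_choice (max 1 |p 0|) (max ‖tail p‖ |p 0|⁻¹) with h | h
    · rcases max_choice 1 |p 0| with h' | h' <;> rw [hM, h, h']
      · rw [one_pow]; linarith
      · linarith
    · rcases max_choice ‖tail p‖ |p 0|⁻¹ with h' | h' <;> rw [hM, h, h'] <;> linarith
  have := one_le_weight p
  calc squeezeWeight p ^ N ≤ (4 * M) ^ N := by gcongr
    _ = 4 ^ N * M ^ N := mul_pow _ _ _
    _ ≤ _ := by gcongr

namespace SqueezedSchwartz

/-- The finite set of indices whose seminorms control `squeezeWeight ^ N * ‖Dⁱ f‖`, `i ≤ j`. -/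
def ctrl (N j : ℕ) : Finset (ℤ × ℕ × ℕ) :=
  (({(0, 0), ((N : ℤ), 0), (0, N), (-(N : ℤ), 0)} : Finset (ℤ × ℕ)) ×ˢ Finset.range (j + 1)).image
    fun x => (x.1.1, x.1.2, x.2)

theorem weight_pow_mul_le (f : SqueezedSchwartz d) (N : ℕ) {i j : ℕ} (hij : i ≤ j)
    {p : Eucl (d + 1)} (hp : p ∈ offPlane d) :
    squeezeWeight p ^ N * ‖iteratedFDerivWithin ℝ i f (offPlane d) p‖ ≤
      4 ^ (N + 1) * ((ctrl N j).sup (seminormFamily d)) f := by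
  rw [iteratedFDerivWithin_offPlane _ _ hp]
  have hle : ∀ (k : ℤ) (b : ℕ), (k, b) ∈ ({(0, 0), ((N : ℤ), 0), (0, N), (-(N : ℤ), 0)} :
      Finset (ℤ × ℕ)) → |p 0| ^ k * ‖tail p‖ ^ b * ‖iteratedFDeriv ℝ i f p‖ ≤
        ((ctrl N j).sup (seminormFamily d)) f := by
    intro k b hkb
    refine (f.le_seminorm k b i (mem_offPlane.1 hp)).trans ?_
    have hm : (k, b, i) ∈ ctrl N j :=
      Finset.mem_image.2 ⟨((k, b), i), Finset.mem_product.2 ⟨hkb, Finset.mem_range.2 (by omega)⟩, rfl⟩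
    exact Seminorm.le_def.1 (Finset.le_sup (f := seminormFamily d) hm) f
  have e1 := hle 0 0 (by simp)
  have e2 := hle N 0 (by simp)
  have e3 := hle 0 N (by simp)
  have e4 := hle (-N) 0 (by simp)
  simp only [zpow_zero, pow_zero, one_mul, mul_one] at e1 e2 e3 e4
  refine (mul_le_mul_of_nonneg_right (weight_pow_le N (mem_offPlane.1 hp)) (norm_nonneg _)).trans ?_
  rw [mul_assoc, pow_succ, mul_assoc]
  refine mul_le_mul_of_nonneg_left ?_ (by positivity)
  linarith

/-- A smooth function on `{p⁺ ≠ 0}`, extended by zero, all of whose derivatives decay faster than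
any power of `squeezeWeight`, is a squeezed Schwartz function. -/
def ofBound (h : Eucl (d + 1) → ℂ) (hs : ContDiffOn ℝ ∞ h (offPlane d))
    (h0 : ∀ p : Eucl (d + 1), p 0 = 0 → h p = 0)
    (hb : ∀ N j : ℕ, ∃ C : ℝ, ∀ p ∈ offPlane d,
      squeezeWeight p ^ N * ‖iteratedFDerivWithin ℝ j h (offPlane d) p‖ ≤ C) :
    SqueezedSchwartz d :=
  ⟨h, by
    refine contDiff_infty.2 fun n => contDiff_of_flat (plusForm d) n h hs h0 fun j => ?_
    obtain ⟨C, hC⟩ := hb 2 j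
    refine ⟨C, fun q hq => ?_⟩
    have hq0 : 0 < |q 0| := abs_pos.2 hq
    have h1 : 1 ≤ squeezeWeight q ^ 2 * |q 0| ^ 2 := by
      rw [← mul_pow]
      refine one_le_pow₀ ?_
      have := inv_le_weight q
      calc (1 : ℝ) = |q 0|⁻¹ * |q 0| := by field_simp
        _ ≤ _ := by gcongr
    calc ‖iteratedFDerivWithin ℝ j h (offPlane d) q‖
        ≤ (squeezeWeight q ^ 2 * |q 0| ^ 2) * ‖iteratedFDerivWithin ℝ j h (offPlane d) q‖ :=
          le_mul_of_one_le_left (norm_nonneg _) h1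
      _ = (squeezeWeight q ^ 2 * ‖iteratedFDerivWithin ℝ j h (offPlane d) q‖) * |q 0| ^ 2 := by ring
      _ ≤ C * |q 0| ^ 2 := by gcongr; exact hC q hq, by
    intro k b j
    obtain ⟨C, hC⟩ := hb (k.natAbs + b) j
    refine ⟨C, fun p hp => ?_⟩
    have := hC p hp
    rw [iteratedFDerivWithin_offPlane _ _ (mem_offPlane.2 hp)] at this
    exact (mul_le_mul_of_nonneg_right (zpow_mul_le_weight k b hp) (norm_nonneg _)).trans this⟩

theorem seminorm_le_of_weight (g : SqueezedSchwartz d) (k : ℤ) (b j : ℕ) {C : ℝ}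
    (hC0 : 0 ≤ C) (hC : ∀ p ∈ offPlane d,
      squeezeWeight p ^ (k.natAbs + b) * ‖iteratedFDerivWithin ℝ j g (offPlane d) p‖ ≤ C) :
    seminorm d (k, b, j) g ≤ C := by
  refine seminorm_le _ _ _ _ hC0 fun p hp => ?_
  have := hC p hp
  rw [iteratedFDerivWithin_offPlane _ _ (mem_offPlane.2 hp)] at this
  exact (mul_le_mul_of_nonneg_right (zpow_mul_le_weight k b hp) (norm_nonneg _)).trans this

end SqueezedSchwartz
end Squeezed
end LightCone

namespace LightCone

section Growth2
variable {V W F G : Type} [NormedAddCommGroup V] [NormedSpace ℝ V]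
  [NormedAddCommGroup W] [NormedSpace ℝ W] [NormedAddCommGroup F] [NormedSpace ℝ F]
  [NormedAddCommGroup G] [NormedSpace ℝ G]

theorem ModerateOn.congr {U : Set V} {ρ : V → ℝ} {f g : V → F} (hf : ModerateOn U ρ f)
    (h : Set.EqOn g f U) : ModerateOn U ρ g := by
  refine ⟨hf.1.congr h, fun j => ?_⟩
  obtain ⟨N, C, hC, hb⟩ := hf.2 j
  exact ⟨N, C, hC, fun i hi x hx => by rw [iteratedFDerivWithin_congr h hx]; exact hb i hi x hx⟩

theorem ModerateOn.clm {U : Set V} (hU : IsOpen U) {ρ : V → ℝ} (L : F →L[ℝ] G) {f : V → F}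
    (hf : ModerateOn U ρ f) : ModerateOn U ρ (fun x => L (f x)) := by
  refine ⟨L.contDiff.comp_contDiffOn hf.1, fun j => ?_⟩
  obtain ⟨N, C, hC, hb⟩ := hf.2 j
  refine ⟨N, ‖L‖ * C, by positivity, fun i hi x hx => ?_⟩
  refine (L.norm_iteratedFDerivWithin_comp_left (hf.1 x hx) hU.uniqueDiffOn hx
    (by exact_mod_cast le_top)).trans ?_
  rw [mul_assoc]
  exact mul_le_mul_of_nonneg_left (hb i hi x hx) (norm_nonneg L)

theorem ModerateOn.mul {U : Set V} (hU : IsOpen U) {ρ : V → ℝ} (hρ : ∀ x ∈ U, 1 ≤ ρ x)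
    {f g : V → ℝ} (hf : ModerateOn U ρ f) (hg : ModerateOn U ρ g) :
    ModerateOn U ρ (fun x => f x * g x) :=
  hf.bilin hU hρ (ContinuousLinearMap.mul ℝ ℝ) hg

theorem ModerateOn.ofReal {U : Set V} (hU : IsOpen U) {ρ : V → ℝ} {f : V → ℝ}
    (hf : ModerateOn U ρ f) : ModerateOn U ρ (fun x => (f x : ℂ)) :=
  hf.clm hU Complex.ofRealCLM

theorem ModerateOn.eucl {U : Set V} (hU : IsOpen U) {ρ : V → ℝ} (hρ : ∀ x ∈ U, 1 + ‖x‖ ≤ ρ x)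
    {n : ℕ} {f : V → Eucl n} (hf : ∀ i, ModerateOn U ρ (fun x => f x i)) : ModerateOn U ρ f := by
  have hρ1 : ∀ x ∈ U, 1 ≤ ρ x := fun x hx => by linarith [hρ x hx, norm_nonneg x]
  have h : ∀ s : Finset (Fin n),
      ModerateOn U ρ (fun x => ∑ i ∈ s, f x i • EuclideanSpace.single i (1 : ℝ)) := by
    intro s
    classical
    induction s using Finset.induction_on with
    | empty => simpa using ModerateOn.of_temperate hU hρ (.const (0 : Eucl n))
    | insert a s ha ih =>
      simp only [Finset.sum_insert ha]
      exact .add hU hρ1 ((hf a).clm hU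
        ((ContinuousLinearMap.id ℝ ℝ).smulRight (EuclideanSpace.single a (1 : ℝ)))) ih
  refine (h Finset.univ).congr fun x _ => ?_
  ext j
  simp [Pi.single_apply]

theorem ModerateOn.norm_le {U : Set V} {ρ : V → ℝ} {f : V → F} (hf : ModerateOn U ρ f) :
    ∃ (N : ℕ) (C : ℝ), ∀ x ∈ U, ‖f x‖ ≤ C * ρ x ^ N := by
  obtain ⟨N, C, -, h⟩ := hf.2 0
  exact ⟨N, C, fun x hx => by simpa using h 0 le_rfl x hx⟩

theorem ModerateOn.temperate_comp {U : Set V} (hU : IsOpen U) {ρ : V → ℝ} (hρ : ∀ x ∈ U, 1 ≤ ρ x)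
    {φ : V → W} (hφ : ModerateOn U ρ φ) {f : W → F} (hf : f.HasTemperateGrowth) :
    ModerateOn U ρ (fun x => f (φ x)) := by
  obtain ⟨N, C, hC⟩ := hφ.norm_le
  refine hφ.comp (ρ' := fun y => 1 + ‖y‖) (k := N) (C₀ := 1 + C) hU isOpen_univ hρ
    (fun x _ => by linarith [norm_nonneg x])
    (.of_temperate isOpen_univ (fun _ _ => le_rfl) hf) (Set.mapsTo_univ _ _) fun x hx => ?_
  have h1 : 1 ≤ ρ x ^ N := one_le_pow₀ (hρ x hx)
  linarith [hC x hx]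

/-- The weight `1 + |x| + 1 / |x|` on the punctured line. -/
def lineWeight (x : ℝ) : ℝ := 1 + ‖x‖ + ‖x‖⁻¹

theorem one_add_norm_le_lineWeight (x : ℝ) : 1 + ‖x‖ ≤ lineWeight x := by
  have : 0 ≤ ‖x‖⁻¹ := by positivity
  simp only [lineWeight]; linarith

theorem isOpen_punctured : IsOpen {x : ℝ | x ≠ 0} := isOpen_ne

theorem moderateOn_inv : ModerateOn {x : ℝ | x ≠ 0} lineWeight (fun x : ℝ => x⁻¹) := by
  have h1 : ∀ x : ℝ, 1 ≤ lineWeight x := fun x => by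
    linarith [one_add_norm_le_lineWeight x, norm_nonneg x]
  refine .of_bound (fun x _ => h1 x) (contDiffOn_inv ℝ) fun j => ⟨j + 1, j.factorial, fun x hx => ?_⟩
  rw [iteratedFDerivWithin_of_isOpen j isOpen_punctured hx, norm_iteratedFDeriv_eq_norm_iteratedDeriv,
    iteratedDeriv_eq_iterate]
  have e : deriv^[j] (fun x : ℝ => x⁻¹) x = (-1) ^ j * j.factorial * x ^ (-1 - j : ℤ) := by
    simp [iter_deriv_inv' (𝕜 := ℝ) j]
  have e2 : ‖x ^ (-1 - j : ℤ)‖ = ‖x‖⁻¹ ^ (j + 1) := by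
    rw [norm_zpow, show (-1 - j : ℤ) = -((j + 1 : ℕ) : ℤ) by push_cast; ring, zpow_neg,
      zpow_natCast, inv_pow]
  rw [e, norm_mul, norm_mul, norm_pow, norm_neg, norm_one, one_pow, one_mul, e2,
    RCLike.norm_natCast]
  gcongr
  simp only [lineWeight]
  linarith [norm_nonneg x]

theorem moderateOn_step (a b : ℝ) :
    ModerateOn {x : ℝ | x ≠ 0} lineWeight (fun x : ℝ => if 0 < x then a else b) := by
  have hloc : ∀ x : ℝ, x ≠ 0 → ∃ c, (|c| ≤ |a| + |b|) ∧
      (fun x : ℝ => if 0 < x then a else b) =ᶠ[nhds x] fun _ => c := by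
    intro x hx
    rcases lt_or_gt_of_ne hx with h | h
    · refine ⟨b, by linarith [abs_nonneg a], ?_⟩
      filter_upwards [eventually_lt_nhds h] with y hy
      rw [if_neg (by linarith)]
    · refine ⟨a, by linarith [abs_nonneg b], ?_⟩
      filter_upwards [eventually_gt_nhds h] with y hy
      rw [if_pos hy]
  refine .of_bound (fun x _ => ?_) (fun x hx => ?_) fun j => ⟨0, |a| + |b|, fun x hx => ?_⟩
  · linarith [one_add_norm_le_lineWeight x, norm_nonneg x]
  · obtain ⟨c, -, hc⟩ := hloc x hx
    exact (contDiffAt_const.congr_of_eventuallyEq hc).contDiffWithinAt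
  · obtain ⟨c, hc', hc⟩ := hloc x hx
    rw [iteratedFDerivWithin_of_isOpen j isOpen_punctured hx, (hc.iteratedFDeriv ℝ j).eq_of_nhds,
      pow_zero, mul_one]
    rcases Nat.eq_zero_or_pos j with rfl | hj
    · rw [norm_iteratedFDeriv_zero]; exact hc'
    · rw [iteratedFDeriv_const_of_ne hj.ne']
      simp only [Pi.zero_apply, norm_zero]
      positivity

variable {d : ℕ}

theorem moderateOn_plus {f : ℝ → ℝ} (hf : ModerateOn {x : ℝ | x ≠ 0} lineWeight f) :
    ModerateOn (offPlane d) squeezeWeight (fun p => f (p 0)) := by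
  refine ModerateOn.comp (φ := fun p : Eucl (d + 1) => p 0) (k := 1) (C₀ := 1)
    isOpen_offPlane isOpen_punctured (fun x _ => one_le_weight x)
    (fun x _ => by linarith [one_add_norm_le_lineWeight x, norm_nonneg x])
    (.of_temperate isOpen_offPlane (fun x _ => one_add_norm_le_weight x)
      (plusForm d).hasTemperateGrowth) hf (fun x hx => hx) fun p hp => ?_
  simp only [lineWeight, squeezeWeight, Real.norm_eq_abs]
  linarith [abs_plus_le p]

theorem moderateOn_temperate {f : Eucl (d + 1) → F} (hf : f.HasTemperateGrowth) :
    ModerateOn (offPlane d) squeezeWeight f :=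
  .of_temperate isOpen_offPlane (fun x _ => one_add_norm_le_weight x) hf

theorem moderateOn_abs : ModerateOn {x : ℝ | x ≠ 0} lineWeight (fun x : ℝ => |x|) := by
  refine ((moderateOn_step 1 (-1)).mul isOpen_punctured (fun x _ => by
    linarith [one_add_norm_le_lineWeight x, norm_nonneg x]) (.of_temperate isOpen_punctured
    (fun x _ => one_add_norm_le_lineWeight x) .id)).congr fun x hx => ?_
  rcases lt_or_gt_of_ne hx with h | h
  · simp [not_lt.2 h.le, abs_of_neg h]
  · simp [h, abs_of_pos h]

theorem moderateOn_abs_inv : ModerateOn {x : ℝ | x ≠ 0} lineWeight (fun x : ℝ => |x|⁻¹) := by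
  refine ((moderateOn_step 1 (-1)).mul isOpen_punctured (fun x _ => by
    linarith [one_add_norm_le_lineWeight x, norm_nonneg x]) moderateOn_inv).congr fun x hx => ?_
  rcases lt_or_gt_of_ne hx with h | h
  · simp [not_lt.2 h.le, abs_of_neg h, inv_neg]
  · simp [h, abs_of_pos h]

end Growth2

section Transfer
variable {W X ι : Type} [NormedAddCommGroup W] [NormedSpace ℝ W] [AddCommGroup X] [Module ℂ X]
  [TopologicalSpace X] {d : ℕ}

/-- The operator `f ↦ w • (f ∘ φ)`, extended by zero to `{p⁺ = 0}`, with values in the squeezed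
Schwartz space. -/
def toSqueezed {q : SeminormFamily ℂ X ι} (hq : WithSeminorms q) (ev : X →ₗ[ℂ] (W → ℂ))
    {U' : Set W} (hU' : IsOpen U') {ρ' : W → ℝ} (hρ' : ∀ y ∈ U', 1 ≤ ρ' y)
    (hev : ∀ f, ContDiffOn ℝ ∞ (ev f) U')
    (hctrl : ∀ N j : ℕ, ∃ (s : Finset ι) (C : ℝ), 0 ≤ C ∧ ∀ f : X, ∀ i ≤ j, ∀ y ∈ U',
      ρ' y ^ N * ‖iteratedFDerivWithin ℝ i (ev f) U' y‖ ≤ C * (s.sup q) f)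
    {φ : Eucl (d + 1) → W} (hφ : ModerateOn (offPlane d) squeezeWeight φ)
    {w : Eucl (d + 1) → ℂ} (hw : ModerateOn (offPlane d) squeezeWeight w)
    (hm : Set.MapsTo φ (offPlane d) U')
    (hk : ∃ (k : ℕ) (C₀ : ℝ), ∀ p ∈ offPlane d, squeezeWeight p ≤ C₀ * ρ' (φ p) ^ k) :
    X →L[ℂ] SqueezedSchwartz d :=
  have key : ∀ N j : ℕ, ∃ (s : Finset ι) (C : ℝ), 0 ≤ C ∧ ∀ f : X, ∀ p ∈ offPlane d,
      squeezeWeight p ^ N * ‖iteratedFDerivWithin ℝ j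
        (fun p => if p 0 = 0 then 0 else w p * ev f (φ p)) (offPlane d) p‖ ≤ C * (s.sup q) f := by
    intro N j
    obtain ⟨k, C₀, hk⟩ := hk
    obtain ⟨N', C, hC, h⟩ := ModerateOn.weighted_comp_bound isOpen_offPlane hU'
      (fun x _ => one_le_weight x) hρ' hφ hw hm hk j N
    obtain ⟨s, C', hC', h'⟩ := hctrl N' j
    refine ⟨s, C * C', by positivity, fun f p hp => ?_⟩
    have e : Set.EqOn (fun p => if p 0 = 0 then 0 else w p * ev f (φ p))
        (fun p => w p * ev f (φ p)) (offPlane d) := fun p hp => if_neg hp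
    rw [iteratedFDerivWithin_congr e hp, mul_assoc]
    exact h (ev f) (hev f) _ (mul_nonneg hC' (apply_nonneg _ _)) (h' f) p hp
  let T : X →ₗ[ℂ] SqueezedSchwartz d :=
  { toFun := fun f => SqueezedSchwartz.ofBound (fun p => if p 0 = 0 then 0 else w p * ev f (φ p))
      (((hw.contDiffOn.mul ((hev f).comp hφ.contDiffOn hm))).congr fun p hp => if_neg hp)
      (fun p hp => if_pos hp)
      (fun N j => by
        obtain ⟨s, C, -, h⟩ := key N j
        exact ⟨_, h f⟩)
    map_add' := fun f g => SqueezedSchwartz.ext fun p => by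
      change (if p 0 = 0 then 0 else w p * ev (f + g) (φ p)) =
        (if p 0 = 0 then 0 else w p * ev f (φ p)) + (if p 0 = 0 then 0 else w p * ev g (φ p))
      rw [map_add]
      split_ifs <;> simp [mul_add]
    map_smul' := fun c f => SqueezedSchwartz.ext fun p => by
      change (if p 0 = 0 then 0 else w p * ev (c • f) (φ p)) =
        c * (if p 0 = 0 then 0 else w p * ev f (φ p))
      rw [map_smul]
      split_ifs <;> simp [mul_left_comm] }
  { T with
    cont := by
      refine WithSeminorms.continuous_of_isBounded hq SqueezedSchwartz.withSeminorms T fun i => ?_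
      obtain ⟨s, C, hC, h⟩ := key (i.1.natAbs + i.2.1) i.2.2
      exact ⟨s, ⟨C, hC⟩, fun f => SqueezedSchwartz.seminorm_le_of_weight (T f) _ _ _
        (mul_nonneg hC (apply_nonneg _ _)) (h f)⟩ }

/-- Evaluation of squeezed Schwartz functions as a linear map. -/
def SqueezedSchwartz.coeLM : SqueezedSchwartz d →ₗ[ℂ] (Eucl (d + 1) → ℂ) where
  toFun f := f
  map_add' _ _ := rfl
  map_smul' _ _ := rfl

/-- Evaluation of Schwartz functions as a linear map. -/
def schwartzCoeLM (W : Type) [NormedAddCommGroup W] [NormedSpace ℝ W] :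
    𝓢(W, ℂ) →ₗ[ℂ] (W → ℂ) where
  toFun f := f
  map_add' _ _ := rfl
  map_smul' _ _ := rfl

theorem SqueezedSchwartz.ctrl_bound (N j : ℕ) : ∃ (s : Finset (ℤ × ℕ × ℕ)) (C : ℝ), 0 ≤ C ∧
    ∀ f : SqueezedSchwartz d, ∀ i ≤ j, ∀ y ∈ offPlane d,
      squeezeWeight y ^ N * ‖iteratedFDerivWithin ℝ i (coeLM f) (offPlane d) y‖ ≤
        C * (s.sup (seminormFamily d)) f :=
  ⟨ctrl N j, 4 ^ (N + 1), by positivity, fun f _ hi _ hy => f.weight_pow_mul_le N hi hy⟩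

theorem schwartz_ctrl_bound (N j : ℕ) : ∃ (s : Finset (ℕ × ℕ)) (C : ℝ), 0 ≤ C ∧
    ∀ f : 𝓢(W, ℂ), ∀ i ≤ j, ∀ y ∈ (Set.univ : Set W),
      (1 + ‖y‖) ^ N * ‖iteratedFDerivWithin ℝ i (schwartzCoeLM W f) Set.univ y‖ ≤
        C * (s.sup (schwartzSeminormFamily ℂ W ℂ)) f :=
  ⟨Finset.Iic (N, j), 2 ^ N, by positivity, fun f i hi y _ => by
    rw [iteratedFDerivWithin_univ]
    exact SchwartzMap.one_add_le_sup_seminorm_apply (𝕜 := ℂ) (m := (N, j)) le_rfl hi f y⟩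

/-- The operator `f ↦ w • (f ∘ φ)` from squeezed Schwartz functions to Schwartz functions. -/
def squeezedPull {φ : W → Eucl (d + 1)} (hφ : ModerateOn Set.univ (fun x => 1 + ‖x‖) φ)
    {w : W → ℂ} (hw : ModerateOn Set.univ (fun x => 1 + ‖x‖) w)
    (hm : Set.MapsTo φ Set.univ (offPlane d))
    (hk : ∃ (k : ℕ) (C₀ : ℝ), ∀ x ∈ (Set.univ : Set W), 1 + ‖x‖ ≤ C₀ * squeezeWeight (φ x) ^ k) :
    SqueezedSchwartz d →L[ℂ] 𝓢(W, ℂ) :=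
  have key : ∀ N j : ℕ, ∃ (s : Finset (ℤ × ℕ × ℕ)) (C : ℝ), 0 ≤ C ∧ ∀ f : SqueezedSchwartz d,
      ∀ x : W, ‖x‖ ^ N * ‖iteratedFDeriv ℝ j (fun x => w x * f (φ x)) x‖ ≤
        C * (s.sup (SqueezedSchwartz.seminormFamily d)) f := by
    intro N j
    obtain ⟨k, C₀, hk⟩ := hk
    obtain ⟨N', C, hC, h⟩ := ModerateOn.weighted_comp_bound isOpen_univ isOpen_offPlane
      (fun x _ => by linarith [norm_nonneg x]) (fun x _ => one_le_weight x) hφ hw hm hk j N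
    obtain ⟨s, C', hC', h'⟩ := SqueezedSchwartz.ctrl_bound (d := d) N' j
    refine ⟨s, C * C', by positivity, fun f x => ?_⟩
    have := h f f.contDiff.contDiffOn _ (mul_nonneg hC' (apply_nonneg _ _)) (h' f) x
      (Set.mem_univ x)
    rw [iteratedFDerivWithin_univ, ← mul_assoc] at this
    refine le_trans ?_ this
    gcongr
    linarith
  let T : SqueezedSchwartz d →ₗ[ℂ] 𝓢(W, ℂ) :=
  { toFun := fun f => ⟨fun x => w x * f (φ x), by
      have h1 := contDiffOn_univ.1 hφ.contDiffOn
      have h2 := contDiffOn_univ.1 hw.contDiffOn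
      exact h2.mul (f.contDiff.comp h1), fun N j => by
        obtain ⟨s, C, -, h⟩ := key N j
        exact ⟨_, h f⟩⟩
    map_add' := fun f g => SchwartzMap.ext fun x => mul_add _ _ _
    map_smul' := fun c f => SchwartzMap.ext fun x => mul_left_comm _ _ _ }
  { T with
    cont := by
      refine WithSeminorms.continuous_of_isBounded SqueezedSchwartz.withSeminorms
        (schwartz_withSeminorms ℂ W ℂ) T fun i => ?_
      obtain ⟨s, C, hC, h⟩ := key i.1 i.2
      exact ⟨s, ⟨C, hC⟩, fun f => SchwartzMap.seminorm_le_bound ℂ _ _ _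
        (mul_nonneg hC (apply_nonneg _ _)) (h f)⟩ }

theorem dense_offPlane : Dense (offPlane d) := by
  have h : (offPlane d) = ((LinearMap.ker (plusForm d).toLinearMap : Set (Eucl (d + 1))))ᶜ := by
    ext p; simp [offPlane]
  rw [h, ← interior_eq_empty_iff_dense_compl]
  by_contra hne
  have := Submodule.eq_top_of_nonempty_interior' _ (Set.nonempty_iff_ne_empty.2 hne)
  have h1 : EuclideanSpace.single (0 : Fin (d + 1)) (1 : ℝ) ∈
      LinearMap.ker (plusForm d).toLinearMap := by rw [this]; trivial
  simp [plusForm] at h1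

/-- The inclusion of the squeezed Schwartz space into the Schwartz space. -/
def SqueezedSchwartz.toSchwartz : SqueezedSchwartz d →L[ℂ] 𝓢(Eucl (d + 1), ℂ) :=
  have key : ∀ N j : ℕ, ∃ (s : Finset (ℤ × ℕ × ℕ)) (C : ℝ), 0 ≤ C ∧ ∀ f : SqueezedSchwartz d,
      ∀ x : Eucl (d + 1), ‖x‖ ^ N * ‖iteratedFDeriv ℝ j f x‖ ≤
        C * (s.sup (SqueezedSchwartz.seminormFamily d)) f := by
    intro N j
    obtain ⟨s, C', hC', h'⟩ := SqueezedSchwartz.ctrl_bound (d := d) N j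
    refine ⟨s, C', hC', fun f x => ?_⟩
    have hcl : IsClosed {x : Eucl (d + 1) | ‖x‖ ^ N * ‖iteratedFDeriv ℝ j f x‖ ≤
        C' * (s.sup (SqueezedSchwartz.seminormFamily d)) f} :=
      isClosed_le ((continuous_norm.pow N).mul
        (f.contDiff.continuous_iteratedFDeriv (by exact_mod_cast le_top)).norm) continuous_const
    refine hcl.closure_subset_iff.2 (fun y hy => ?_) (dense_offPlane x)
    have := h' f j le_rfl y hy
    rw [iteratedFDerivWithin_offPlane _ _ hy] at this
    refine le_trans ?_ this
    change _ ≤ squeezeWeight y ^ N * ‖iteratedFDeriv ℝ j f y‖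
    gcongr
    linarith [one_add_norm_le_weight y]
  let T : SqueezedSchwartz d →ₗ[ℂ] 𝓢(Eucl (d + 1), ℂ) :=
  { toFun := fun f => ⟨f, f.contDiff, fun N j => by
        obtain ⟨s, C, -, h⟩ := key N j
        exact ⟨_, h f⟩⟩
    map_add' := fun f g => rfl
    map_smul' := fun c f => rfl }
  { T with
    cont := by
      refine WithSeminorms.continuous_of_isBounded SqueezedSchwartz.withSeminorms
        (schwartz_withSeminorms ℂ _ ℂ) T fun i => ?_
      obtain ⟨s, C, hC, h⟩ := key i.1 i.2
      exact ⟨s, ⟨C, hC⟩, fun f => SchwartzMap.seminorm_le_bound ℂ _ _ _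
        (mul_nonneg hC (apply_nonneg _ _)) (h f)⟩ }

/-- Multiplication of squeezed Schwartz functions by a function on `{p⁺ ≠ 0}` which is smooth there
with derivatives bounded by powers of `1 + ‖p‖ + 1 / |p⁺|`. -/
def squeezedMul {M : Eucl (d + 1) → ℂ} (hM : ModerateOn (offPlane d) squeezeWeight M) :
    SqueezedSchwartz d →L[ℂ] SqueezedSchwartz d :=
  toSqueezed SqueezedSchwartz.withSeminorms SqueezedSchwartz.coeLM isOpen_offPlane
    (fun y _ => one_le_weight y) (fun f => f.contDiff.contDiffOn) SqueezedSchwartz.ctrl_bound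
    (moderateOn_temperate .id) hM (Set.mapsTo_id _)
    ⟨1, 1, fun p _ => by simp⟩

theorem squeezedMul_apply {M : Eucl (d + 1) → ℂ} (hM : ModerateOn (offPlane d) squeezeWeight M)
    (f : SqueezedSchwartz d) {p : Eucl (d + 1)} (hp : p 0 ≠ 0) :
    squeezedMul hM f p = M p * f p := if_neg hp

end Transfer
end LightCone

namespace LightCone

/-! ### Mass shells, light-cone coordinates and the squeezing maps -/

section Geometry
variable {d : ℕ}

/-- The energy `ω(𝐩) = √(𝐩² + m²)`. -/
def omega (m : ℝ) {n : ℕ} (p : Eucl n) : ℝ := √(‖p‖ ^ 2 + m ^ 2)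

/-- The light-cone energy `ω̃(p⁺, p_⊥) = (p_⊥² + m²) / (2 p⁺)`. -/
def omegaLC (m : ℝ) (q : Eucl (d + 1)) : ℝ := (‖tail q‖ ^ 2 + m ^ 2) / (2 * q 0)

/-- The underlying function of the change to light-cone coordinates. -/
def kappaFun (x : Eucl (d + 2)) : Eucl (d + 2) := WithLp.toLp 2 fun i =>
  if i = 0 then (x 0 + x (Fin.last (d + 1))) / √2
  else if i = Fin.last (d + 1) then (x 0 - x (Fin.last (d + 1))) / √2
  else x i

theorem kappaFun_zero (x : Eucl (d + 2)) :
    kappaFun x 0 = (x 0 + x (Fin.last (d + 1))) / √2 := by simp [kappaFun]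

theorem kappaFun_last (x : Eucl (d + 2)) :
    kappaFun x (Fin.last (d + 1)) = (x 0 - x (Fin.last (d + 1))) / √2 := by
  simp [kappaFun, (Fin.last_pos (n := d)).ne']

theorem kappaFun_mid (x : Eucl (d + 2)) (i : Fin d) :
    kappaFun x i.castSucc.succ = x i.castSucc.succ := by
  have h : i.castSucc.succ ≠ Fin.last (d + 1) := by
    have := i.2
    simp only [ne_eq, Fin.ext_iff, Fin.val_succ, Fin.val_castSucc, Fin.val_last]
    omega
  simp [kappaFun, h, Fin.succ_ne_zero]

theorem eucl_ext {x y : Eucl (d + 2)} (h0 : x 0 = y 0)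
    (h1 : ∀ i : Fin d, x i.castSucc.succ = y i.castSucc.succ)
    (h2 : x (Fin.last (d + 1)) = y (Fin.last (d + 1))) : x = y := by
  ext i
  induction i using Fin.cases with
  | zero => exact h0
  | succ i =>
    induction i using Fin.lastCases with
    | last => exact h2
    | cast i => exact h1 i

theorem kappaFun_kappaFun (x : Eucl (d + 2)) : kappaFun (kappaFun x) = x := by
  have h2 : √2 * √2 = 2 := Real.mul_self_sqrt (by norm_num)
  have h0 : √2 ≠ 0 := by positivity
  refine eucl_ext ?_ (fun i => ?_) ?_
  · rw [kappaFun_zero, kappaFun_zero, kappaFun_last]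
    field_simp
    rw [Real.sq_sqrt (by norm_num)]; ring
  · rw [kappaFun_mid, kappaFun_mid]
  · rw [kappaFun_last, kappaFun_zero, kappaFun_last]
    field_simp
    rw [Real.sq_sqrt (by norm_num)]; ring

variable (d) in
/-- The change to light-cone coordinates `κ(x) = (x⁺, x_⊥, x⁻)`, `x^± = (x⁰ ± xⁿ) / √2`, on
`ℝ^{1+n}`, `n = d + 1`. It is a linear isometry for the Euclidean norm, so it preserves Lebesgue
measure. -/
def kappa : Eucl (d + 2) ≃ₗᵢ[ℝ] Eucl (d + 2) where
  toFun := kappaFun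
  invFun := kappaFun
  left_inv := kappaFun_kappaFun
  right_inv := kappaFun_kappaFun
  map_add' x y := by
    refine eucl_ext ?_ (fun i => ?_) ?_
    · simp only [kappaFun_zero, PiLp.add_apply]; ring
    · simp only [kappaFun_mid, PiLp.add_apply]
    · simp only [kappaFun_last, PiLp.add_apply]; ring
  map_smul' c x := by
    refine eucl_ext ?_ (fun i => ?_) ?_
    · simp only [kappaFun_zero, PiLp.smul_apply, smul_eq_mul, RingHom.id_apply]; ring
    · simp only [kappaFun_mid, PiLp.smul_apply, RingHom.id_apply]
    · simp only [kappaFun_last, PiLp.smul_apply, smul_eq_mul, RingHom.id_apply]; ring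
  norm_map' x := by
    change ‖kappaFun x‖ = ‖x‖
    rw [← sq_eq_sq₀ (norm_nonneg _) (norm_nonneg _), EuclideanSpace.norm_sq_eq,
      EuclideanSpace.norm_sq_eq]
    simp only [Fin.sum_univ_succ (n := d + 1), Fin.sum_univ_castSucc (n := d), Fin.succ_last,
      kappaFun_zero, kappaFun_mid, kappaFun_last, Real.norm_eq_abs, sq_abs, div_pow,
      Real.sq_sqrt (show (0 : ℝ) ≤ 2 by norm_num)]
    ring

/-- The parametrization `Ω̃(p⁺, p_⊥) = (p⁺, p_⊥, ω̃(p⁺, p_⊥))` of the light-cone mass shell. -/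
def OmegaLC (m : ℝ) (q : Eucl (d + 1)) : Eucl (d + 2) :=
  WithLp.toLp 2 (Fin.snoc (α := fun _ => ℝ) (fun i => q i) (omegaLC m q))

/-- The squeezing maps: on `{±p⁺ > 0}` this is `ν_{≷0} = Ω_±⁻¹ ∘ κ⁻¹ ∘ Ω̃_±`, where `Ω_±⁻¹` is the
projection `(p⁰, 𝐩) ↦ 𝐩`. -/
def nu (m : ℝ) (q : Eucl (d + 1)) : Eucl (d + 1) := tail ((kappa d).symm (OmegaLC m q))

/-- The maps `μ_{≷0}(𝐩) = (p⁺, p_⊥) = ((pⁿ ± ω(𝐩)) / √2, p¹, …, pⁿ⁻¹)`, with the sign `ε`. -/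
def mu (ε : ℤˣ) (m : ℝ) (p : Eucl (d + 1)) : Eucl (d + 1) :=
  WithLp.toLp 2 (Fin.cons (α := fun _ => ℝ) ((p (Fin.last d) + ((ε : ℤ) : ℝ) * omega m p) / √2)
    fun i : Fin d => p i.castSucc)

theorem mu_zero (ε : ℤˣ) (m : ℝ) (p : Eucl (d + 1)) :
    mu ε m p 0 = (p (Fin.last d) + ((ε : ℤ) : ℝ) * omega m p) / √2 := rfl

theorem mu_succ (ε : ℤˣ) (m : ℝ) (p : Eucl (d + 1)) (i : Fin d) :
    mu ε m p i.succ = p i.castSucc := rfl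

theorem nu_last (m : ℝ) (q : Eucl (d + 1)) : nu m q (Fin.last d) = (q 0 - omegaLC m q) / √2 := by
  change kappaFun (OmegaLC m q) (Fin.last d).succ = _
  rw [Fin.succ_last, kappaFun_last]
  have h0 : OmegaLC m q 0 = q 0 := Fin.snoc_castSucc (α := fun _ => ℝ) (omegaLC m q) (fun i => q i) (0 : Fin (d + 1))
  have h1 : OmegaLC m q (Fin.last (d + 1)) = omegaLC m q := Fin.snoc_last (α := fun _ => ℝ) (omegaLC m q) (fun i => q i)
  rw [h0, h1]

theorem nu_castSucc (m : ℝ) (q : Eucl (d + 1)) (i : Fin d) : nu m q i.castSucc = q i.succ := by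
  change kappaFun (OmegaLC m q) i.castSucc.succ = _
  rw [kappaFun_mid]
  exact Fin.snoc_castSucc (α := fun _ => ℝ) (omegaLC m q) (fun i => q i) i.succ

theorem norm_sq_nu (m : ℝ) (q : Eucl (d + 1)) :
    ‖nu m q‖ ^ 2 = ‖tail q‖ ^ 2 + (q 0 - omegaLC m q) ^ 2 / 2 := by
  rw [EuclideanSpace.norm_sq_eq, Fin.sum_univ_castSucc, EuclideanSpace.norm_sq_eq]
  simp only [nu_last, nu_castSucc, Real.norm_eq_abs, sq_abs, div_pow,
    Real.sq_sqrt (show (0 : ℝ) ≤ 2 by norm_num)]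
  rfl

theorem norm_sq_last (p : Eucl (d + 1)) (ε : ℤˣ) (m : ℝ) :
    ‖p‖ ^ 2 = ‖tail (mu ε m p)‖ ^ 2 + p (Fin.last d) ^ 2 := by
  rw [EuclideanSpace.norm_sq_eq, Fin.sum_univ_castSucc, EuclideanSpace.norm_sq_eq]
  simp only [Real.norm_eq_abs, sq_abs]
  rfl

theorem omega_sq (m : ℝ) {n : ℕ} (p : Eucl n) : omega m p ^ 2 = ‖p‖ ^ 2 + m ^ 2 :=
  Real.sq_sqrt (by positivity)

theorem omega_pos {m : ℝ} (hm : 0 < m) {n : ℕ} (p : Eucl n) : 0 < omega m p :=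
  Real.sqrt_pos.2 (by positivity)

theorem norm_le_omega (m : ℝ) {n : ℕ} (p : Eucl n) : ‖p‖ ≤ omega m p :=
  Real.le_sqrt_of_sq_le (by nlinarith [sq_nonneg m])

theorem omega_le {m : ℝ} (hm : 0 < m) {n : ℕ} (p : Eucl n) : omega m p ≤ m + ‖p‖ :=
  Real.sqrt_le_iff.2 ⟨by positivity, by nlinarith [norm_nonneg p]⟩

theorem omega_eq {m : ℝ} (hm : 0 < m) {n : ℕ} (p : Eucl n) :
    omega m p = m * (1 + ‖m⁻¹ • p‖ ^ 2) ^ ((1 / 2 : ℝ)) := by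
  rw [← Real.sqrt_eq_rpow, omega, norm_smul, mul_pow, Real.norm_eq_abs, sq_abs]
  rw [show ‖p‖ ^ 2 + m ^ 2 = m ^ 2 * (1 + m⁻¹ ^ 2 * ‖p‖ ^ 2) by field_simp; ring,
    Real.sqrt_mul (by positivity), Real.sqrt_sq hm.le]

theorem temperate_omega {m : ℝ} (hm : 0 < m) {n : ℕ} :
    (fun p : Eucl n => omega m p).HasTemperateGrowth := by
  simp only [omega_eq hm]
  exact (Function.HasTemperateGrowth.const m).mul
    ((Function.hasTemperateGrowth_one_add_norm_sq_rpow (Eucl n) (1 / 2)).comp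
      (m⁻¹ • ContinuousLinearMap.id ℝ (Eucl n)).hasTemperateGrowth)

theorem temperate_omega_inv {m : ℝ} (hm : 0 < m) {n : ℕ} :
    (fun p : Eucl n => (omega m p)⁻¹).HasTemperateGrowth := by
  have h : ∀ p : Eucl n, (omega m p)⁻¹ = m⁻¹ * (1 + ‖m⁻¹ • p‖ ^ 2) ^ (-(1 / 2) : ℝ) := fun p => by
    rw [omega_eq hm, mul_inv, Real.rpow_neg (by positivity)]
  simp only [h]
  exact (Function.HasTemperateGrowth.const m⁻¹).mul
    ((Function.hasTemperateGrowth_one_add_norm_sq_rpow (Eucl n) (-(1 / 2))).comp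
      (m⁻¹ • ContinuousLinearMap.id ℝ (Eucl n)).hasTemperateGrowth)

/-- `±μ_±(𝐩)⁺ > 0`. -/
theorem mu_zero_pos (ε : ℤˣ) {m : ℝ} (hm : 0 < m) (p : Eucl (d + 1)) :
    0 < ((ε : ℤ) : ℝ) * mu ε m p 0 := by
  have h1 : |p (Fin.last d)| < omega m p := by
    refine abs_lt_of_sq_lt_sq ?_ (omega_pos hm p).le
    rw [omega_sq]
    nlinarith [norm_sq_last p 1 m, sq_nonneg ‖tail (mu 1 m p)‖, pow_pos hm 2]
  have h2 : 0 < √2 := by positivity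
  obtain ⟨h3, h4⟩ := abs_lt.1 h1
  rw [mu_zero]
  rcases Int.units_eq_one_or ε with rfl | rfl
  · have : 0 < (p (Fin.last d) + omega m p) / √2 := div_pos (by linarith) h2
    simpa using this
  · have : (p (Fin.last d) - omega m p) / √2 < 0 := div_neg_of_neg_of_pos (by linarith) h2
    simpa [sub_eq_add_neg] using this

theorem mu_zero_ne (ε : ℤˣ) {m : ℝ} (hm : 0 < m) (p : Eucl (d + 1)) : mu ε m p 0 ≠ 0 := by
  intro h
  have := mu_zero_pos ε hm p
  rw [h, mul_zero] at this
  exact lt_irrefl _ this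

theorem abs_mu_zero (ε : ℤˣ) {m : ℝ} (hm : 0 < m) (p : Eucl (d + 1)) :
    |mu ε m p 0| = (omega m p + ((ε : ℤ) : ℝ) * p (Fin.last d)) / √2 := by
  have h := mu_zero_pos ε hm p
  rw [mu_zero] at h ⊢
  rcases Int.units_eq_one_or ε with rfl | rfl
  · simp only [Units.val_one, Int.cast_one, one_mul] at h ⊢
    rw [abs_of_pos h]; ring
  · simp only [Units.val_neg, Units.val_one, Int.cast_neg, Int.cast_one, neg_mul, one_mul] at h ⊢
    rw [abs_of_neg (by linarith)]; ring

theorem omegaLC_mul {m : ℝ} {q : Eucl (d + 1)} (hq : q 0 ≠ 0) :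
    2 * q 0 * omegaLC m q = ‖tail q‖ ^ 2 + m ^ 2 := by
  simp only [omegaLC]; field_simp

theorem omega_nu {m : ℝ} {q : Eucl (d + 1)} (hq : q 0 ≠ 0) :
    omega m (nu m q) = (|q 0| + |omegaLC m q|) / √2 := by
  have h1 := omegaLC_mul (m := m) hq
  have h3 : 0 ≤ q 0 * omegaLC m q := by nlinarith [sq_nonneg ‖tail q‖, sq_nonneg m]
  rw [omega, ← Real.sqrt_sq (show 0 ≤ (|q 0| + |omegaLC m q|) / √2 by positivity)]
  congr 1
  rw [norm_sq_nu, div_pow, Real.sq_sqrt (by norm_num), add_sq, sq_abs, sq_abs, mul_assoc, ← abs_mul,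
    abs_of_nonneg h3]
  linarith

theorem abs_plus_le_omega_nu {m : ℝ} {q : Eucl (d + 1)} (hq : q 0 ≠ 0) :
    |q 0| + |omegaLC m q| ≤ 2 * omega m (nu m q) := by
  have h2 : √2 ≤ 2 := Real.sqrt_le_iff.2 ⟨by norm_num, by norm_num⟩
  have h0 : 0 < √2 := by positivity
  have : |q 0| + |omegaLC m q| = √2 * omega m (nu m q) := by rw [omega_nu hq]; field_simp
  rw [this]
  exact mul_le_mul_of_nonneg_right h2 (Real.sqrt_nonneg _)

theorem nu_growth {m : ℝ} (hm : 0 < m) : ∃ (k : ℕ) (C₀ : ℝ), ∀ q ∈ offPlane d,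
    squeezeWeight q ≤ C₀ * (1 + ‖nu m q‖) ^ k := by
  refine ⟨1, 1 + 3 * (m + 1) + 4 * (m + 1) / m ^ 2, fun q hq => ?_⟩
  have hq0 : q 0 ≠ 0 := hq
  have h1 := abs_plus_le_omega_nu (m := m) hq0
  have h2 := omegaLC_mul (m := m) hq0
  have h3 := omega_le hm (nu m q)
  have h4 := norm_le_plus_tail q
  set N := ‖nu m q‖
  have hN : 0 ≤ N := norm_nonneg _
  have h5 : ‖tail q‖ ≤ N := by
    refine abs_le_of_sq_le_sq' ?_ (norm_nonneg _) |>.2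
    rw [norm_sq_nu]; nlinarith [sq_nonneg (q 0 - omegaLC m q)]
  have h6 : omega m (nu m q) ≤ (m + 1) * (1 + N) := by nlinarith
  have h7 : |q 0|⁻¹ ≤ 4 * (m + 1) / m ^ 2 * (1 + N) := by
    have hpos : 0 < |q 0| := abs_pos.2 hq0
    have : m ^ 2 ≤ 2 * |q 0| * |omegaLC m q| := by
      have e : 2 * |q 0| * |omegaLC m q| = |2 * q 0 * omegaLC m q| := by
        rw [abs_mul, abs_mul, abs_of_pos (by norm_num : (0 : ℝ) < 2)]
      rw [e, h2]
      exact (le_add_of_nonneg_left (sq_nonneg _)).trans (le_abs_self _)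
    have h8 : |omegaLC m q| ≤ 2 * ((m + 1) * (1 + N)) := by linarith
    rw [inv_le_iff_one_le_mul₀ hpos, div_mul_eq_mul_div, div_mul_eq_mul_div,
      le_div_iff₀ (by positivity)]
    nlinarith [mul_le_mul_of_nonneg_left h8 hpos.le]
  rw [pow_one]
  simp only [squeezeWeight]
  have h9 : |q 0| ≤ 2 * ((m + 1) * (1 + N)) := by linarith [abs_nonneg (omegaLC m q)]
  have h10 : N ≤ (m + 1) * (1 + N) := by nlinarith
  nlinarith

theorem mu_growth (ε : ℤˣ) {m : ℝ} (hm : 0 < m) : ∃ (k : ℕ) (C₀ : ℝ),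
    ∀ p ∈ (Set.univ : Set (Eucl (d + 1))), 1 + ‖p‖ ≤ C₀ * squeezeWeight (mu ε m p) ^ k := by
  refine ⟨3, 3 + m ^ 2, fun p _ => ?_⟩
  have h0 : 0 < √2 := by positivity
  have hne := mu_zero_ne ε hm p
  have h1 := abs_mu_zero ε hm p
  have hsq := norm_sq_last p ε m
  have hpos : 0 < |mu ε m p 0| := abs_pos.2 hne
  have hR1 := one_le_weight (mu ε m p)
  have hR2 := one_add_norm_le_weight (mu ε m p)
  have hR3 := inv_le_weight (mu ε m p)
  have hR4 := abs_plus_le (mu ε m p)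
  have hR5 := norm_tail_le (mu ε m p)
  have hε : ((ε : ℤ) : ℝ) ^ 2 = 1 := by
    rcases Int.units_eq_one_or ε with rfl | rfl <;> simp
  set R := squeezeWeight (mu ε m p)
  set t := ‖tail (mu ε m p)‖
  set A := omega m p + ((ε : ℤ) : ℝ) * p (Fin.last d) with hA
  set B := omega m p - ((ε : ℤ) : ℝ) * p (Fin.last d) with hB
  have ht : 0 ≤ t := norm_nonneg _
  have hAB : A * B = t ^ 2 + m ^ 2 := by
    have : A * B = omega m p ^ 2 - ((ε : ℤ) : ℝ) ^ 2 * p (Fin.last d) ^ 2 := by rw [hA, hB]; ring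
    rw [this, hε, omega_sq, hsq]; ring
  have hA' : A = √2 * |mu ε m p 0| := by rw [h1]; field_simp
  have hs : √2 ≤ 2 := Real.sqrt_le_iff.2 ⟨by norm_num, by norm_num⟩
  have hs1 : 1 ≤ √2 := Real.one_le_sqrt.2 (by norm_num)
  have hB' : B ≤ (R ^ 2 + m ^ 2) * R := by
    have e : |mu ε m p 0| * B ≤ t ^ 2 + m ^ 2 := by
      have hB0 : 0 ≤ B := by
        by_contra hneg
        have : A * B < 0 := mul_neg_of_pos_of_neg (by rw [hA']; positivity) (not_le.1 hneg)
        nlinarith [sq_nonneg t, sq_nonneg m]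
      rw [← hAB, hA']
      have : 0 ≤ |mu ε m p 0| * B := by positivity
      nlinarith
    have e2 : B ≤ (t ^ 2 + m ^ 2) * |mu ε m p 0|⁻¹ := by
      rw [← div_eq_mul_inv, le_div_iff₀ hpos]; linarith
    refine e2.trans ?_
    have : t ≤ R := by linarith
    gcongr
  have hAR : A ≤ 2 * R := by rw [hA']; nlinarith
  have hω : 2 * omega m p = A + B := by rw [hA, hB]; ring
  have hp := norm_le_omega m p
  have hR3 : R ≤ R ^ 3 := le_self_pow₀ hR1 (by norm_num)
  nlinarith [sq_nonneg m, mul_le_mul_of_nonneg_left hR3 (sq_nonneg m)]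

theorem nu_mu (ε : ℤˣ) {m : ℝ} (hm : 0 < m) (p : Eucl (d + 1)) : nu m (mu ε m p) = p := by
  have h0 : √2 ≠ 0 := by positivity
  have hne := mu_zero_ne ε hm p
  have hε : ((ε : ℤ) : ℝ) ^ 2 = 1 := by
    rcases Int.units_eq_one_or ε with rfl | rfl <;> simp
  have hlc : omegaLC m (mu ε m p) =
      (((ε : ℤ) : ℝ) * omega m p - p (Fin.last d)) / √2 := by
    rw [omegaLC, div_eq_iff (by positivity)]
    have e : ‖tail (mu ε m p)‖ ^ 2 + m ^ 2 = omega m p ^ 2 - p (Fin.last d) ^ 2 := by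
      rw [omega_sq, norm_sq_last p ε m]; ring
    rw [e, mu_zero]
    field_simp
    rw [Real.sq_sqrt (by norm_num)]
    linear_combination (-2 * omega m p ^ 2) * hε
  ext i
  induction i using Fin.lastCases with
  | last =>
    rw [nu_last, hlc, mu_zero]
    field_simp
    rw [Real.sq_sqrt (by norm_num)]; ring
  | cast i => rw [nu_castSucc, mu_succ]

theorem moderateOn_nu (m : ℝ) : ModerateOn (offPlane d) squeezeWeight (nu (d := d) m) := by
  have hproj : ∀ i : Fin (d + 1), ModerateOn (offPlane d) squeezeWeight
      (fun q : Eucl (d + 1) => q i) := fun i =>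
    moderateOn_temperate (EuclideanSpace.proj (𝕜 := ℝ) i).hasTemperateGrowth
  have h1 : ∀ x ∈ offPlane d, 1 ≤ squeezeWeight x := fun x _ => one_le_weight x
  refine .eucl isOpen_offPlane (fun x _ => one_add_norm_le_weight x) fun i => ?_
  induction i using Fin.lastCases with
  | cast i => simpa only [nu_castSucc] using hproj i.succ
  | last =>
    have hn : ModerateOn (offPlane d) squeezeWeight
        (fun q : Eucl (d + 1) => ‖q‖ ^ 2 - q 0 ^ 2 + m ^ 2) :=
      moderateOn_temperate
        (((Function.hasTemperateGrowth_norm_sq (H := Eucl (d + 1))).sub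
          ((plusForm d).hasTemperateGrowth.pow 2)).add (.const (m ^ 2)))
    have hinv : ModerateOn (offPlane d) squeezeWeight (fun q : Eucl (d + 1) => (q 0)⁻¹) :=
      moderateOn_plus moderateOn_inv
    have hc : ∀ c : ℝ, ModerateOn (offPlane d) squeezeWeight (fun _ : Eucl (d + 1) => c) :=
      fun c => moderateOn_temperate (.const c)
    refine (((hproj 0).mul isOpen_offPlane h1 (hc (√2)⁻¹)).add isOpen_offPlane h1
      ((hn.mul isOpen_offPlane h1 hinv).mul isOpen_offPlane h1
        (hc (-(2 * √2)⁻¹)))).congr fun q hq => ?_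
    have hq0 : q 0 ≠ 0 := hq
    have h0 : √2 ≠ 0 := by positivity
    simp only [nu_last, omegaLC, norm_sq_tail q]
    field_simp
    ring

theorem moderateOn_mu (ε : ℤˣ) {m : ℝ} (hm : 0 < m) :
    ModerateOn Set.univ (fun x => 1 + ‖x‖) (mu (d := d) ε m) := by
  have hproj : ∀ i : Fin (d + 1), (fun q : Eucl (d + 1) => q i).HasTemperateGrowth := fun i =>
    (EuclideanSpace.proj (𝕜 := ℝ) i).hasTemperateGrowth
  refine .eucl isOpen_univ (fun x _ => le_rfl) fun i =>
    .of_temperate isOpen_univ (fun x _ => le_rfl) ?_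
  induction i using Fin.cases with
  | succ i => simpa only [mu_succ] using hproj i.castSucc
  | zero =>
    simp only [mu_zero, div_eq_mul_inv]
    exact ((hproj (Fin.last d)).add
      ((Function.HasTemperateGrowth.const _).mul (temperate_omega hm))).mul (.const _)

theorem moderateOn_mu_weight (ε : ℤˣ) {m : ℝ} (hm : 0 < m) :
    ModerateOn Set.univ (fun x => 1 + ‖x‖)
      (fun p : Eucl (d + 1) => ((|mu ε m p 0| / omega m p : ℝ) : ℂ)) := by
  refine .ofReal isOpen_univ (.of_temperate isOpen_univ (fun x _ => le_rfl) ?_)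
  have hproj : (fun q : Eucl (d + 1) => q (Fin.last d)).HasTemperateGrowth :=
    (EuclideanSpace.proj (𝕜 := ℝ) (Fin.last d)).hasTemperateGrowth
  simp only [abs_mu_zero ε hm, div_eq_mul_inv]
  exact (((temperate_omega hm).add ((Function.HasTemperateGrowth.const _).mul hproj)).mul
    (.const _)).mul (temperate_omega_inv hm)

theorem moderateOn_heaviside (ε : ℤˣ) : ModerateOn {x : ℝ | x ≠ 0} lineWeight
    (fun x : ℝ => if 0 < ((ε : ℤ) : ℝ) * x then (1 : ℝ) else 0) := by
  rcases Int.units_eq_one_or ε with rfl | rfl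
  · simpa using moderateOn_step 1 0
  · refine (moderateOn_step 0 1).congr fun x hx => ?_
    rcases lt_or_gt_of_ne hx with h | h
    · simp [h, not_lt.2 h.le]
    · simp [h, not_lt.2 h.le]

theorem moderateOn_nu_weight (ε : ℤˣ) {m : ℝ} (hm : 0 < m) :
    ModerateOn (offPlane d) squeezeWeight (fun q : Eucl (d + 1) =>
      (((if 0 < ((ε : ℤ) : ℝ) * q 0 then (1 : ℝ) else 0) * (omega m (nu m q) / |q 0|) : ℝ) : ℂ)) := by
  have h1 : ∀ x ∈ offPlane d, 1 ≤ squeezeWeight x := fun x _ => one_le_weight x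
  refine .ofReal isOpen_offPlane (.mul isOpen_offPlane h1 (moderateOn_plus (moderateOn_heaviside ε)) ?_)
  simp only [div_eq_mul_inv]
  exact ((moderateOn_nu m).temperate_comp isOpen_offPlane h1 (temperate_omega hm)).mul
    isOpen_offPlane h1 (moderateOn_plus moderateOn_abs_inv)

end Geometry
end LightCone

namespace LightCone

open scoped LineDeriv FourierTransform
open MeasureTheory

section Distributions

/-! ### Fourier transforms -/

/-- Dilation by `(2π)⁻¹`. -/
def dilation (n : ℕ) : Eucl n ≃L[ℝ] Eucl n :=
  ContinuousLinearEquiv.smulLeft (Units.mk0 (2 * Real.pi)⁻¹ (by positivity))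

theorem dilation_apply (n : ℕ) (p : Eucl n) : dilation n p = (2 * Real.pi)⁻¹ • p := rfl

/-- The Fourier transform `(𝓕 f)(p) = ∫ f(x) exp(-i x·p) dx` on Schwartz functions. -/
def schwartzFourier (n : ℕ) : 𝓢(Eucl n, ℂ) →L[ℂ] 𝓢(Eucl n, ℂ) :=
  (SchwartzMap.compCLMOfContinuousLinearEquiv ℂ (dilation n)) ∘L
    (FourierTransform.fourierCLM ℂ 𝓢(Eucl n, ℂ))

theorem schwartzFourier_apply {n : ℕ} (f : 𝓢(Eucl n, ℂ)) (p : Eucl n) :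
    schwartzFourier n f p = ∫ x, Complex.exp (-Complex.I * ((inner ℝ x p : ℝ) : ℂ)) * f x := by
  change (𝓕 f) ((2 * Real.pi)⁻¹ • p) = _
  rw [SchwartzMap.fourier_coe, Real.fourier_eq']
  congr 1
  ext x
  rw [smul_eq_mul, inner_smul_right]
  congr 2
  have : (Real.pi : ℂ) ≠ 0 := by exact_mod_cast Real.pi_ne_zero
  push_cast
  field_simp

/-- The Fourier transform of tempered distributions, `(𝓕 u, f) = (u, 𝓕 f)`. -/
def distFourier (n : ℕ) : 𝓢'(Eucl n, ℂ) →L[ℂ] 𝓢'(Eucl n, ℂ) :=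
  PointwiseConvergenceCLM.precomp ℂ (schwartzFourier n)

variable {d : ℕ}

/-- The linear map `(x_⊥, x⁻) ↦ (-x⁻, x_⊥)`. -/
def rotateLin (d : ℕ) : Eucl (d + 1) ≃ₗ[ℝ] Eucl (d + 1) where
  toFun x := WithLp.toLp 2 (Fin.cons (α := fun _ => ℝ) (-x (Fin.last d)) fun i => x i.castSucc)
  invFun y := WithLp.toLp 2 (Fin.snoc (α := fun _ => ℝ) (fun i => y i.succ) (-y 0))
  map_add' x y := by
    ext i
    induction i using Fin.cases <;> simp [add_comm]
  map_smul' c x := by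
    ext i
    induction i using Fin.cases <;> simp
  left_inv x := by
    ext i
    induction i using Fin.lastCases <;> simp
  right_inv x := by
    ext i
    induction i using Fin.cases <;> simp

/-- The continuous linear map `(x_⊥, x⁻) ↦ (-x⁻, x_⊥)`. -/
def rotate (d : ℕ) : Eucl (d + 1) ≃L[ℝ] Eucl (d + 1) := (rotateLin d).toContinuousLinearEquiv

theorem rotate_zero (x : Eucl (d + 1)) : rotate d x 0 = -x (Fin.last d) := rfl
theorem rotate_succ (x : Eucl (d + 1)) (i : Fin d) : rotate d x i.succ = x i.castSucc := rfl

theorem rotate_single :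
    rotate d (EuclideanSpace.single (Fin.last d) 1) = -EuclideanSpace.single 0 1 := by
  ext i
  induction i using Fin.cases with
  | zero => simp [rotate_zero]
  | succ i => simp [rotate_succ, (Fin.castSucc_lt_last i).ne]

/-- The transpose of the partial light-cone Fourier transform on Schwartz functions,
`g ↦ ∫ g(p⁺, p_⊥) exp(i (x⁻ p⁺ - x_⊥ · p_⊥)) dp⁺ dp_⊥`, as a function of `(x_⊥, x⁻)`. -/
def lcFourierTransposeSchwartz (d : ℕ) : 𝓢(Eucl (d + 1), ℂ) →L[ℂ] 𝓢(Eucl (d + 1), ℂ) :=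
  (SchwartzMap.compCLMOfContinuousLinearEquiv ℂ (rotate d)) ∘L (schwartzFourier (d + 1))

theorem lcFourierTransposeSchwartz_apply (g : 𝓢(Eucl (d + 1), ℂ)) (x : Eucl (d + 1)) :
    lcFourierTransposeSchwartz d g x = ∫ p : Eucl (d + 1), Complex.exp (Complex.I *
      ((x (Fin.last d) * p 0 - ∑ i : Fin d, x i.castSucc * p i.succ : ℝ) : ℂ)) * g p := by
  change schwartzFourier (d + 1) g (rotate d x) = _
  rw [schwartzFourier_apply]
  congr 1
  ext p
  congr 2
  rw [PiLp.inner_apply, Fin.sum_univ_succ]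
  simp only [rotate_zero, rotate_succ, RCLike.inner_apply, conj_trivial]
  push_cast
  ring

/-! ### Tame generalized functions -/

/-- The space `𝓢_{∂₋}(ℝⁿ⁺¹) = ⋂ₖ ∂₋ᵏ 𝓢(ℝⁿ⁺¹)`, where `∂₋` is the partial derivative in the last
coordinate `x⁻`; it carries the subspace topology. -/
def tameSchwartz (n : ℕ) : Submodule ℂ 𝓢(Eucl (n + 1), ℂ) :=
  ⨅ k : ℕ, LinearMap.range
    ((LineDeriv.lineDerivOpCLM ℂ 𝓢(Eucl (n + 1), ℂ)
      (EuclideanSpace.single (Fin.last n) (1 : ℝ))).toLinearMap ^ k)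

/-- The tame generalized functions `𝓢'_{∂₋}(ℝⁿ⁺¹)`. -/
abbrev TameDistribution (n : ℕ) : Type := ↥(tameSchwartz n) →Lₚₜ[ℂ] ℂ

/-- The squeezed generalized functions `𝓢'_{p⁺}(ℝⁿ)`, `n = d + 1`. -/
abbrev SqueezedDistribution (d : ℕ) : Type := SqueezedSchwartz d →Lₚₜ[ℂ] ℂ

/-- The relaxation `u ↦ u*` of a tempered distribution. -/
def relax (n : ℕ) : 𝓢'(Eucl (n + 1), ℂ) →L[ℂ] TameDistribution n :=
  PointwiseConvergenceCLM.precomp ℂ (tameSchwartz n).subtypeL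

theorem moderateOn_I_inv : ModerateOn (offPlane d) squeezeWeight
    (fun q : Eucl (d + 1) => (((q 0)⁻¹ : ℝ) : ℂ)) :=
  .ofReal isOpen_offPlane (moderateOn_plus moderateOn_inv)

theorem SqueezedSchwartz.apply_eq_zero (f : SqueezedSchwartz d) {p : Eucl (d + 1)} (hp : p 0 = 0) :
    f p = 0 := by
  obtain ⟨C, hC⟩ := f.decay (-1) 0 0
  have hcl : IsClosed {x : Eucl (d + 1) | ‖f x‖ ≤ C * |x 0|} :=
    isClosed_le f.contDiff.continuous.norm
      (continuous_const.mul (plusForm d).continuous.abs)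
  have h : ‖f p‖ ≤ C * |p 0| := by
    refine hcl.closure_subset_iff.2 (fun y hy => ?_) (dense_offPlane p)
    have hy0 : 0 < |y 0| := abs_pos.2 hy
    have := hC y hy
    rw [norm_iteratedFDeriv_zero, pow_zero, mul_one, zpow_neg_one, inv_mul_le_iff₀ hy0] at this
    exact this.trans_eq (mul_comm _ _)
  simpa [hp] using h

theorem exists_lcFourierTranspose_eq (g : SqueezedSchwartz d) : ∃ g' : SqueezedSchwartz d,
    lcFourierTransposeSchwartz d g.toSchwartz =
      LineDeriv.lineDerivOpCLM ℂ 𝓢(Eucl (d + 1), ℂ) (EuclideanSpace.single (Fin.last d) (1 : ℝ))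
        (lcFourierTransposeSchwartz d g'.toSchwartz) := by
  refine ⟨(-Complex.I) • squeezedMul moderateOn_I_inv g, ?_⟩
  set g' : SqueezedSchwartz d := (-Complex.I) • squeezedMul moderateOn_I_inv g with hg'
  have h1 : ∀ f : 𝓢(Eucl (d + 1), ℂ), lcFourierTransposeSchwartz d f =
      SchwartzMap.compCLMOfContinuousLinearEquiv ℂ (rotate d)
        (SchwartzMap.compCLMOfContinuousLinearEquiv ℂ (dilation (d + 1)) (𝓕 f)) := fun _ => rfl
  rw [h1, h1, LineDeriv.lineDerivOpCLM_apply, SchwartzMap.lineDerivOp_compCLMOfContinuousLinearEquiv,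
    SchwartzMap.lineDerivOp_compCLMOfContinuousLinearEquiv, SchwartzMap.lineDerivOp_fourier_eq]
  congr 3
  ext p
  have ht : (fun x : Eucl (d + 1) => (inner ℝ x (dilation (d + 1)
      (rotate d (EuclideanSpace.single (Fin.last d) 1))) : ℝ)).HasTemperateGrowth := by
    fun_prop
  have e : (inner ℝ p (dilation (d + 1) (rotate d (EuclideanSpace.single (Fin.last d) 1))) : ℝ) =
      -((2 * Real.pi)⁻¹ * p 0) := by
    rw [rotate_single, dilation_apply, inner_smul_right, inner_neg_right,
      EuclideanSpace.inner_single_right]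
    simp
  have hpi : (Real.pi : ℂ) ≠ 0 := by exact_mod_cast Real.pi_ne_zero
  change g p = (-(2 * Real.pi * Complex.I)) * _
  rw [SchwartzMap.smulLeftCLM_apply_apply ht, e]
  change g p = (-(2 * Real.pi * Complex.I)) *
    (((-((2 * Real.pi)⁻¹ * p 0) : ℝ) : ℂ) * ((-Complex.I) * squeezedMul moderateOn_I_inv g p))
  by_cases hp : p 0 = 0
  · rw [g.apply_eq_zero hp, SqueezedSchwartz.apply_eq_zero _ hp]; simp
  · rw [squeezedMul_apply _ _ hp]
    have hp' : ((p 0 : ℝ) : ℂ) ≠ 0 := by exact_mod_cast hp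
    push_cast
    field_simp
    simp

theorem lcFourierTranspose_mem_tame (g : SqueezedSchwartz d) :
    lcFourierTransposeSchwartz d g.toSchwartz ∈ tameSchwartz d := by
  rw [tameSchwartz, Submodule.mem_iInf]
  intro k
  induction k generalizing g with
  | zero => exact ⟨_, rfl⟩
  | succ k ih =>
    obtain ⟨g', hg'⟩ := exists_lcFourierTranspose_eq g
    obtain ⟨h, hh⟩ := ih g'
    refine ⟨h, ?_⟩
    rw [pow_succ', Module.End.mul_apply, hh, hg']
    rfl

/-- The transpose of the partial light-cone Fourier transform, mapping the squeezed Schwartz space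
to `𝓢_{∂₋}`. -/
def lcFourierTranspose (d : ℕ) : SqueezedSchwartz d →L[ℂ] ↥(tameSchwartz d) :=
  ((lcFourierTransposeSchwartz d) ∘L SqueezedSchwartz.toSchwartz).codRestrict (tameSchwartz d)
    lcFourierTranspose_mem_tame

/-- The partial light-cone Fourier transform
`v(x_⊥, x⁻) ↦ ∫ v(x_⊥, x⁻) exp(i (x⁻ p⁺ - x_⊥ · p_⊥)) dx_⊥ dx⁻` of tame generalized functions. -/
def lcFourier (d : ℕ) : TameDistribution d →L[ℂ] SqueezedDistribution d :=
  PointwiseConvergenceCLM.precomp ℂ (lcFourierTranspose d)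

end Distributions
end LightCone

namespace LightCone

open scoped LineDeriv FourierTransform
open MeasureTheory

section Laws
variable {d : ℕ}

/-! ### Multiplication and pull-back of generalized functions -/

/-- The operator `f ↦ (|μ_±(𝐩)⁺| / ω(𝐩)) f(μ_±(𝐩))`; the factor is the Jacobian of `μ_±`. -/
def nuTranspose (ε : ℤˣ) {m : ℝ} (hm : 0 < m) : SqueezedSchwartz d →L[ℂ] 𝓢(Eucl (d + 1), ℂ) :=
  squeezedPull (moderateOn_mu ε hm) (moderateOn_mu_weight ε hm) (fun p _ => mu_zero_ne ε hm p)
    (mu_growth ε hm)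

theorem nuTranspose_apply (ε : ℤˣ) {m : ℝ} (hm : 0 < m) (f : SqueezedSchwartz d)
    (p : Eucl (d + 1)) :
    nuTranspose ε hm f p = ((|mu ε m p 0| / omega m p : ℝ) : ℂ) * f (mu ε m p) := rfl

/-- The operator `g ↦ (ω(ν(q)) / |q⁺|) g(ν(q))` for `±q⁺ > 0`, extended by zero; the factor is the
Jacobian of `ν_{≷0}`. -/
def muTranspose (ε : ℤˣ) {m : ℝ} (hm : 0 < m) : 𝓢(Eucl (d + 1), ℂ) →L[ℂ] SqueezedSchwartz d :=
  toSqueezed (schwartz_withSeminorms ℂ (Eucl (d + 1)) ℂ) (schwartzCoeLM (Eucl (d + 1)))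
    isOpen_univ (ρ' := fun y => 1 + ‖y‖) (fun y _ => by linarith [norm_nonneg y])
    (fun f => (f.smooth ⊤).contDiffOn) schwartz_ctrl_bound (moderateOn_nu m)
    (moderateOn_nu_weight ε hm) (Set.mapsTo_univ _ _) (nu_growth hm)

theorem muTranspose_apply (ε : ℤˣ) {m : ℝ} (hm : 0 < m) (g : 𝓢(Eucl (d + 1), ℂ))
    (q : Eucl (d + 1)) :
    muTranspose ε hm g q = if 0 < ((ε : ℤ) : ℝ) * q 0 then
      ((omega m (nu m q) / |q 0| : ℝ) : ℂ) * g (nu m q) else 0 := by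
  change (if q 0 = 0 then 0 else (((if 0 < ((ε : ℤ) : ℝ) * q 0 then (1 : ℝ) else 0) *
    (omega m (nu m q) / |q 0|) : ℝ) : ℂ) * g (nu m q)) = _
  by_cases hq : q 0 = 0
  · simp [hq]
  · rw [if_neg hq]
    split_ifs <;> simp

/-- The pull-back `ν*_{≷0} : 𝓢'(ℝⁿ) → 𝓢'_{p⁺}(ℝⁿ)` (composition with `ν_{≷0}` on `{±p⁺ > 0}`,
extended by zero), where the sign `ε` is `1` for `ν_{>0}` and `-1` for `ν_{<0}`. -/
def nuStar (ε : ℤˣ) {m : ℝ} (hm : 0 < m) : 𝓢'(Eucl (d + 1), ℂ) →L[ℂ] SqueezedDistribution d :=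
  PointwiseConvergenceCLM.precomp ℂ (nuTranspose ε hm)

/-- The pull-back `μ*_{≷0} : 𝓢'_{p⁺}(ℝⁿ) → 𝓢'(ℝⁿ)` (composition with `μ_{≷0} = ν_{≷0}⁻¹`). -/
def muStar (ε : ℤˣ) {m : ℝ} (hm : 0 < m) : SqueezedDistribution d →L[ℂ] 𝓢'(Eucl (d + 1), ℂ) :=
  PointwiseConvergenceCLM.precomp ℂ (muTranspose ε hm)

/-- The product `M b` of a squeezed generalized function with a multiplicator,
`(M b, f) = (b, M f)`. -/
def squeezedSmul {M : Eucl (d + 1) → ℂ} (hM : ModerateOn (offPlane d) squeezeWeight M) :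
    SqueezedDistribution d →L[ℂ] SqueezedDistribution d :=
  PointwiseConvergenceCLM.precomp ℂ (squeezedMul hM)

theorem moderateOn_half_abs_inv : ModerateOn (offPlane d) squeezeWeight
    (fun q : Eucl (d + 1) => ((1 / (2 * |q 0|) : ℝ) : ℂ)) := by
  have h1 : ∀ x ∈ offPlane d, 1 ≤ squeezeWeight x := fun x _ => one_le_weight x
  refine .ofReal isOpen_offPlane ((ModerateOn.mul isOpen_offPlane h1
    (moderateOn_temperate (.const (1 / 2 : ℝ))) (moderateOn_plus moderateOn_abs_inv)).congr ?_)
  intro q hq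
  change 1 / (2 * |q 0|) = 1 / 2 * |q 0|⁻¹
  rw [one_div, mul_inv, one_div]

theorem moderateOn_abs_heaviside (ε : ℤˣ) : ModerateOn (offPlane d) squeezeWeight
    (fun q : Eucl (d + 1) =>
      ((|q 0| * (if 0 < ((ε : ℤ) : ℝ) * q 0 then (1 : ℝ) else 0) : ℝ) : ℂ)) :=
  .ofReal isOpen_offPlane (ModerateOn.mul isOpen_offPlane (fun x _ => one_le_weight x)
    (moderateOn_plus moderateOn_abs) (moderateOn_plus (moderateOn_heaviside ε)))

/-- `b ↦ (1 / (2 |p⁺|)) b`. -/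
def halfAbsInvSmul : SqueezedDistribution d →L[ℂ] SqueezedDistribution d :=
  squeezedSmul moderateOn_half_abs_inv

/-- `b ↦ |p⁺| Θ(±p⁺) b`. -/
def absHeavisideSmul (ε : ℤˣ) : SqueezedDistribution d →L[ℂ] SqueezedDistribution d :=
  squeezedSmul (moderateOn_abs_heaviside ε)

/-- The product `ω a`. -/
def omegaSmul (m : ℝ) {n : ℕ} : 𝓢'(Eucl n, ℂ) →L[ℂ] 𝓢'(Eucl n, ℂ) :=
  TemperedDistribution.smulLeftCLM ℂ fun p => ((omega m p : ℝ) : ℂ)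

/-- The product `(1 / ω) a`. -/
def omegaInvSmul (m : ℝ) {n : ℕ} : 𝓢'(Eucl n, ℂ) →L[ℂ] 𝓢'(Eucl n, ℂ) :=
  TemperedDistribution.smulLeftCLM ℂ fun p => ((1 / omega m p : ℝ) : ℂ)

/-- The composition `u ∘ κ⁻¹`, `(u ∘ κ⁻¹, f) = (u, f ∘ κ)` (recall `|det κ| = 1`). -/
def compKappaInv (d : ℕ) : 𝓢'(Eucl (d + 2), ℂ) →L[ℂ] 𝓢'(Eucl (d + 2), ℂ) :=
  PointwiseConvergenceCLM.precomp ℂ (SchwartzMap.compCLMOfContinuousLinearEquiv ℂ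
    (kappa d).toContinuousLinearEquiv)

/-! ### The Klein-Gordon equation and restrictions -/

/-- `∂_i u` for a tempered distribution. -/
def pd {n : ℕ} (i : Fin n) (u : 𝓢'(Eucl n, ℂ)) : 𝓢'(Eucl n, ℂ) :=
  ∂_{EuclideanSpace.single i (1 : ℝ)} u

/-- The Klein-Gordon equation `∂₀²u - ∑ᵢ ∂ᵢ²u + m²u = 0` on `ℝ¹⁺ⁿ`. -/
def IsKleinGordonSolution (m : ℝ) {n : ℕ} (u : 𝓢'(Eucl (n + 1), ℂ)) : Prop :=
  pd 0 (pd 0 u) - ∑ i : Fin n, pd i.succ (pd i.succ u) + ((m ^ 2 : ℝ) : ℂ) • u = 0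

/-- `u₀ = u|_{x⁰=0}`: the distribution `u` on `ℝ¹⁺ⁿ` depends smoothly on `x⁰` as a parameter, with
values `v t` in `𝓢'(ℝⁿ)`, and `u₀ = v 0`. -/
def HasRestriction {n : ℕ} (u : 𝓢'(Eucl (n + 1), ℂ)) (u₀ : 𝓢'(Eucl n, ℂ)) : Prop :=
  ∃ v : ℝ → 𝓢'(Eucl n, ℂ),
    (∀ g : 𝓢(Eucl n, ℂ), ContDiff ℝ ∞ fun t => v t g) ∧
    (∀ (f : 𝓢(ℝ, ℂ)) (g : 𝓢(Eucl n, ℂ)) (F : 𝓢(Eucl (n + 1), ℂ)),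
      (∀ x, F x = f (x 0) * g (tail x)) →
        Integrable (fun t => v t g * f t) ∧ u F = ∫ t, v t g * f t) ∧
    v 0 = u₀

/-- `w = u|*_{x⁺=0}`: for some open neighbourhood `Ω` of `0`, the relaxation of `u` depends smoothly
on `x⁺ ∈ Ω` as a parameter, with values `v t` in `𝓢'_{∂₋}(ℝⁿ)`, `n = d + 1`, and `w = v 0`. -/
def HasTameRestriction (u : 𝓢'(Eucl (d + 2), ℂ)) (w : TameDistribution d) : Prop :=
  ∃ (Ω : Set ℝ) (v : ℝ → TameDistribution d), IsOpen Ω ∧ 0 ∈ Ω ∧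
    (∀ g : tameSchwartz d, ContDiffOn ℝ ∞ (fun t => v t g) Ω) ∧
    (∀ f : ℝ → ℂ, ContDiff ℝ ∞ f → HasCompactSupport f → tsupport f ⊆ Ω →
      ∀ (g : tameSchwartz d) (F : tameSchwartz (d + 1)),
        (∀ x, (F : 𝓢(Eucl (d + 2), ℂ)) x = f (x 0) * (g : 𝓢(Eucl (d + 1), ℂ)) (tail x)) →
          relax (d + 1) u F = ∫ t in Ω, v t g * f t) ∧
    v 0 = w

end Laws
end LightCone

end

/-! The Klein-Gordon equation says that the Fourier transform of `u` is annihilated by `k⁰² -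
ω(𝐤)²`. A Schwartz function that vanishes on both sheets `k⁰ = ±ω(𝐤)` is a Schwartz multiple of this
polynomial (Hadamard division, applied to one sheet after the other). The transform of `u` therefore
depends only on the restrictions of a test function to the sheets and is a sum of two tempered
densities `a ε`, one on each sheet `k⁰ = -ε ω(𝐤)`. This is `exists_shell_densities`, repackaged as
`IsShellTransform`.

All initial data are read off from these two densities. Put `c = (2π)⁻¹`. In ordinary time the
evolution multiplies `a ε` by `exp(-i ε t ω)`. At time zero the transform of `u₀` is `c (a 1 + a
(-1))`, and since `∂₀` acts on `a ε` as `-i ε ω`, that of `u₁` is `-i c ω (a 1 - a (-1))`. In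
light-cone time the same density is multiplied by `exp(-i t ω̃)`, where `ω̃` is the light-cone
energy at `μ_ε(𝐤)`, and the spatial momentum is `μ_ε(𝐤)`. Hence `lcFourier` of the tame restriction
sends a squeezed test function `h` to `c ∑ ε, (a ε, h ∘ μ_ε)`. Tameness enters here: one light-cone
momentum `μ_ε(𝐤)⁺` tends to zero as `kⁿ → -∞` and the other as `kⁿ → ∞`, so `h ∘ μ_ε` is a Schwartz
function because `h` is flat at `p⁺ = 0`. The laws follow by cancelling Jacobians, since `ω û₀ ± i
û₁ = 2 c ω a (±1)`.

Three analytic facts support this. `pairing_integral` moves a distribution through an integral over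
time: as a function of the symbol `Φ`, the pairing with `(Φ ∘ φ) g` is continuous for finitely many
weighted derivatives, extends by Hahn-Banach to a Banach space of jets, and there Bochner
integration applies. `contDiff_pairing` gives smoothness in time. `tameToSqueezed` inverts the
transposed light-cone transform, because `∂₋` becomes multiplication by `i p⁺` and infinite
divisibility by `p⁺` is flatness. Uniqueness holds because tensor products test the smooth functions
of time pointwise. -/

noncomputable section
namespace LightCone

open scoped LineDeriv FourierTransform BoundedContinuousFunction
open MeasureTheory

/-! ### Distributions paired with superpositions of characters. -/

section Pairing
variable {V : Type} [NormedAddCommGroup V] [NormedSpace ℝ V]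

/-- The seminorms of `(Φ ∘ φ) g` are controlled by the derivatives of the symbol `Φ`. -/
theorem exists_bound_symbol_comp_mul {φ : V → ℝ} (hφ : φ.HasTemperateGrowth) (g : 𝓢(V, ℂ))
    (k j : ℕ) : ∃ C : ℝ, 0 ≤ C ∧ ∀ (Φ : ℝ → ℂ) (B : ℝ), ContDiff ℝ ∞ Φ → 0 ≤ B →
      (∀ i ≤ j, ∀ s, ‖iteratedDeriv i Φ s‖ ≤ B * (1 + s ^ 2)) → ∀ x,
        ‖x‖ ^ k * ‖iteratedFDeriv ℝ j (fun x => Φ (φ x) * g x) x‖ ≤ C * B := by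
  obtain ⟨l, C, hC, hφb⟩ := hφ.norm_iteratedFDeriv_le_uniform j
  -- Each factor `D` costs `r ^ l`: the chain rule uses at most `j` of them, and `1 + φ²` two more.
  set M := k + l * (j + 2) with hM
  set S := (2 : ℝ) ^ M * ((Finset.Iic (M, j)).sup fun m => SchwartzMap.seminorm ℂ m.1 m.2) g with hS
  have hS0 : 0 ≤ S := by positivity
  refine ⟨2 ^ j * (j.factorial * (C + 1) ^ (j + 2) * S), by positivity, fun Φ B hΦ hB hb x => ?_⟩
  set r := 1 + ‖x‖ with hr
  have hr1 : 1 ≤ r := by linarith [norm_nonneg x]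
  set D := (C + 1) * r ^ l with hD
  have hrl : 1 ≤ r ^ l := one_le_pow₀ hr1
  have hD1 : 1 ≤ D := by nlinarith
  have hφ0 : |φ x| ≤ C * r ^ l := by simpa using hφb 0 (Nat.zero_le _) x
  have hsq : 1 + φ x ^ 2 ≤ D ^ 2 := by
    rw [← sq_abs, hD]
    nlinarith [abs_nonneg (φ x), mul_nonneg hC (by linarith : (0 : ℝ) ≤ r ^ l)]
  have hcomp : ∀ i ≤ j, ‖iteratedFDeriv ℝ i (Φ ∘ φ) x‖ ≤ j.factorial * (B * D ^ 2) * D ^ j := by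
    intro i hi
    have := norm_iteratedFDeriv_comp_le (n := i) (C := B * D ^ 2) (D := D) hΦ hφ.1
      (by exact_mod_cast le_top) x
      (fun m hm => by
        rw [norm_iteratedFDeriv_eq_norm_iteratedDeriv]
        exact (hb m (hm.trans hi) _).trans (by gcongr))
      (fun m hm hm' => by
        refine (hφb m (hm'.trans hi) x).trans ?_
        have : C * r ^ l ≤ D := by rw [hD]; gcongr; linarith
        exact this.trans (le_self_pow₀ hD1 (by omega)))
    refine this.trans ?_
    gcongr
  have hg : ∀ i ≤ j, r ^ M * ‖iteratedFDeriv ℝ i g x‖ ≤ S := fun i hi =>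
    SchwartzMap.one_add_le_sup_seminorm_apply (𝕜 := ℂ) (m := (M, j)) le_rfl hi g x
  have hmul := norm_iteratedFDeriv_mul_le (n := j) (hΦ.comp hφ.1) (g.smooth ⊤) x
    (by exact_mod_cast le_top)
  have e : (2 : ℝ) ^ j = ∑ i ∈ Finset.range (j + 1), (j.choose i : ℝ) := by
    exact_mod_cast (Nat.sum_range_choose j).symm
  calc ‖x‖ ^ k * _ ≤ r ^ k * ∑ i ∈ Finset.range (j + 1), (j.choose i : ℝ) *
        ‖iteratedFDeriv ℝ i (Φ ∘ φ) x‖ * ‖iteratedFDeriv ℝ (j - i) g x‖ := by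
        gcongr
        · linarith
        · exact hmul
    _ ≤ r ^ k * ∑ i ∈ Finset.range (j + 1), (j.choose i : ℝ) *
        (j.factorial * (B * D ^ 2) * D ^ j) * ‖iteratedFDeriv ℝ (j - i) g x‖ := by
        gcongr with i hi
        have := Finset.mem_range.1 hi
        exact hcomp i (by omega)
    _ = ∑ i ∈ Finset.range (j + 1), (j.choose i : ℝ) * (j.factorial * (C + 1) ^ (j + 2) * B) *
        (r ^ M * ‖iteratedFDeriv ℝ (j - i) g x‖) := by
        rw [Finset.mul_sum]
        refine Finset.sum_congr rfl fun i _ => ?_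
        rw [hM, hD, mul_pow _ _ j]
        ring
    _ ≤ ∑ i ∈ Finset.range (j + 1), (j.choose i : ℝ) * (j.factorial * (C + 1) ^ (j + 2) * B) * S := by
        gcongr with i hi
        exact hg _ (by omega)
    _ = _ := by rw [← Finset.sum_mul, ← Finset.sum_mul, ← e]; ring

theorem exists_seminorm_bound (a : 𝓢'(V, ℂ)) : ∃ (s : Finset (ℕ × ℕ)) (C : ℝ), 0 ≤ C ∧
    ∀ f : 𝓢(V, ℂ), ‖a f‖ ≤ C * (s.sup (schwartzSeminormFamily ℂ V ℂ)) f := by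
  obtain ⟨s, C, -, h⟩ := Seminorm.bound_of_continuous (schwartz_withSeminorms ℂ V ℂ)
    ((normSeminorm ℂ ℂ).comp (a : 𝓢(V, ℂ) →ₗ[ℂ] ℂ)) (continuous_norm.comp a.continuous)
  exact ⟨s, C, C.2, fun f => h f⟩

/-- A tempered distribution has finite order, so finitely many derivatives of `Φ` suffice; `K` is
the largest order of differentiation among the seminorms that dominate `a`. -/
theorem exists_bound_apply_symbol (a : 𝓢'(V, ℂ)) {φ : V → ℝ} (hφ : φ.HasTemperateGrowth)
    (g : 𝓢(V, ℂ)) : ∃ (K : ℕ) (C : ℝ), 0 ≤ C ∧ ∀ (Φ : ℝ → ℂ) (B : ℝ), Φ.HasTemperateGrowth → 0 ≤ B →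
      (∀ i ≤ K, ∀ s, ‖iteratedDeriv i Φ s‖ ≤ B * (1 + s ^ 2)) →
        ‖a (SchwartzMap.smulLeftCLM ℂ (fun x => Φ (φ x)) g)‖ ≤ C * B := by
  obtain ⟨s, C, hC, h⟩ := exists_seminorm_bound a
  choose C' hC' h' using exists_bound_symbol_comp_mul hφ g
  refine ⟨s.sup Prod.snd, C * ∑ i ∈ s, C' i.1 i.2,
    mul_nonneg hC (Finset.sum_nonneg fun i _ => hC' _ _), fun Φ B hΦ hB hb => ?_⟩
  refine (h _).trans ?_
  rw [mul_assoc]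
  refine mul_le_mul_of_nonneg_left ?_ hC
  refine Seminorm.finset_sup_apply_le
    (mul_nonneg (Finset.sum_nonneg fun i _ => hC' _ _) hB) fun i hi => ?_
  have h1 : SchwartzMap.seminorm ℂ i.1 i.2 (SchwartzMap.smulLeftCLM ℂ (fun x => Φ (φ x)) g) ≤
      C' i.1 i.2 * B := by
    refine SchwartzMap.seminorm_le_bound ℂ _ _ _ (mul_nonneg (hC' _ _) hB) fun x => ?_
    have e : ⇑(SchwartzMap.smulLeftCLM ℂ (fun x => Φ (φ x)) g) = fun x => Φ (φ x) * g x := by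
      ext x
      exact SchwartzMap.smulLeftCLM_apply_apply (g := fun x => Φ (φ x)) (hΦ.comp hφ) g x
    rw [e]
    exact h' i.1 i.2 Φ B hΦ.1 hB
      (fun l hl => hb l (hl.trans (Finset.le_sup (f := Prod.snd) hi))) x
  refine h1.trans (mul_le_mul_of_nonneg_right ?_ hB)
  exact Finset.single_le_sum (f := fun i : ℕ × ℕ => C' i.1 i.2) (fun i _ => hC' _ _) hi

/-- A tempered distribution, tested on functions `(Φ ∘ φ) g`, is given by a continuous linear
functional of the weighted jet of `Φ`. -/
theorem exists_jet_functional (a : 𝓢'(V, ℂ)) {φ : V → ℝ} (hφ : φ.HasTemperateGrowth)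
    (g : 𝓢(V, ℂ)) : ∃ (K : ℕ) (L : (ℝ →ᵇ (Fin (K + 1) → ℂ)) →L[ℂ] ℂ), ∀ (Φ : ℝ → ℂ)
      (e : ℝ →ᵇ (Fin (K + 1) → ℂ)), Φ.HasTemperateGrowth →
      (∀ s i, e s i = (1 + s ^ 2 : ℝ)⁻¹ * iteratedDeriv i Φ s) →
        a (SchwartzMap.smulLeftCLM ℂ (fun x => Φ (φ x)) g) = L e := by
  obtain ⟨K, C, hC, hb⟩ := exists_bound_apply_symbol a hφ g
  have hs : ∀ s : ℝ, (1 + s ^ 2 : ℝ) ≠ 0 := fun s => by positivity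
  let p : Submodule ℂ (ℝ →ᵇ (Fin (K + 1) → ℂ)) :=
    { carrier := {e | ∃ Φ : ℝ → ℂ, Φ.HasTemperateGrowth ∧
        ∀ s i, e s i = (1 + s ^ 2 : ℝ)⁻¹ * iteratedDeriv i Φ s}
      zero_mem' := ⟨fun _ => 0, .const 0, fun s i => by simp⟩
      add_mem' := by
        rintro e e' ⟨Φ, hΦ, h⟩ ⟨Φ', hΦ', h'⟩
        refine ⟨Φ + Φ', hΦ.add hΦ', fun s i => ?_⟩
        rw [iteratedDeriv_add (hΦ.1.contDiffAt.of_le (by exact_mod_cast le_top))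
          (hΦ'.1.contDiffAt.of_le (by exact_mod_cast le_top)), mul_add, ← h, ← h']
        rfl
      smul_mem' := by
        rintro c e ⟨Φ, hΦ, h⟩
        refine ⟨fun s => c * Φ s, (Function.HasTemperateGrowth.const c).mul hΦ, fun s i => ?_⟩
        rw [iteratedDeriv_const_mul_field, mul_left_comm, ← h]
        rfl }
  -- The zeroth component of the jet determines `Φ`, so the functional below is defined on jets
  -- without a choice of `Φ`.
  have hsym : ∀ (e : ℝ →ᵇ (Fin (K + 1) → ℂ)) (Φ : ℝ → ℂ),
      (∀ s i, e s i = (1 + s ^ 2 : ℝ)⁻¹ * iteratedDeriv i Φ s) →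
      (fun x => ((1 + φ x ^ 2 : ℝ) : ℂ) * e (φ x) 0) = fun x => Φ (φ x) := by
    intro e Φ h
    ext x
    have : ((1 + φ x ^ 2 : ℝ) : ℂ) ≠ 0 := by exact_mod_cast hs _
    rw [h]
    simp only [Fin.val_zero, iteratedDeriv_zero, Complex.ofReal_inv]
    rw [mul_inv_cancel_left₀ this]
  have htemp : ∀ e ∈ p, (fun x => ((1 + φ x ^ 2 : ℝ) : ℂ) * e (φ x) 0).HasTemperateGrowth := by
    rintro e ⟨Φ, hΦ, h⟩
    rw [hsym e Φ h]
    exact hΦ.comp hφ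
  let ℓ : p →ₗ[ℂ] ℂ :=
    { toFun := fun e =>
        a (SchwartzMap.smulLeftCLM ℂ (fun x => ((1 + φ x ^ 2 : ℝ) : ℂ) * e.1 (φ x) 0) g)
      map_add' := fun e e' => by
        have h := SchwartzMap.smulLeftCLM_add (F := ℂ) (htemp e.1 e.2) (htemp e'.1 e'.2)
        rw [← map_add, ← add_apply, ← h]
        congr 3
        ext x
        exact mul_add _ _ _
      map_smul' := fun c e => by
        have h := SchwartzMap.smulLeftCLM_smul (F := ℂ) (htemp e.1 e.2) c
        rw [RingHom.id_apply, ← map_smul, ← smul_apply, ← h]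
        congr 3
        ext x
        exact mul_left_comm _ _ _ }
  have hbound : ∀ e : p, ‖ℓ e‖ ≤ C * ‖e‖ := by
    rintro ⟨e, Φ, hΦ, h⟩
    change ‖a (SchwartzMap.smulLeftCLM ℂ (fun x => ((1 + φ x ^ 2 : ℝ) : ℂ) * e (φ x) 0) g)‖ ≤ C * ‖e‖
    rw [hsym e Φ h]
    refine hb Φ _ hΦ (norm_nonneg _) fun i hi s => ?_
    have h1 : ‖e s ⟨i, by omega⟩‖ ≤ ‖e‖ := (norm_le_pi_norm _ _).trans (e.norm_coe_le_norm s)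
    have h2 : (0 : ℝ) < 1 + s ^ 2 := by positivity
    rw [h, norm_mul, Complex.norm_real, norm_inv, Real.norm_of_nonneg h2.le,
      inv_mul_le_iff₀ h2] at h1
    linarith
  -- Hahn-Banach: the integrated jets then need not be shown to lie in a closure of `p`.
  obtain ⟨L, hL, -⟩ := exists_extension_norm_eq p (ℓ.mkContinuous C hbound)
  refine ⟨K, L, fun Φ e hΦ h => ?_⟩
  rw [← hsym e Φ h]
  exact (hL ⟨e, Φ, hΦ, h⟩).symm

/-- The character `x ↦ exp(-2πi t x)`. -/
def phase (t x : ℝ) : ℂ := Complex.exp (((-2 * Real.pi * t * x : ℝ) : ℂ) * Complex.I)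

theorem norm_phase (t x : ℝ) : ‖phase t x‖ = 1 := Complex.norm_exp_ofReal_mul_I _

theorem phase_zero (x : ℝ) : phase 0 x = 1 := by
  rw [phase]; simp

theorem continuous_phase : Continuous fun q : ℝ × ℝ => phase q.1 q.2 := by
  unfold phase; fun_prop

theorem hasDerivAt_phase_right (t x : ℝ) :
    HasDerivAt (phase t) (-2 * Real.pi * Complex.I * t * phase t x) x := by
  have h1 : HasDerivAt (fun x : ℝ => ((-2 * Real.pi * t * x : ℝ) : ℂ) * Complex.I)
      (((-2 * Real.pi * t : ℝ) : ℂ) * Complex.I) x := by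
    have := ((hasDerivAt_id x).const_mul (-2 * Real.pi * t)).ofReal_comp.mul_const Complex.I
    simpa using this
  refine h1.cexp.congr_deriv ?_
  rw [phase]
  push_cast
  ring

theorem phase_comm (t x : ℝ) : phase t x = phase x t := by
  rw [phase, phase]; congr 3; ring

theorem iteratedDeriv_phase (t : ℝ) (i : ℕ) :
    iteratedDeriv i (phase t) = fun x => (-2 * Real.pi * Complex.I * t) ^ i * phase t x := by
  induction i with
  | zero => ext x; simp
  | succ i ih =>
    ext x
    rw [iteratedDeriv_succ, ih, ((hasDerivAt_phase_right t x).const_mul _).deriv, pow_succ]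
    ring

theorem contDiff_phase (t : ℝ) : ContDiff ℝ ∞ (phase t) := by
  unfold phase
  exact (Complex.ofRealCLM.contDiff.comp (contDiff_const.mul contDiff_id)).mul contDiff_const |>.cexp

theorem temperate_of_iteratedDeriv_bounded {Φ : ℝ → ℂ} (h : ContDiff ℝ ∞ Φ)
    (hb : ∀ n, ∃ C, ∀ x, ‖iteratedDeriv n Φ x‖ ≤ C) : Φ.HasTemperateGrowth := by
  refine ⟨h, fun n => ?_⟩
  obtain ⟨C, hC⟩ := hb n
  refine ⟨0, C, fun x => ?_⟩
  rw [norm_iteratedFDeriv_eq_norm_iteratedDeriv, pow_zero, mul_one]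
  exact hC x

theorem temperate_phase (t : ℝ) : (phase t).HasTemperateGrowth :=
  temperate_of_iteratedDeriv_bounded (contDiff_phase t) fun n =>
    ⟨‖(-2 * Real.pi * Complex.I * t : ℂ) ^ n‖, fun x => by
      rw [iteratedDeriv_phase, norm_mul, norm_phase, mul_one]⟩

theorem fourier_eq_integral_phase (f : ℝ → ℂ) (x : ℝ) : 𝓕 f x = ∫ t, phase t x * f t := by
  rw [Real.fourier_real_eq_integral_exp_smul]
  rfl

theorem contDiff_fourier_of_moments {f : ℝ → ℂ} (hf : ∀ n : ℕ, Integrable fun t => t ^ n • f t) :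
    ContDiff ℝ ∞ (𝓕 f) := by
  refine Real.contDiff_fourier (N := ⊤) fun n _ => ?_
  convert (hf n).norm using 2 with t
  rw [norm_smul, norm_pow]

theorem iteratedDeriv_fourier_of_moments {f : ℝ → ℂ}
    (hf : ∀ n : ℕ, Integrable fun t => t ^ n • f t) (i : ℕ) (x : ℝ) :
    iteratedDeriv i (𝓕 f) x = ∫ t, f t * iteratedDeriv i (phase t) x := by
  rw [Real.iteratedDeriv_fourier (N := ⊤) (fun n _ => hf n) le_top, fourier_eq_integral_phase]
  congr 1
  ext t
  rw [iteratedDeriv_phase, smul_eq_mul]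
  ring

theorem temperate_fourier_of_moments {f : ℝ → ℂ} (hf : ∀ n : ℕ, Integrable fun t => t ^ n • f t) :
    (𝓕 f).HasTemperateGrowth := by
  refine temperate_of_iteratedDeriv_bounded (contDiff_fourier_of_moments hf) fun n =>
    ⟨∫ t, ‖(-2 * Real.pi * Complex.I * t) ^ n * f t‖, fun x => ?_⟩
  rw [iteratedDeriv_fourier_of_moments hf]
  refine (norm_integral_le_integral_norm _).trans (le_of_eq (integral_congr_ae (.of_forall fun t => ?_)))
  simp only [iteratedDeriv_phase, norm_mul, norm_phase]
  ring

theorem norm_phase_sub_le (t t' x : ℝ) : ‖phase t x - phase t' x‖ ≤ 2 * Real.pi * |t - t'| * |x| := by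
  have e : phase t x = phase t' x * phase (t - t') x := by
    rw [phase, phase, phase, ← Complex.exp_add]
    congr 1
    push_cast
    ring
  have h := Real.norm_exp_I_mul_ofReal_sub_one_le (x := -2 * Real.pi * (t - t') * x)
  rw [e, show phase t' x * phase (t - t') x - phase t' x = phase t' x * (phase (t - t') x - 1) by ring,
    norm_mul, norm_phase, one_mul, phase, mul_comm _ Complex.I]
  refine h.trans (le_of_eq ?_)
  rw [Real.norm_eq_abs, abs_mul, abs_mul, abs_mul, abs_neg, abs_two, abs_of_pos Real.pi_pos]

/-- The weighted jet of the character `phase t`. -/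
def phaseJet (K : ℕ) (t : ℝ) : ℝ →ᵇ (Fin (K + 1) → ℂ) :=
  BoundedContinuousFunction.ofNormedAddCommGroup
    (fun s i => (1 + s ^ 2 : ℝ)⁻¹ * iteratedDeriv i (phase t) s)
    (continuous_pi fun i => (Complex.continuous_ofReal.comp
      (Continuous.inv₀ (by fun_prop) fun s => by positivity)).mul
      ((contDiff_phase t).continuous_iteratedDeriv i (by exact_mod_cast le_top)))
    (∑ i : Fin (K + 1), (2 * Real.pi) ^ (i : ℕ) * |t| ^ (i : ℕ)) (fun s => by
      refine (pi_norm_le_iff_of_nonneg (Finset.sum_nonneg fun i _ => by positivity)).2 fun i => ?_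
      refine le_trans ?_ (Finset.single_le_sum (f := fun i : Fin (K + 1) =>
        (2 * Real.pi) ^ (i : ℕ) * |t| ^ (i : ℕ)) (fun i _ => by positivity) (Finset.mem_univ i))
      rw [iteratedDeriv_phase, norm_mul, norm_mul, norm_phase, norm_pow, norm_mul, norm_mul, norm_mul,
        Complex.norm_real, Complex.norm_real, Complex.norm_I, norm_inv, norm_neg, Complex.norm_ofNat,
        Complex.norm_real, mul_one, mul_one, Real.norm_of_nonneg Real.pi_pos.le, Real.norm_eq_abs,
        Real.norm_eq_abs, mul_pow (2 * Real.pi)]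
      refine mul_le_of_le_one_left (by positivity) (inv_le_one_of_one_le₀ ?_)
      exact le_trans (by nlinarith [sq_nonneg s]) (le_abs_self _))

theorem phaseJet_apply (K : ℕ) (t s : ℝ) (i : Fin (K + 1)) :
    phaseJet K t s i = (1 + s ^ 2 : ℝ)⁻¹ * iteratedDeriv i (phase t) s := rfl

theorem norm_phaseJet_le (K : ℕ) (t : ℝ) :
    ‖phaseJet K t‖ ≤ ∑ i : Fin (K + 1), (2 * Real.pi) ^ (i : ℕ) * |t| ^ (i : ℕ) :=
  BoundedContinuousFunction.norm_ofNormedAddCommGroup_le _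
    (Finset.sum_nonneg fun i _ => by positivity) _

/-- This is what the weight `(1 + s²)⁻¹` is for. The difference of two characters is only bounded by
`2π |t - t₀| |s|`, which is not uniform in `s`, but `|s| / (1 + s²) ≤ 1`. -/
theorem continuous_phaseJet (K : ℕ) : Continuous (phaseJet K) := by
  let c : ℝ → ℂ := fun t => -2 * Real.pi * Complex.I * t
  have hc : Continuous c := by fun_prop
  let b : ℝ → ℝ → ℝ := fun t₀ t => ∑ i : Fin (K + 1),
    (‖c t ^ (i : ℕ) - c t₀ ^ (i : ℕ)‖ + ‖c t₀ ^ (i : ℕ)‖ * (2 * Real.pi * |t - t₀|))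
  refine continuous_iff_continuousAt.2 fun t₀ => ?_
  have hb : Continuous (b t₀) := by fun_prop
  rw [ContinuousAt, tendsto_iff_norm_sub_tendsto_zero]
  have hb0 : Filter.Tendsto (b t₀) (nhds t₀) (nhds 0) := by
    have := hb.tendsto t₀
    simpa [b] using this
  refine squeeze_zero (fun _ => norm_nonneg _) (fun t => ?_) hb0
  refine (BoundedContinuousFunction.norm_le (Finset.sum_nonneg fun i _ => by positivity)).2 fun s => ?_
  refine (pi_norm_le_iff_of_nonneg (Finset.sum_nonneg fun i _ => by positivity)).2 fun i => ?_
  refine le_trans ?_ (Finset.single_le_sum (f := fun i : Fin (K + 1) =>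
    ‖c t ^ (i : ℕ) - c t₀ ^ (i : ℕ)‖ + ‖c t₀ ^ (i : ℕ)‖ * (2 * Real.pi * |t - t₀|))
    (fun i _ => by positivity) (Finset.mem_univ i))
  change ‖phaseJet K t s i - phaseJet K t₀ s i‖ ≤ _
  rw [phaseJet_apply, phaseJet_apply, iteratedDeriv_phase, iteratedDeriv_phase]
  have e : ((1 + s ^ 2 : ℝ)⁻¹ : ℝ) * (c t ^ (i : ℕ) * phase t s) -
      ((1 + s ^ 2 : ℝ)⁻¹ : ℝ) * (c t₀ ^ (i : ℕ) * phase t₀ s) =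
      ((1 + s ^ 2 : ℝ)⁻¹ : ℝ) * ((c t ^ (i : ℕ) - c t₀ ^ (i : ℕ)) * phase t s) +
      c t₀ ^ (i : ℕ) * (((1 + s ^ 2 : ℝ)⁻¹ : ℝ) * (phase t s - phase t₀ s)) := by ring
  have hs : (0 : ℝ) < 1 + s ^ 2 := by positivity
  have hs1 : (1 + s ^ 2 : ℝ)⁻¹ ≤ 1 := inv_le_one_of_one_le₀ (by nlinarith [sq_nonneg s])
  have hs2 : (1 + s ^ 2 : ℝ)⁻¹ * |s| ≤ 1 := by
    rw [inv_mul_le_iff₀ hs, mul_one, ← sq_abs]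
    nlinarith [sq_nonneg (|s| - 1)]
  refine (le_of_eq (congrArg norm e)).trans ((norm_add_le _ _).trans (add_le_add ?_ ?_))
  · rw [norm_mul, norm_mul, norm_phase, mul_one, Complex.norm_real, Real.norm_of_nonneg (by positivity)]
    exact mul_le_of_le_one_left (norm_nonneg _) hs1
  · rw [norm_mul, norm_mul, Complex.norm_real, Real.norm_of_nonneg (by positivity)]
    refine mul_le_mul_of_nonneg_left ?_ (norm_nonneg _)
    calc _ ≤ (1 + s ^ 2 : ℝ)⁻¹ * (2 * Real.pi * |t - t₀| * |s|) := by
          gcongr; exact norm_phase_sub_le _ _ _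
      _ = 2 * Real.pi * |t - t₀| * ((1 + s ^ 2 : ℝ)⁻¹ * |s|) := by ring
      _ ≤ _ := mul_le_of_le_one_right (by positivity) hs2

/-- The norm of the jet grows at most like a polynomial of degree `K` in `|t|`, so integrable
moments of `f` are enough. -/
theorem integrable_smul_phaseJet (K : ℕ) {f : ℝ → ℂ} (hf : ∀ n : ℕ, Integrable fun t => t ^ n • f t) :
    Integrable fun t => f t • phaseJet K t := by
  have hf0 : Integrable f := by simpa using hf 0
  refine Integrable.mono' (g := fun t => ∑ i : Fin (K + 1), (2 * Real.pi) ^ (i : ℕ) *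
    ‖t ^ (i : ℕ) • f t‖) (integrable_finsetSum _ fun i _ => ((hf i).norm.const_mul _))
    (hf0.aestronglyMeasurable.smul (continuous_phaseJet K).aestronglyMeasurable)
    (.of_forall fun t => ?_)
  rw [norm_smul]
  refine (mul_le_mul_of_nonneg_left (norm_phaseJet_le K t) (norm_nonneg _)).trans (le_of_eq ?_)
  rw [Finset.mul_sum]
  refine Finset.sum_congr rfl fun i _ => ?_
  rw [norm_smul, norm_pow, Real.norm_eq_abs]
  ring

/-- Pairing a distribution with a superposition of the functions `exp(-2πi t φ) g`. -/
theorem pairing_integral (a : 𝓢'(V, ℂ)) {φ : V → ℝ} (hφ : φ.HasTemperateGrowth) (g : 𝓢(V, ℂ)) :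
    (Continuous fun t => a (SchwartzMap.smulLeftCLM ℂ (fun x => phase t (φ x)) g)) ∧
    ∀ f : ℝ → ℂ, (∀ n : ℕ, Integrable fun t => t ^ n • f t) →
      Integrable (fun t => a (SchwartzMap.smulLeftCLM ℂ (fun x => phase t (φ x)) g) * f t) ∧
      ∫ t, a (SchwartzMap.smulLeftCLM ℂ (fun x => phase t (φ x)) g) * f t =
        a (SchwartzMap.smulLeftCLM ℂ (fun x => 𝓕 f (φ x)) g) := by
  obtain ⟨K, L, hL⟩ := exists_jet_functional a hφ g
  have hy : (fun t => a (SchwartzMap.smulLeftCLM ℂ (fun x => phase t (φ x)) g)) =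
      fun t => L (phaseJet K t) :=
    funext fun t => hL (phase t) (phaseJet K t) (temperate_phase t) fun s i => phaseJet_apply K t s i
  refine ⟨hy ▸ L.continuous.comp (continuous_phaseJet K), fun f hf => ?_⟩
  have hint := integrable_smul_phaseJet K hf
  have e : (fun t => a (SchwartzMap.smulLeftCLM ℂ (fun x => phase t (φ x)) g) * f t) =
      fun t => L (f t • phaseJet K t) := by
    ext t
    rw [map_smul, smul_eq_mul, mul_comm]
    exact congrArg (f t * ·) (congrFun hy t)
  rw [e]
  refine ⟨L.integrable_comp hint, ?_⟩
  rw [L.integral_comp_comm hint]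
  -- Point evaluations commute with the Bochner integral, so the integrated jet is the weighted jet
  -- of `𝓕 f`.
  refine (hL (𝓕 f) _ (temperate_fourier_of_moments hf) fun s i => ?_).symm
  have h1 : (∫ t, f t • phaseJet K t) s i = ∫ t, f t * phaseJet K t s i := by
    have := (((ContinuousLinearMap.proj (R := ℂ) (φ := fun _ : Fin (K + 1) => ℂ) i) ∘L
      (BoundedContinuousFunction.evalCLM ℂ s)).integral_comp_comm hint)
    exact this.symm
  rw [h1, iteratedDeriv_fourier_of_moments hf, ← integral_const_mul]
  congr 1
  ext t
  rw [phaseJet_apply]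
  ring

end Pairing

/-! ### Smooth dependence of the pairing on time. -/

section PairingSmooth
variable {V : Type} [NormedAddCommGroup V] [NormedSpace ℝ V]

theorem temperate_ofReal {φ : V → ℝ} (hφ : φ.HasTemperateGrowth) :
    (fun x => (φ x : ℂ)).HasTemperateGrowth := Complex.ofRealCLM.hasTemperateGrowth.comp hφ

theorem temperate_phase_comp (t : ℝ) {φ : V → ℝ} (hφ : φ.HasTemperateGrowth) :
    (fun x => phase t (φ x)).HasTemperateGrowth := (temperate_phase t).comp hφ

theorem moments_indicator (s t : ℝ) (n : ℕ) :
    Integrable fun r : ℝ => r ^ n • (Set.Ioc s t).indicator (fun _ => (1 : ℂ)) r := by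
  have e : (fun r : ℝ => r ^ n • (Set.Ioc s t).indicator (fun _ => (1 : ℂ)) r) =
      (Set.Ioc s t).indicator fun r => ((r ^ n : ℝ) : ℂ) := by
    ext r
    by_cases hr : r ∈ Set.Ioc s t <;> simp [hr]
  rw [e, integrable_indicator_iff measurableSet_Ioc]
  exact (Continuous.integrableOn_Icc (by fun_prop)).mono_set Set.Ioc_subset_Icc_self

theorem mul_fourier_indicator {s t : ℝ} (hst : s ≤ t) (x : ℝ) :
    (-2 * Real.pi * Complex.I * x) * 𝓕 ((Set.Ioc s t).indicator fun _ => (1 : ℂ)) x =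
      phase t x - phase s x := by
  have e : (fun r => phase r x * (Set.Ioc s t).indicator (fun _ => (1 : ℂ)) r) =
      (Set.Ioc s t).indicator fun r => phase r x := by
    ext r
    by_cases hr : r ∈ Set.Ioc s t <;> simp [hr]
  rw [fourier_eq_integral_phase, e, integral_indicator measurableSet_Ioc,
    ← intervalIntegral.integral_of_le hst, ← intervalIntegral.integral_const_mul]
  have hd : ∀ r : ℝ, HasDerivAt (fun r => phase r x) (-2 * Real.pi * Complex.I * x * phase r x) r := by
    intro r
    have := hasDerivAt_phase_right x r
    simp only [phase_comm _ x]
    exact this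
  refine intervalIntegral.integral_eq_sub_of_hasDerivAt (fun r _ => hd r) ?_
  refine Continuous.intervalIntegrable ?_ _ _
  exact continuous_const.mul (continuous_phase.comp (by fun_prop : Continuous fun r : ℝ => (r, x)))

/-- No difference quotient is estimated. The candidate derivative is continuous, and integrating it
over an interval by `pairing_integral` gives the increment of the pairing, so the fundamental
theorem of calculus applies. -/
theorem hasDerivAt_pairing (a : 𝓢'(V, ℂ)) {φ : V → ℝ} (hφ : φ.HasTemperateGrowth) (g : 𝓢(V, ℂ))
    (t : ℝ) : HasDerivAt (fun t => a (SchwartzMap.smulLeftCLM ℂ (fun x => phase t (φ x)) g))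
      (a (SchwartzMap.smulLeftCLM ℂ (fun x => phase t (φ x))
        (SchwartzMap.smulLeftCLM ℂ (fun x => -2 * Real.pi * Complex.I * (φ x : ℂ)) g))) t := by
  have hφ' : (fun x => -2 * Real.pi * Complex.I * (φ x : ℂ)).HasTemperateGrowth :=
    (Function.HasTemperateGrowth.const _).mul (temperate_ofReal hφ)
  set g' := SchwartzMap.smulLeftCLM ℂ (fun x => -2 * Real.pi * Complex.I * (φ x : ℂ)) g with hg'
  set y := fun t => a (SchwartzMap.smulLeftCLM ℂ (fun x => phase t (φ x)) g) with hy
  set y' := fun t => a (SchwartzMap.smulLeftCLM ℂ (fun x => phase t (φ x)) g') with hy'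
  obtain ⟨hc, hint⟩ := pairing_integral a hφ g'
  have key : ∀ s t : ℝ, s ≤ t → ∫ r in s..t, y' r = y t - y s := by
    intro s t hst
    have h := (hint _ (moments_indicator s t)).2
    have e : (fun r => y' r * (Set.Ioc s t).indicator (fun _ => (1 : ℂ)) r) =
        (Set.Ioc s t).indicator y' := by
      ext r
      by_cases hr : r ∈ Set.Ioc s t <;> simp [hr]
    rw [e, integral_indicator measurableSet_Ioc, ← intervalIntegral.integral_of_le hst] at h
    rw [h, hy, ← map_sub]
    congr 1
    ext x
    have hf : (fun x => 𝓕 ((Set.Ioc s t).indicator fun _ => (1 : ℂ)) (φ x)).HasTemperateGrowth :=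
      (temperate_fourier_of_moments (moments_indicator s t)).comp hφ
    rw [sub_apply, SchwartzMap.smulLeftCLM_apply_apply (temperate_phase_comp t hφ),
      SchwartzMap.smulLeftCLM_apply_apply (temperate_phase_comp s hφ),
      SchwartzMap.smulLeftCLM_apply_apply hf, hg', SchwartzMap.smulLeftCLM_apply_apply hφ']
    simp only [smul_eq_mul]
    rw [← sub_mul, ← mul_fourier_indicator hst]
    ring
  have key' : ∀ r, y r = y 0 + ∫ r in (0 : ℝ)..r, y' r := by
    intro r
    rcases le_total 0 r with h | h
    · rw [key 0 r h]; ring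
    · rw [intervalIntegral.integral_symm, key r 0 h]; ring
  have := (intervalIntegral.integral_hasDerivAt_right (hc.intervalIntegrable 0 t)
    (hc.stronglyMeasurableAtFilter _ _) hc.continuousAt).const_add (y 0)
  exact this.congr_of_eventuallyEq (.of_forall key')

/-- The derivative is again a pairing of the same kind, with `g` replaced by `-2πi φ g`; hence the
induction over all `g`. -/
theorem contDiff_pairing (a : 𝓢'(V, ℂ)) {φ : V → ℝ} (hφ : φ.HasTemperateGrowth) (g : 𝓢(V, ℂ)) :
    ContDiff ℝ ∞ fun t => a (SchwartzMap.smulLeftCLM ℂ (fun x => phase t (φ x)) g) := by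
  refine contDiff_infty.2 fun n => ?_
  induction n generalizing g with
  | zero => exact contDiff_zero.2 (pairing_integral a hφ g).1
  | succ n ih =>
    have hd := hasDerivAt_pairing a hφ g
    push_cast
    refine contDiff_succ_iff_deriv.2 ⟨fun t => (hd t).differentiableAt, by simp, ?_⟩
    rw [show deriv _ = _ from funext fun t => (hd t).deriv]
    exact ih _

theorem moments_schwartz (f : 𝓢(ℝ, ℂ)) (n : ℕ) : Integrable fun t : ℝ => t ^ n • f t := by
  refine (f.integrable_pow_mul volume n).mono' ((continuous_id.pow n).smul
    f.continuous).aestronglyMeasurable (.of_forall fun t => ?_)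
  rw [norm_smul, norm_pow]

end PairingSmooth

/-! ### Hadamard division of Schwartz functions by a coordinate. -/

section Division
variable {n : ℕ}

/-- The contraction `x ↦ (θ x⁰, 𝐱)`. -/
def squash (θ : ℝ) : Eucl (n + 1) →L[ℝ] Eucl (n + 1) :=
  ContinuousLinearMap.id ℝ _ + (θ - 1) • (plusForm n).smulRight (EuclideanSpace.single 0 1)

theorem squash_apply (θ : ℝ) (x : Eucl (n + 1)) :
    squash θ x = x + ((θ - 1) * x 0) • EuclideanSpace.single 0 1 := by
  rw [mul_smul]; rfl

theorem squash_zero (θ : ℝ) (x : Eucl (n + 1)) : squash θ x 0 = θ * x 0 := by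
  rw [squash_apply]; simp; ring

theorem tail_squash (θ : ℝ) (x : Eucl (n + 1)) : tail (squash θ x) = tail x := by
  ext i
  rw [squash_apply]; simp [tail]

theorem norm_le_one_add_norm_squash (θ : ℝ) {x : Eucl (n + 1)} (hx : |x 0| ≤ 1) :
    ‖x‖ ≤ 1 + ‖squash θ x‖ := by
  have h1 := norm_le_plus_tail x
  have h2 := norm_tail_le (squash θ x)
  rw [tail_squash] at h2
  linarith

variable {E : Type} [NormedAddCommGroup E] [NormedSpace ℝ E]

/-- The weighted average of `F` along the segment from `(0, 𝐱)` to `(x⁰, 𝐱)`. -/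
def segAverage (w : ℝ → ℝ) (F : 𝓢(Eucl (n + 1), E)) (x : Eucl (n + 1)) : E :=
  ∫ θ in (0 : ℝ)..1, w θ • F (squash θ x)

/-- The derivative of `F`, composed with a linear map. -/
def fderivComp (A : Eucl (n + 1) →L[ℝ] Eucl (n + 1)) (F : 𝓢(Eucl (n + 1), E)) :
    𝓢(Eucl (n + 1), Eucl (n + 1) →L[ℝ] E) :=
  SchwartzMap.postcompCLM ((ContinuousLinearMap.compL ℝ (Eucl (n + 1)) (Eucl (n + 1)) E).flip A)
    (SchwartzMap.fderivCLM ℝ (Eucl (n + 1)) E F)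

theorem fderivComp_apply (A : Eucl (n + 1) →L[ℝ] Eucl (n + 1)) (F : 𝓢(Eucl (n + 1), E))
    (x : Eucl (n + 1)) : fderivComp A F x = (fderiv ℝ F x) ∘L A := rfl

theorem continuous_squash_uncurry (x : Eucl (n + 1)) : Continuous fun θ : ℝ => squash θ x := by
  simp only [squash_apply]
  fun_prop

/-- Since `squash θ` is affine in `θ`, the derivative is a sum of two averages with weights `w` and
`θ w`. Averages with arbitrary weights and arbitrary target spaces are thus closed under
differentiation, which drives the inductions below. -/
theorem hasFDerivAt_segAverage {w : ℝ → ℝ} (hw : Continuous w) (F : 𝓢(Eucl (n + 1), E))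
    (x : Eucl (n + 1)) : HasFDerivAt (segAverage w F)
      (segAverage w (fderivComp (squash 0) F) x +
        segAverage (fun θ => θ * w θ) (fderivComp (squash 1 - squash 0) F) x) x := by
  have hsq : ∀ θ : ℝ, (squash θ : Eucl (n + 1) →L[ℝ] Eucl (n + 1)) =
      squash 0 + θ • (squash 1 - squash 0) := by
    intro θ
    ext1 y
    simp only [squash_apply, add_apply, smul_apply, sub_apply]
    module
  have hi : ∀ {E' : Type} [NormedAddCommGroup E'] [NormedSpace ℝ E'] (w : ℝ → ℝ), Continuous w →
      ∀ (F : 𝓢(Eucl (n + 1), E')) (x : Eucl (n + 1)),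
        Continuous fun θ => w θ • F (squash θ x) := fun w hw F x =>
    hw.smul (F.continuous.comp (continuous_squash_uncurry x))
  set D : Eucl (n + 1) → ℝ → (Eucl (n + 1) →L[ℝ] E) := fun x θ =>
    w θ • fderivComp (squash 0) F (squash θ x) +
      (θ * w θ) • fderivComp (squash 1 - squash 0) F (squash θ x) with hD
  have hw' : Continuous fun θ : ℝ => θ * w θ := continuous_id.mul hw
  have hDc : ∀ x, Continuous (D x) := fun x => (hi w hw _ x).add (hi _ hw' _ x)
  obtain ⟨C0, hC0⟩ : ∃ C, ∀ y, ‖fderivComp (squash 0) F y‖ ≤ C :=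
    ⟨_, fun y => SchwartzMap.norm_le_seminorm ℝ _ y⟩
  obtain ⟨C1, hC1⟩ : ∃ C, ∀ y, ‖fderivComp (squash 1 - squash 0) F y‖ ≤ C :=
    ⟨_, fun y => SchwartzMap.norm_le_seminorm ℝ _ y⟩
  have h := intervalIntegral.hasFDerivAt_integral_of_dominated_of_fderiv_le (μ := volume) (𝕜 := ℝ)
    (F := fun x θ => w θ • F (squash θ x)) (F' := D) (x₀ := x) (s := Set.univ) (a := 0) (b := 1)
    (bound := fun θ => |w θ| * C0 + |θ * w θ| * C1) Filter.univ_mem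
    (.of_forall fun y => (hi w hw F y).aestronglyMeasurable)
    ((hi w hw F x).intervalIntegrable _ _) (hDc x).aestronglyMeasurable
    (.of_forall fun θ _ y _ => by
      refine (norm_add_le _ _).trans (add_le_add ?_ ?_)
      · rw [norm_smul, Real.norm_eq_abs]
        exact mul_le_mul_of_nonneg_left (hC0 _) (abs_nonneg _)
      · rw [norm_smul, Real.norm_eq_abs]
        exact mul_le_mul_of_nonneg_left (hC1 _) (abs_nonneg _))
    (Continuous.intervalIntegrable (by fun_prop) _ _)
    (.of_forall fun θ _ y _ => by
      have h1 : HasFDerivAt (fun y => F (squash θ y)) ((fderiv ℝ F (squash θ y)) ∘L squash θ) y :=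
        (F.hasFDerivAt (squash θ y)).comp y (squash θ).hasFDerivAt
      refine (h1.const_smul (w θ)).congr_fderiv ?_
      simp only [hD, fderivComp_apply]
      rw [hsq θ, ContinuousLinearMap.comp_add, ContinuousLinearMap.comp_smul, smul_add, smul_smul,
        mul_comm θ, ← hsq θ])
  refine h.congr_fderiv ?_
  exact intervalIntegral.integral_add ((hi w hw _ x).intervalIntegrable _ _)
    ((hi _ hw' _ x).intervalIntegrable _ _)

theorem fderiv_segAverage {w : ℝ → ℝ} (hw : Continuous w) (F : 𝓢(Eucl (n + 1), E)) :
    fderiv ℝ (segAverage w F) = segAverage w (fderivComp (squash 0) F) +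
        segAverage (fun θ => θ * w θ) (fderivComp (squash 1 - squash 0) F) :=
  funext fun x => (hasFDerivAt_segAverage hw F x).fderiv

theorem contDiff_segAverage (k : ℕ) : ∀ {E : Type} [NormedAddCommGroup E] [NormedSpace ℝ E]
    {w : ℝ → ℝ} (_ : Continuous w) (F : 𝓢(Eucl (n + 1), E)), ContDiff ℝ k (segAverage w F) := by
  induction k with
  | zero =>
    intro E _ _ w hw F
    exact contDiff_zero.2 (continuous_iff_continuousAt.2 fun x =>
      (hasFDerivAt_segAverage hw F x).continuousAt)
  | succ k ih =>
    intro E _ _ w hw F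
    push_cast
    refine contDiff_succ_iff_fderiv.2
      ⟨fun x => (hasFDerivAt_segAverage hw F x).differentiableAt, by simp, ?_⟩
    rw [fderiv_segAverage hw]
    exact (ih hw _).add (ih (continuous_id.mul hw) _)

/-- Near `θ = 0` the average does not see `x⁰`, so `F` yields no decay in that direction; in the
slab `|x⁰| ≤ 1` decay in `𝐱` is all that is required. -/
theorem segAverage_decay (N j : ℕ) : ∀ {E : Type} [NormedAddCommGroup E] [NormedSpace ℝ E]
    {w : ℝ → ℝ} (_ : Continuous w) (F : 𝓢(Eucl (n + 1), E)), ∃ C, ∀ x : Eucl (n + 1), |x 0| ≤ 1 →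
      ‖x‖ ^ N * ‖iteratedFDeriv ℝ j (segAverage w F) x‖ ≤ C := by
  induction j with
  | zero =>
    intro E _ _ w hw F
    obtain ⟨W, hW⟩ := isCompact_Icc.exists_bound_of_continuousOn (s := Set.Icc (0 : ℝ) 1)
      hw.continuousOn
    set S := (2 : ℝ) ^ N * ((Finset.Iic (N, 0)).sup fun m => SchwartzMap.seminorm ℝ m.1 m.2) F
    refine ⟨W * S, fun x hx => ?_⟩
    rw [norm_iteratedFDeriv_zero, ← Real.norm_of_nonneg (by positivity : 0 ≤ ‖x‖ ^ N), ← norm_smul,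
      segAverage, ← intervalIntegral.integral_smul]
    refine (intervalIntegral.norm_integral_le_of_norm_le_const (C := W * S) fun θ hθ => ?_).trans
      (by simp)
    rw [Set.uIoc_of_le zero_le_one] at hθ
    rw [norm_smul, norm_smul, norm_pow, norm_norm, mul_left_comm]
    refine mul_le_mul (hW θ ⟨hθ.1.le, hθ.2⟩) ?_ (by positivity)
      ((norm_nonneg _).trans (hW θ ⟨hθ.1.le, hθ.2⟩))
    have := SchwartzMap.one_add_le_sup_seminorm_apply (𝕜 := ℝ) (m := (N, 0)) le_rfl le_rfl F
      (squash θ x)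
    rw [norm_iteratedFDeriv_zero] at this
    refine le_trans ?_ this
    gcongr
    exact norm_le_one_add_norm_squash θ hx
  | succ j ih =>
    intro E _ _ w hw F
    have hw' : Continuous fun θ : ℝ => θ * w θ := continuous_id.mul hw
    obtain ⟨C, hC⟩ := ih hw (fderivComp (squash 0) F)
    obtain ⟨C', hC'⟩ := ih hw' (fderivComp (squash 1 - squash 0) F)
    refine ⟨C + C', fun x hx => ?_⟩
    rw [← norm_iteratedFDeriv_fderiv, fderiv_segAverage hw,
      iteratedFDeriv_add_apply (contDiff_segAverage j hw _).contDiffAt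
        (contDiff_segAverage j hw' _).contDiffAt]
    calc _ ≤ ‖x‖ ^ N * (_ + _) := by gcongr; exact norm_add_le _ _
      _ ≤ _ := by rw [mul_add]; exact add_le_add (hC x hx) (hC' x hx)

theorem ModerateOn.mono {V F : Type} [NormedAddCommGroup V] [NormedSpace ℝ V]
    [NormedAddCommGroup F] [NormedSpace ℝ F] {U U' : Set V} {ρ ρ' : V → ℝ} {f : V → F} {c : ℝ}
    (hf : ModerateOn U ρ f) (hU : IsOpen U) (hU' : IsOpen U') (hs : U' ⊆ U)
    (hρ : ∀ x ∈ U', 0 ≤ ρ x) (hρ' : ∀ x ∈ U', 0 ≤ ρ' x) (h : ∀ x ∈ U', ρ x ≤ c * ρ' x) :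
    ModerateOn U' ρ' f := by
  refine ⟨hf.1.mono hs, fun j => ?_⟩
  obtain ⟨N, C, hC, hb⟩ := hf.2 j
  refine ⟨N, C * |c| ^ N, by positivity, fun i hi x hx => ?_⟩
  rw [iteratedFDerivWithin_of_isOpen i hU' hx, ← iteratedFDerivWithin_of_isOpen i hU (hs hx)]
  refine (hb i hi x (hs hx)).trans ?_
  rw [mul_assoc]
  refine mul_le_mul_of_nonneg_left ?_ hC
  calc ρ x ^ N ≤ (c * ρ' x) ^ N := pow_le_pow_left₀ (hρ x hx) (h x hx) N
    _ ≤ |c * ρ' x| ^ N := by rw [← abs_pow]; exact le_abs_self _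
    _ = _ := by rw [abs_mul, abs_of_nonneg (hρ' x hx), mul_pow]

/-- A Schwartz function which vanishes on the hyperplane `x⁰ = 0` is divisible by `x⁰`. -/
theorem exists_eq_zeroth_mul (G : 𝓢(Eucl (n + 1), ℂ)) (hG : ∀ x, x 0 = 0 → G x = 0) :
    ∃ H : 𝓢(Eucl (n + 1), ℂ), ∀ x, G x = x 0 * H x := by
  -- Hadamard's formula: `θ ↦ G (θ x⁰, 𝐱)` has derivative `x⁰ ∂₀G`, and its value at `θ = 0`
  -- vanishes.
  set F : 𝓢(Eucl (n + 1), ℂ) := ∂_{(EuclideanSpace.single 0 (1 : ℝ) : Eucl (n + 1))} G with hF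
  set H := segAverage (fun _ => 1) F with hH
  have hGH : ∀ x, G x = x 0 * H x := by
    intro x
    have hd : ∀ θ : ℝ, HasDerivAt (fun θ => G (squash θ x)) (x 0 * F (squash θ x)) θ := by
      intro θ
      have h1 : HasDerivAt (fun θ : ℝ => squash θ x)
          (x 0 • EuclideanSpace.single 0 (1 : ℝ)) θ := by
        simp only [squash_apply]
        have := ((((hasDerivAt_id θ).sub_const 1).mul_const (x 0)).smul_const
          (EuclideanSpace.single (0 : Fin (n + 1)) (1 : ℝ))).const_add x
        simpa using this
      refine ((G.hasFDerivAt (squash θ x)).comp_hasDerivAt θ h1).congr_deriv ?_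
      rw [map_smul, hF, SchwartzMap.lineDerivOp_apply_eq_fderiv, Complex.real_smul]
    have hi := intervalIntegral.integral_eq_sub_of_hasDerivAt (a := 0) (b := 1) (fun θ _ => hd θ)
      (Continuous.intervalIntegrable
        (continuous_const.mul (F.continuous.comp (continuous_squash_uncurry x))) _ _)
    have h1 : squash 1 x = x := by rw [squash_apply]; simp
    rw [h1, hG (squash 0 x) (by rw [squash_zero, zero_mul]), sub_zero,
      intervalIntegral.integral_const_mul] at hi
    rw [← hi, hH, segAverage]
    simp
  have hc : ContDiff ℝ ∞ H := contDiff_infty.2 fun k => contDiff_segAverage k continuous_const F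
  -- Outside the slab the quotient is estimated as `G / x⁰`; on `U` the factor `1 / x⁰` has
  -- derivatives of moderate growth.
  set U : Set (Eucl (n + 1)) := {x | 1 / 2 < |x 0|} with hU
  have hUo : IsOpen U := isOpen_lt continuous_const (plusForm n).continuous.abs
  have hUs : U ⊆ offPlane n := fun x hx h0 => by
    have h0' : x 0 = 0 := h0
    have : 1 / 2 < |x 0| := hx
    rw [h0'] at this; norm_num at this
  have hwt : ModerateOn U (fun x => 1 + ‖x‖) (fun x : Eucl (n + 1) => (((x 0)⁻¹ : ℝ) : ℂ)) := by
    -- On `U` the weight `1 + ‖x‖ + 1 / |x⁰|` is at most `3 + ‖x‖`.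
    refine moderateOn_I_inv.mono (c := 3) isOpen_offPlane hUo hUs
      (fun x _ => by linarith [one_le_weight x]) (fun x _ => by positivity) fun x hx => ?_
    have hx' : 1 / 2 < |x 0| := hx
    have : |x 0|⁻¹ ≤ 2 := by
      rw [inv_le_comm₀ (by linarith) (by norm_num)]; linarith
    simp only [squeezeWeight]
    linarith [norm_nonneg x]
  refine ⟨⟨H, hc, fun N j => ?_⟩, hGH⟩
  obtain ⟨C, hC⟩ := segAverage_decay N j (continuous_const (y := (1 : ℝ))) F
  obtain ⟨N', C', hC', hb⟩ := ModerateOn.weighted_comp_bound (U' := Set.univ) (φ := id) (k := 1)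
    (C₀ := 1) (ρ' := fun x => 1 + ‖x‖) hUo isOpen_univ
    (fun x _ => by linarith [norm_nonneg x]) (fun x _ => by linarith [norm_nonneg x])
    (.of_temperate hUo (fun x _ => le_rfl) .id) hwt (Set.mapsTo_univ _ _)
    (fun x _ => by simp) j N
  obtain ⟨s, C₁, hC₁, h1⟩ := schwartz_ctrl_bound (W := Eucl (n + 1)) N' j
  refine ⟨max C (C' * (C₁ * (s.sup (schwartzSeminormFamily ℂ (Eucl (n + 1)) ℂ)) G)), fun x => ?_⟩
  rcases le_or_gt |x 0| 1 with hx | hx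
  · exact (hC x hx).trans (le_max_left _ _)
  · have hxU : x ∈ U := by change 1 / 2 < |x 0|; linarith
    have := hb G (G.smooth ⊤).contDiffOn _ (by positivity) (h1 G) x hxU
    have e : Set.EqOn H (fun x => (((x 0)⁻¹ : ℝ) : ℂ) * G (id x)) U := by
      intro y hy
      have h0 : ((y 0 : ℝ) : ℂ) ≠ 0 := Complex.ofReal_ne_zero.2 (hUs hy)
      change _ = (((y 0)⁻¹ : ℝ) : ℂ) * G y
      rw [hGH y]
      push_cast
      rw [inv_mul_cancel_left₀ h0]
    rw [← iteratedFDerivWithin_congr e hxU, iteratedFDerivWithin_of_isOpen j hUo hxU] at this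
    refine le_trans ?_ (this.trans (le_max_right C _))
    gcongr
    linarith

end Division

/-! ### Restriction to the mass shell and division by its equation. -/

section Shell
variable {n : ℕ}

/-- The projection `(x⁰, 𝐱) ↦ 𝐱` as a continuous linear map. -/
def tailCLM (n : ℕ) : Eucl (n + 1) →L[ℝ] Eucl n :=
  LinearMap.toContinuousLinearMap
    { toFun := tail
      map_add' := fun _ _ => rfl
      map_smul' := fun _ _ => rfl }

theorem tailCLM_apply (x : Eucl (n + 1)) : tailCLM n x = tail x := rfl

theorem norm_tailCLM_le : ‖tailCLM n‖ ≤ 1 :=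
  ContinuousLinearMap.opNorm_le_bound _ zero_le_one fun x => by
    rw [one_mul]; exact norm_tail_le x

theorem norm_plusForm_le : ‖plusForm n‖ ≤ 1 :=
  ContinuousLinearMap.opNorm_le_bound _ zero_le_one fun x => by
    rw [one_mul]; exact abs_plus_le x

/-- The point `(t, 𝐱)`. -/
def cons (t : ℝ) (x : Eucl n) : Eucl (n + 1) :=
  WithLp.toLp 2 (Fin.cons (α := fun _ => ℝ) t fun i => x i)

@[simp] theorem cons_zero (t : ℝ) (x : Eucl n) : cons t x 0 = t := rfl
@[simp] theorem cons_succ (t : ℝ) (x : Eucl n) (i : Fin n) : cons t x i.succ = x i := rfl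
@[simp] theorem tail_cons (t : ℝ) (x : Eucl n) : tail (cons t x) = x := rfl

theorem ext_tail {x y : Eucl (n + 1)} (h0 : x 0 = y 0) (h1 : tail x = tail y) : x = y := by
  ext i
  induction i using Fin.cases with
  | zero => exact h0
  | succ i => exact congrArg (fun z : Eucl n => z i) h1

/-- The embedding `𝐱 ↦ (0, 𝐱)`. -/
def inclTail (n : ℕ) : Eucl n →L[ℝ] Eucl (n + 1) :=
  LinearMap.toContinuousLinearMap
    { toFun := cons 0
      map_add' := fun x y => ext_tail (by simp) rfl
      map_smul' := fun c x => ext_tail (by simp) rfl }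

theorem tail_add_smul_single (x : Eucl (n + 1)) (c : ℝ) :
    tail (x + c • EuclideanSpace.single 0 (1 : ℝ)) = tail x := by
  ext i
  simp [tail]

theorem cons_eq (t : ℝ) (x : Eucl n) :
    cons t x = inclTail n x + t • EuclideanSpace.single 0 (1 : ℝ) := by
  refine ext_tail ?_ ?_
  · change t = cons 0 x 0 + t * _
    simp
  · rw [tail_add_smul_single]; rfl

variable {m : ℝ}

/-- The shear `(k⁰, 𝐤) ↦ (k⁰ + c ω(𝐤), 𝐤)`. -/
def shear (c m : ℝ) (k : Eucl (n + 1)) : Eucl (n + 1) :=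
  k + (c * omega m (tail k)) • EuclideanSpace.single 0 1

@[simp] theorem shear_zero (c : ℝ) (k : Eucl (n + 1)) :
    shear c m k 0 = k 0 + c * omega m (tail k) := by simp [shear]

@[simp] theorem tail_shear (c : ℝ) (k : Eucl (n + 1)) : tail (shear c m k) = tail k :=
  tail_add_smul_single _ _

theorem shear_shear_neg (c : ℝ) (k : Eucl (n + 1)) : shear c m (shear (-c) m k) = k :=
  ext_tail (by simp) (by simp)

theorem temperate_smul_single {V : Type} [NormedAddCommGroup V] [NormedSpace ℝ V] {φ : V → ℝ}
    (hφ : φ.HasTemperateGrowth) :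
    (fun x => φ x • (EuclideanSpace.single 0 1 : Eucl (n + 1))).HasTemperateGrowth :=
  hφ.smul (.const _)

theorem temperate_tail : (tail : Eucl (n + 1) → Eucl n).HasTemperateGrowth :=
  (tailCLM n).hasTemperateGrowth

theorem temperate_shear (c : ℝ) (hm : 0 < m) :
    (shear c m : Eucl (n + 1) → Eucl (n + 1)).HasTemperateGrowth :=
  .add .id (temperate_smul_single
    ((Function.HasTemperateGrowth.const c).mul ((temperate_omega hm).comp temperate_tail)))

/-- The shear fixes the spatial part, so the displacement `c ω` is controlled by the image.
Composition with the shear then preserves Schwartz functions. -/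
theorem shear_growth (c : ℝ) (hm : 0 < m) : ∃ (k : ℕ) (C : ℝ), ∀ x : Eucl (n + 1),
    ‖x‖ ≤ C * (1 + ‖shear c m x‖) ^ k := by
  refine ⟨1, 1 + |c| * (m + 1), fun x => ?_⟩
  have h1 : x = shear c m x - (c * omega m (tail x)) • EuclideanSpace.single 0 1 := by
    rw [shear, add_sub_cancel_right]
  have h2 : ‖(c * omega m (tail x)) • (EuclideanSpace.single 0 1 : Eucl (n + 1))‖ =
      |c| * omega m (tail x) := by
    rw [norm_smul, PiLp.norm_single, norm_one, mul_one, Real.norm_eq_abs, abs_mul,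
      abs_of_pos (omega_pos hm _)]
  have h3 := norm_tail_le (shear c m x)
  rw [tail_shear] at h3
  have h4 : omega m (tail x) ≤ (m + 1) * (1 + ‖shear c m x‖) := by
    nlinarith [omega_le hm (tail x), norm_nonneg (shear c m x)]
  calc ‖x‖ ≤ ‖shear c m x‖ + |c| * omega m (tail x) := by
        rw [← h2]; conv_lhs => rw [h1]
        exact norm_sub_le _ _
    _ ≤ (1 + ‖shear c m x‖) + |c| * ((m + 1) * (1 + ‖shear c m x‖)) := by
        gcongr; linarith
    _ = _ := by ring

/-- Composition with the shear. -/
def shearCLM (c : ℝ) (hm : 0 < m) : 𝓢(Eucl (n + 1), ℂ) →L[ℂ] 𝓢(Eucl (n + 1), ℂ) :=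
  SchwartzMap.compCLM ℂ (temperate_shear c hm) (shear_growth c hm)

theorem shearCLM_apply (c : ℝ) (hm : 0 < m) (G : 𝓢(Eucl (n + 1), ℂ)) (k : Eucl (n + 1)) :
    shearCLM c hm G k = G (shear c m k) := rfl

/-- The restriction `G ↦ G(c ω(𝐤), 𝐤)` to a mass shell. -/
def shellRestrict (c : ℝ) (hm : 0 < m) : 𝓢(Eucl (n + 1), ℂ) →L[ℂ] 𝓢(Eucl n, ℂ) :=
  SchwartzMap.compCLM ℂ (g := fun k => cons (c * omega m k) k)
    (by
      simp only [cons_eq]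
      exact (inclTail n).hasTemperateGrowth.add (temperate_smul_single
        ((Function.HasTemperateGrowth.const c).mul (temperate_omega hm))))
    ⟨1, 1, fun k => by
      have := norm_tail_le (cons (c * omega m k) k)
      rw [tail_cons] at this
      linarith⟩

theorem shellRestrict_apply (c : ℝ) (hm : 0 < m) (G : 𝓢(Eucl (n + 1), ℂ)) (k : Eucl n) :
    shellRestrict c hm G k = G (cons (c * omega m k) k) := rfl

/-- Division by the equation of one sheet of the mass shell. -/
theorem exists_eq_sub_omega_mul (c : ℝ) (hm : 0 < m) (G : 𝓢(Eucl (n + 1), ℂ))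
    (hG : shellRestrict c hm G = 0) :
    ∃ H : 𝓢(Eucl (n + 1), ℂ), ∀ k, G k = ((k 0 - c * omega m (tail k) : ℝ) : ℂ) * H k := by
  -- The shear straightens the sheet to the hyperplane `k⁰ = 0`.
  obtain ⟨H, hH⟩ := exists_eq_zeroth_mul (shearCLM c hm G) fun x hx => by
    rw [shearCLM_apply]
    have : shear c m x = cons (c * omega m (tail x)) (tail x) := ext_tail (by simp [hx]) (by simp)
    rw [this, ← shellRestrict_apply c hm, hG]
    rfl
  refine ⟨shearCLM (-c) hm H, fun k => ?_⟩
  have := hH (shear (-c) m k)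
  rw [shearCLM_apply, shear_shear_neg, shear_zero] at this
  rw [this, shearCLM_apply]
  congr 2
  ring

/-- Division by the equation of the mass shell. -/
theorem exists_eq_massShell_mul (hm : 0 < m) (G : 𝓢(Eucl (n + 1), ℂ))
    (h1 : shellRestrict (-1) hm G = 0) (h2 : shellRestrict 1 hm G = 0) :
    ∃ H : 𝓢(Eucl (n + 1), ℂ),
      ∀ k, G k = ((k 0 ^ 2 - omega m (tail k) ^ 2 : ℝ) : ℂ) * H k := by
  obtain ⟨H, hH⟩ := exists_eq_sub_omega_mul 1 hm G h2
  -- On the sheet `k⁰ = -ω` the factor already removed equals `-2ω ≠ 0`, so the first quotient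
  -- vanishes there too.
  obtain ⟨H', hH'⟩ := exists_eq_sub_omega_mul (-1) hm H (by
    ext k
    have h := congrArg (fun f : 𝓢(Eucl n, ℂ) => f k) h1
    simp only [shellRestrict_apply] at h
    rw [hH] at h
    refine (mul_eq_zero.1 h).resolve_left ?_
    have := omega_pos hm k
    rw [Complex.ofReal_eq_zero, cons_zero, tail_cons]
    linarith)
  refine ⟨H', fun k => ?_⟩
  rw [hH, hH']
  push_cast
  ring

/-- The function `f(x⁰) g(𝐱)`, as a continuous linear function of `g`. -/
def tensor (f : 𝓢(ℝ, ℂ)) : 𝓢(Eucl n, ℂ) →L[ℂ] 𝓢(Eucl (n + 1), ℂ) :=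
  SchwartzMap.mkCLM (fun g x => f (x 0) * g (tail x)) (fun g g' x => mul_add _ _ _)
    (fun c g x => mul_left_comm _ _ _)
    (fun g => ((f.smooth ⊤).comp (plusForm n).contDiff).mul
      ((g.smooth ⊤).comp (tailCLM n).contDiff)) <| by
  rintro ⟨N, j⟩
  set S := (2 : ℝ) ^ N * ((Finset.Iic (N, j)).sup fun m => SchwartzMap.seminorm ℂ m.1 m.2) f with hS
  have hS0 : 0 ≤ S := by positivity
  refine ⟨Finset.Iic (N, j), 2 ^ j * S * 2 ^ N, by positivity, fun g x => ?_⟩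
  set R := (2 : ℝ) ^ N * ((Finset.Iic (N, j)).sup (schwartzSeminormFamily ℂ (Eucl n) ℂ)) g with hR
  have hR0 : 0 ≤ R := by positivity
  have hf : ∀ i ≤ j, (1 + |x 0|) ^ N * ‖iteratedFDeriv ℝ i (f ∘ plusForm n) x‖ ≤ S := by
    intro i hi
    refine le_trans ?_ (SchwartzMap.one_add_le_sup_seminorm_apply (𝕜 := ℂ) (m := (N, j))
      le_rfl hi f (x 0))
    rw [ContinuousLinearMap.iteratedFDeriv_comp_right (plusForm n) (f.smooth ⊤) x
      (by exact_mod_cast le_top)]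
    refine mul_le_mul_of_nonneg_left ?_ (by positivity)
    refine (ContinuousMultilinearMap.norm_compContinuousLinearMap_le _ _).trans ?_
    exact mul_le_of_le_one_right (norm_nonneg _)
      (Finset.prod_le_one (fun _ _ => norm_nonneg _) fun _ _ => norm_plusForm_le)
  have hg : ∀ i ≤ j, (1 + ‖tail x‖) ^ N * ‖iteratedFDeriv ℝ i (g ∘ tailCLM n) x‖ ≤ R := by
    intro i hi
    refine le_trans ?_ (SchwartzMap.one_add_le_sup_seminorm_apply (𝕜 := ℂ) (m := (N, j))
      le_rfl hi g (tail x))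
    rw [ContinuousLinearMap.iteratedFDeriv_comp_right (tailCLM n) (g.smooth ⊤) x
      (by exact_mod_cast le_top)]
    refine mul_le_mul_of_nonneg_left ?_ (by positivity)
    refine (ContinuousMultilinearMap.norm_compContinuousLinearMap_le _ _).trans ?_
    exact mul_le_of_le_one_right (norm_nonneg _)
      (Finset.prod_le_one (fun _ _ => norm_nonneg _) fun _ _ => norm_tailCLM_le)
  -- A product of weights, so that each tensor factor absorbs its own.
  have hx : ‖x‖ ≤ (1 + |x 0|) * (1 + ‖tail x‖) := by
    nlinarith [norm_le_plus_tail x, mul_nonneg (abs_nonneg (x 0)) (norm_nonneg (tail x))]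
  have hmul := norm_iteratedFDeriv_mul_le (n := j) ((f.smooth ⊤).comp (plusForm n).contDiff)
    ((g.smooth ⊤).comp (tailCLM n).contDiff) x (by exact_mod_cast le_top)
  have e : (2 : ℝ) ^ j = ∑ i ∈ Finset.range (j + 1), (j.choose i : ℝ) := by
    exact_mod_cast (Nat.sum_range_choose j).symm
  calc ‖x‖ ^ N * _ ≤ ((1 + |x 0|) * (1 + ‖tail x‖)) ^ N * ∑ i ∈ Finset.range (j + 1),
        (j.choose i : ℝ) * ‖iteratedFDeriv ℝ i (f ∘ plusForm n) x‖ *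
          ‖iteratedFDeriv ℝ (j - i) (g ∘ tailCLM n) x‖ := by
        gcongr
        exact hmul
    _ = ∑ i ∈ Finset.range (j + 1), (j.choose i : ℝ) *
        ((1 + |x 0|) ^ N * ‖iteratedFDeriv ℝ i (f ∘ plusForm n) x‖) *
          ((1 + ‖tail x‖) ^ N * ‖iteratedFDeriv ℝ (j - i) (g ∘ tailCLM n) x‖) := by
        rw [Finset.mul_sum]
        refine Finset.sum_congr rfl fun i _ => ?_
        rw [mul_pow]
        ring
    _ ≤ ∑ i ∈ Finset.range (j + 1), (j.choose i : ℝ) * S * R := by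
        gcongr with i hi
        · exact hf i (by have := Finset.mem_range.1 hi; omega)
        · exact hg _ (by omega)
    _ = _ := by
        rw [← Finset.sum_mul, ← Finset.sum_mul, ← e, hR]
        ring

theorem tensor_apply (f : 𝓢(ℝ, ℂ)) (g : 𝓢(Eucl n, ℂ)) (x : Eucl (n + 1)) :
    tensor f g x = f (x 0) * g (tail x) := rfl

theorem exists_schwartz_bump {r : ℝ} (hr : 0 < r) :
    ∃ χ : 𝓢(ℝ, ℂ), χ 0 = 1 ∧ ∀ x, r ≤ |x| → χ x = 0 := by
  let b : ContDiffBump (0 : ℝ) := ⟨r / 2, r, by positivity, by linarith⟩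
  have h1 : HasCompactSupport fun x => (b x : ℂ) :=
    b.hasCompactSupport.comp_left (g := Complex.ofReal) Complex.ofReal_zero
  have h2 : ContDiff ℝ ∞ fun x => (b x : ℂ) := Complex.ofRealCLM.contDiff.comp b.contDiff
  refine ⟨h1.toSchwartzMap h2, ?_, fun x hx => ?_⟩
  · change ((b 0 : ℝ) : ℂ) = 1
    rw [b.one_of_mem_closedBall (Metric.mem_closedBall_self b.rIn_pos.le), Complex.ofReal_one]
  · change ((b x : ℝ) : ℂ) = 0
    rw [b.zero_of_le_dist (by simpa [Real.dist_eq] using hx), Complex.ofReal_zero]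

/-- A tempered distribution annihilated by the equation of the mass shell is a sum of two tempered
densities on the sheets of the mass shell. -/
theorem exists_shell_densities (hm : 0 < m) (T : 𝓢'(Eucl (n + 1), ℂ))
    (hT : ∀ G H : 𝓢(Eucl (n + 1), ℂ),
      (∀ k, G k = ((k 0 ^ 2 - omega m (tail k) ^ 2 : ℝ) : ℂ) * H k) → T G = 0) :
    ∃ a : ℤˣ → 𝓢'(Eucl n, ℂ), ∀ G, T G = a 1 (shellRestrict (-1) hm G) +
      a (-1) (shellRestrict 1 hm G) := by
  obtain ⟨χ, hχ0, hχ⟩ := exists_schwartz_bump hm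
  -- An extension operator from one sheet, cut off at vertical distance `m`. The sheets are `2ω ≥
  -- 2m` apart, so it does not reach the other one. Subtracting both extensions leaves a function
  -- divisible by the equation of the shell.
  let ext (c : ℝ) : 𝓢(Eucl n, ℂ) →L[ℂ] 𝓢(Eucl (n + 1), ℂ) := shearCLM (-c) hm ∘L tensor χ
  have hext : ∀ (c c' : ℝ) (h : 𝓢(Eucl n, ℂ)) (k : Eucl n),
      shellRestrict c' hm (ext c h) k = χ ((c' - c) * omega m k) * h k := by
    intro c c' h k
    change χ (shear (-c) m (cons (c' * omega m k) k) 0) *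
      h (tail (shear (-c) m (cons (c' * omega m k) k))) = _
    rw [shear_zero, tail_shear, tail_cons, cons_zero]
    congr 2
    ring
  have hsame : ∀ c h, shellRestrict c hm (ext c h) = h := by
    intro c h
    ext k
    rw [hext, sub_self, zero_mul, hχ0, one_mul]
  have hdiff : ∀ c c' h, |c' - c| = 2 → shellRestrict c' hm (ext c h) = 0 := by
    intro c c' h hc
    ext k
    have h1 : m ≤ omega m k := Real.le_sqrt_of_sq_le (by nlinarith [sq_nonneg ‖k‖])
    rw [hext, hχ, zero_mul]
    · rfl
    · rw [abs_mul, hc, abs_of_pos (omega_pos hm k)]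
      linarith
  -- The sheet of `a ε` is `k⁰ = -ε ω`: then `a 1` evolves with `exp(-i t ω)` and belongs to
  -- `μ_{>0}`.
  refine ⟨fun ε => PointwiseConvergenceCLM.precomp ℂ (ext (-((ε : ℤ) : ℝ))) T, fun G => ?_⟩
  change T G = T (ext (-(((1 : ℤˣ) : ℤ) : ℝ)) _) + T (ext (-(((-1 : ℤˣ) : ℤ) : ℝ)) _)
  simp only [Units.val_one, Int.cast_one, Units.val_neg, Int.cast_neg, neg_neg]
  rw [← map_add, ← sub_eq_zero, ← map_sub]
  obtain ⟨H, hH⟩ := exists_eq_massShell_mul hm (G - (ext (-1) (shellRestrict (-1) hm G) +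
    ext 1 (shellRestrict 1 hm G)))
    (by rw [map_sub, map_add, hsame, hdiff _ _ _ (by norm_num), add_zero, sub_self])
    (by rw [map_sub, map_add, hsame, hdiff _ _ _ (by norm_num), zero_add, sub_self])
  exact hT _ H hH

end Shell

/-! ### Fourier transforms of derivatives, tensor products and compositions with isometries. -/

section FourierRules
variable {n : ℕ}

/-- Multiplication of Schwartz functions by the `i`-th coordinate. -/
def coordMul (i : Fin n) : 𝓢(Eucl n, ℂ) →L[ℂ] 𝓢(Eucl n, ℂ) :=
  SchwartzMap.smulLeftCLM ℂ fun x : Eucl n => ((x i : ℝ) : ℂ)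

theorem temperate_coord (i : Fin n) : (fun x : Eucl n => x i).HasTemperateGrowth :=
  (EuclideanSpace.proj (𝕜 := ℝ) i).hasTemperateGrowth

theorem coordMul_apply (i : Fin n) (g : 𝓢(Eucl n, ℂ)) (x : Eucl n) :
    coordMul i g x = ((x i : ℝ) : ℂ) * g x :=
  SchwartzMap.smulLeftCLM_apply_apply (temperate_ofReal (temperate_coord i)) g x

theorem lineDeriv_schwartzFourier (G : 𝓢(Eucl n, ℂ)) (i : Fin n) :
    ∂_{EuclideanSpace.single i (1 : ℝ)} (schwartzFourier n G) =
      schwartzFourier n ((-Complex.I) • coordMul i G) := by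
  change ∂_{EuclideanSpace.single i (1 : ℝ)}
    (SchwartzMap.compCLMOfContinuousLinearEquiv ℂ (dilation n) (𝓕 G)) =
      SchwartzMap.compCLMOfContinuousLinearEquiv ℂ (dilation n) (𝓕 ((-Complex.I) • coordMul i G))
  rw [SchwartzMap.lineDerivOp_compCLMOfContinuousLinearEquiv, SchwartzMap.lineDerivOp_fourier_eq]
  congr 2
  ext p
  have ht : (fun x : Eucl n => (inner ℝ x (dilation n (EuclideanSpace.single i 1)) : ℝ)).HasTemperateGrowth := by
    fun_prop
  have hpi : (Real.pi : ℂ) ≠ 0 := by exact_mod_cast Real.pi_ne_zero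
  change (-(2 * Real.pi * Complex.I)) * _ = (-Complex.I) * coordMul i G p
  rw [SchwartzMap.smulLeftCLM_apply_apply ht, coordMul_apply, dilation_apply, inner_smul_right,
    EuclideanSpace.inner_single_right]
  change (-(2 * Real.pi * Complex.I)) * (((_ : ℝ) : ℂ) * G p) = _
  simp
  field_simp

theorem pd_apply (i : Fin n) (u : 𝓢'(Eucl n, ℂ)) (g : 𝓢(Eucl n, ℂ)) :
    pd i u g = -u (∂_{EuclideanSpace.single i (1 : ℝ)} g) := by
  rw [pd, TemperedDistribution.lineDerivOp_apply_apply, map_neg]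

theorem distFourier_apply (u : 𝓢'(Eucl n, ℂ)) (g : 𝓢(Eucl n, ℂ)) :
    distFourier n u g = u (schwartzFourier n g) := rfl

theorem distFourier_pd (i : Fin n) (u : 𝓢'(Eucl n, ℂ)) (g : 𝓢(Eucl n, ℂ)) :
    distFourier n (pd i u) g = Complex.I * distFourier n u (coordMul i g) := by
  rw [distFourier_apply, pd_apply, lineDeriv_schwartzFourier, map_smul, map_smul, distFourier_apply,
    smul_eq_mul]
  ring

theorem norm_sq_tail_eq_sum (k : Eucl (n + 1)) : ‖tail k‖ ^ 2 = ∑ i : Fin n, k i.succ ^ 2 := by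
  simp [EuclideanSpace.norm_sq_eq, tail]

/-- The Fourier transform of a solution of the Klein-Gordon equation is annihilated by the equation
of the mass shell. -/
theorem IsKleinGordonSolution.distFourier_eq_zero {m : ℝ} {u : 𝓢'(Eucl (n + 1), ℂ)}
    (hu : IsKleinGordonSolution m u) (G H : 𝓢(Eucl (n + 1), ℂ))
    (h : ∀ k, G k = ((k 0 ^ 2 - omega m (tail k) ^ 2 : ℝ) : ℂ) * H k) :
    distFourier (n + 1) u G = 0 := by
  have hG : G = coordMul 0 (coordMul 0 H) - ∑ i : Fin n, coordMul i.succ (coordMul i.succ H) -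
      ((m ^ 2 : ℝ) : ℂ) • H := by
    ext k
    simp only [sub_apply, sum_apply, smul_apply,
      coordMul_apply, h, omega_sq, norm_sq_tail_eq_sum, smul_eq_mul]
    push_cast
    simp only [← mul_assoc, ← Finset.sum_mul]
    ring_nf
  -- Each second derivative contributes `i² = -1`, so the transformed equation is the negative of
  -- the claim.
  have h2 := DFunLike.congr_fun (congrArg (distFourier (n + 1)) hu) H
  have h3 : ∀ i, distFourier (n + 1) (pd i (pd i u)) H =
      -distFourier (n + 1) u (coordMul i (coordMul i H)) := fun i => by
    rw [distFourier_pd, distFourier_pd, ← mul_assoc, Complex.I_mul_I, neg_one_mul]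
  rw [map_add, map_sub, map_sum, map_smul, map_zero] at h2
  change _ = (0 : ℂ) at h2
  simp only [add_apply, sub_apply,
    sum_apply, smul_apply, h3, smul_eq_mul] at h2
  rw [hG, map_sub, map_sub, map_sum, map_smul, smul_eq_mul]
  rw [Finset.sum_neg_distrib] at h2
  linear_combination -h2

/-- The inverse of the Fourier transform on Schwartz functions. -/
def schwartzFourierInv (n : ℕ) : 𝓢(Eucl n, ℂ) →L[ℂ] 𝓢(Eucl n, ℂ) :=
  (FourierTransform.fourierInvCLM ℂ 𝓢(Eucl n, ℂ)) ∘L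
    (SchwartzMap.compCLMOfContinuousLinearEquiv ℂ (dilation n).symm)

theorem schwartzFourier_inv (g : 𝓢(Eucl n, ℂ)) :
    schwartzFourier n (schwartzFourierInv n g) = g := by
  change SchwartzMap.compCLMOfContinuousLinearEquiv ℂ (dilation n)
    (𝓕 (𝓕⁻ (SchwartzMap.compCLMOfContinuousLinearEquiv ℂ (dilation n).symm g))) = g
  rw [FourierTransform.fourier_fourierInv_eq]
  ext x
  exact congrArg g ((dilation n).symm_apply_apply x)

theorem schwartzFourierInv_fourier (g : 𝓢(Eucl n, ℂ)) :
    schwartzFourierInv n (schwartzFourier n g) = g := by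
  change 𝓕⁻ (SchwartzMap.compCLMOfContinuousLinearEquiv ℂ (dilation n).symm
    (SchwartzMap.compCLMOfContinuousLinearEquiv ℂ (dilation n) (𝓕 g))) = g
  have : SchwartzMap.compCLMOfContinuousLinearEquiv ℂ (dilation n).symm
      (SchwartzMap.compCLMOfContinuousLinearEquiv ℂ (dilation n) (𝓕 g)) = 𝓕 g := by
    ext x
    exact congrArg (⇑(𝓕 g : 𝓢(Eucl n, ℂ))) ((dilation n).apply_symm_apply x)
  rw [this, FourierTransform.fourierInv_fourier_eq]

theorem integral_eucl_succ (f : ℝ → ℂ) (g : Eucl n → ℂ) :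
    ∫ x : Eucl (n + 1), f (x 0) * g (tail x) = (∫ t, f t) * ∫ y, g y := by
  rw [← (PiLp.volume_preserving_toLp (Fin n)).integral_comp
      (MeasurableEquiv.toLp 2 (Fin n → ℝ)).measurableEmbedding,
    ← (PiLp.volume_preserving_toLp (Fin (n + 1))).integral_comp
      (MeasurableEquiv.toLp 2 (Fin (n + 1) → ℝ)).measurableEmbedding, ← integral_prod_mul,
    ← Measure.volume_eq_prod,
    ← (volume_preserving_piFinSuccAbove (fun _ : Fin (n + 1) => ℝ) 0).integral_comp'
      (fun z : ℝ × (Fin n → ℝ) => f z.1 * g (WithLp.toLp 2 z.2))]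
  rfl

theorem inner_eq_tail (x y : Eucl (n + 1)) :
    (inner ℝ x y : ℝ) = x 0 * y 0 + inner ℝ (tail x) (tail y) := by
  simp only [PiLp.inner_apply, Fin.sum_univ_succ]
  simp [tail, mul_comm]

theorem schwartzFourier_tensor (f : 𝓢(ℝ, ℂ)) (h : 𝓢(Eucl n, ℂ)) (x : Eucl (n + 1)) :
    schwartzFourier (n + 1) (tensor f h) x =
      𝓕 f ((2 * Real.pi)⁻¹ * x 0) * schwartzFourier n h (tail x) := by
  have hpi : (Real.pi : ℂ) ≠ 0 := by exact_mod_cast Real.pi_ne_zero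
  rw [schwartzFourier_apply, schwartzFourier_apply, SchwartzMap.fourier_coe,
    fourier_eq_integral_phase, ← integral_eucl_succ]
  congr 1
  ext y
  have e : Complex.exp (-Complex.I * ((inner ℝ y x : ℝ) : ℂ)) = phase (y 0) ((2 * Real.pi)⁻¹ * x 0) *
      Complex.exp (-Complex.I * ((inner ℝ (tail y) (tail x) : ℝ) : ℂ)) := by
    rw [phase, ← Complex.exp_add, inner_eq_tail]
    congr 1
    push_cast
    field_simp
    ring
  rw [tensor_apply, e]
  ring

/-- Applied to `kappa` and to `rotateIsometry`: no determinant or inverse transpose appears because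
both are orthogonal. -/
theorem schwartzFourier_comp_isometry (A : Eucl n ≃ₗᵢ[ℝ] Eucl n) (h : 𝓢(Eucl n, ℂ)) (x : Eucl n) :
    schwartzFourier n (SchwartzMap.compCLMOfContinuousLinearEquiv ℂ A.toContinuousLinearEquiv h) x =
      schwartzFourier n h (A x) := by
  change 𝓕 (h ∘ A) (dilation n x) = 𝓕 h (dilation n (A x))
  rw [dilation_apply, dilation_apply, ← map_smul, SchwartzMap.fourier_coe]
  exact Real.fourier_comp_linearIsometry A h _

end FourierRules

/-! ### Existence of the initial data at `x⁰ = 0`. -/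

section Restriction
variable {n : ℕ} {m : ℝ}

/-- `f₁` is the inverse transform of `f` for the kernel `exp(-i x p)`. Up to reflection and the
factor `(2π)⁻¹` it is again a transform of `f`, the form produced by `pairing_integral`. -/
theorem exists_rescaled_fourierInv (f : 𝓢(ℝ, ℂ)) : ∃ f₁ : 𝓢(ℝ, ℂ),
    (∀ x, 𝓕 f₁ ((2 * Real.pi)⁻¹ * x) = f x) ∧
    ∀ y, f₁ (-y) = ((2 * Real.pi)⁻¹ : ℂ) * 𝓕 f ((2 * Real.pi)⁻¹ * y) := by
  have hpi : (2 * Real.pi) ≠ 0 := by positivity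
  have hpi' : (Real.pi : ℂ) ≠ 0 := by exact_mod_cast Real.pi_ne_zero
  let D : ℝ ≃L[ℝ] ℝ := ContinuousLinearEquiv.smulLeft (Units.mk0 (2 * Real.pi) hpi)
  let f' : 𝓢(ℝ, ℂ) := SchwartzMap.compCLMOfContinuousLinearEquiv ℂ D f
  have hf' : ∀ s, f' s = f (2 * Real.pi * s) := fun s => rfl
  refine ⟨𝓕⁻ f', fun x => ?_, fun y => ?_⟩
  · rw [FourierTransform.fourier_fourierInv_eq, hf', mul_inv_cancel_left₀ hpi]
  · have h1 : (𝓕⁻ f' : 𝓢(ℝ, ℂ)) (-y) = 𝓕 (f' : ℝ → ℂ) y := by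
      rw [SchwartzMap.fourierInv_coe, Real.fourierInv_eq_fourier_neg, neg_neg]
    rw [h1, SchwartzMap.fourier_coe, fourier_eq_integral_phase, fourier_eq_integral_phase]
    have h2 := Measure.integral_comp_mul_left
      (fun t : ℝ => phase t ((2 * Real.pi)⁻¹ * y) * f t) (2 * Real.pi)
    rw [abs_of_pos (by positivity)] at h2
    have h3 : (fun t => phase t y * f' t) =
        fun t => phase (2 * Real.pi * t) ((2 * Real.pi)⁻¹ * y) * f (2 * Real.pi * t) := by
      ext t
      rw [hf', phase, phase]
      congr 4
      field_simp
    rw [h3, h2, Complex.real_smul]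
    push_cast
    rfl

/-- The distribution `u` is the inverse Fourier transform of a sum of densities `a ε` on the sheets
`k⁰ = -ε ω(𝐤)` of the mass shell. -/
def IsShellTransform (hm : 0 < m) (u : 𝓢'(Eucl (n + 1), ℂ)) (a : ℤˣ → 𝓢'(Eucl n, ℂ)) : Prop :=
  ∀ G, distFourier (n + 1) u G = ∑ ε : ℤˣ, a ε (shellRestrict (-((ε : ℤ) : ℝ)) hm G)

theorem sum_units {E : Type} [AddCommMonoid E] (f : ℤˣ → E) : ∑ ε : ℤˣ, f ε = f 1 + f (-1) := by
  rw [show (Finset.univ : Finset ℤˣ) = {1, -1} from rfl, Finset.sum_pair (by decide)]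

theorem IsKleinGordonSolution.exists_isShellTransform (hm : 0 < m) {u : 𝓢'(Eucl (n + 1), ℂ)}
    (hu : IsKleinGordonSolution m u) : ∃ a, IsShellTransform hm u a := by
  obtain ⟨a, ha⟩ := exists_shell_densities hm (distFourier (n + 1) u) hu.distFourier_eq_zero
  refine ⟨a, fun G => ?_⟩
  rw [ha, sum_units]
  simp

theorem omegaSmul_apply (a : 𝓢'(Eucl n, ℂ)) (g : 𝓢(Eucl n, ℂ)) :
    omegaSmul m a g = a (SchwartzMap.smulLeftCLM ℂ (fun p => ((omega m p : ℝ) : ℂ)) g) := rfl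

/-- Under the transform `∂₀` becomes `i k⁰`, and `k⁰ = -ε ω` on the sheet of `a ε`. Existence of
`u₁` thus reduces to that of `u₀`. -/
theorem IsShellTransform.pd_zero {hm : 0 < m} {u : 𝓢'(Eucl (n + 1), ℂ)} {a : ℤˣ → 𝓢'(Eucl n, ℂ)}
    (h : IsShellTransform hm u a) :
    IsShellTransform hm (pd 0 u) fun ε => (-(Complex.I * ((ε : ℤ) : ℂ))) • omegaSmul m (a ε) := by
  intro G
  rw [distFourier_pd, h, Finset.mul_sum]
  refine Finset.sum_congr rfl fun ε _ => ?_
  rw [smul_apply, omegaSmul_apply, smul_eq_mul, neg_mul, mul_assoc, ← mul_neg]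
  congr 1
  rw [← neg_mul, ← smul_eq_mul, ← map_smul]
  congr 1
  ext k
  rw [shellRestrict_apply, coordMul_apply, smul_apply,
    SchwartzMap.smulLeftCLM_apply_apply (temperate_ofReal (temperate_omega hm)), cons_zero,
    shellRestrict_apply]
  push_cast
  simp only [smul_eq_mul]
  ring

/-- The functional `h ↦ (2π)⁻¹ ∑ ε, (a ε, e^{-2πi t φ ε} h ε)` with `h ε = L ε g`. -/
def phasePairing {X : Type} [AddCommGroup X] [Module ℂ X] [TopologicalSpace X]
    (a : ℤˣ → 𝓢'(Eucl n, ℂ)) (φ : ℤˣ → Eucl n → ℝ) (L : ℤˣ → X →L[ℂ] 𝓢(Eucl n, ℂ)) (t : ℝ) :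
    X →Lₚₜ[ℂ] ℂ :=
  ((2 * Real.pi)⁻¹ : ℂ) • ∑ ε : ℤˣ, PointwiseConvergenceCLM.precomp ℂ
    (SchwartzMap.smulLeftCLM ℂ (fun x => phase t (φ ε x)) ∘L L ε) (a ε)

section
variable {X : Type} [AddCommGroup X] [Module ℂ X] [TopologicalSpace X]
  (a : ℤˣ → 𝓢'(Eucl n, ℂ)) {φ : ℤˣ → Eucl n → ℝ} (L : ℤˣ → X →L[ℂ] 𝓢(Eucl n, ℂ))

theorem phasePairing_apply (t : ℝ) (g : X) : phasePairing a φ L t g = ((2 * Real.pi)⁻¹ : ℂ) *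
    ∑ ε : ℤˣ, a ε (SchwartzMap.smulLeftCLM ℂ (fun x => phase t (φ ε x)) (L ε g)) := by
  rw [phasePairing, smul_apply, sum_apply, smul_eq_mul]
  rfl

theorem phasePairing_zero (g : X) : phasePairing a φ L 0 g = ((2 * Real.pi)⁻¹ : ℂ) *
    ∑ ε : ℤˣ, a ε (L ε g) := by
  rw [phasePairing_apply]
  congr 1
  refine Finset.sum_congr rfl fun ε _ => ?_
  congr 1
  ext x
  have : (fun x => phase 0 (φ ε x)) = fun _ => 1 := by ext; exact phase_zero _
  rw [this, SchwartzMap.smulLeftCLM_apply_apply (.const _), one_smul]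

theorem contDiff_phasePairing (hφ : ∀ ε, (φ ε).HasTemperateGrowth) (g : X) :
    ContDiff ℝ ∞ fun t => phasePairing a φ L t g := by
  simp only [phasePairing_apply]
  exact contDiff_const.mul (ContDiff.sum fun ε _ => contDiff_pairing (a ε) (hφ ε) (L ε g))

theorem integral_phasePairing (hφ : ∀ ε, (φ ε).HasTemperateGrowth) (g : X) (f : 𝓢(ℝ, ℂ)) :
    Integrable (fun t => phasePairing a φ L t g * f t) ∧
    ∫ t, phasePairing a φ L t g * f t = ((2 * Real.pi)⁻¹ : ℂ) *
      ∑ ε : ℤˣ, a ε (SchwartzMap.smulLeftCLM ℂ (fun x => 𝓕 f (φ ε x)) (L ε g)) := by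
  have h := fun ε => (pairing_integral (a ε) (hφ ε) (L ε g)).2 f (moments_schwartz f)
  simp only [phasePairing_apply, mul_assoc, Finset.sum_mul]
  refine ⟨(integrable_finsetSum _ fun ε _ => (h ε).1).const_mul _, ?_⟩
  rw [integral_const_mul, integral_finsetSum _ fun ε _ => (h ε).1]
  congr 1
  exact Finset.sum_congr rfl fun ε _ => (h ε).2

end

/-- The family in time is `c ∑ ε, exp(-i ε t ω) a ε`, transformed back in space. Only the time
variable is inverted on the side of the densities, hence a single factor `c = (2π)⁻¹` in every
dimension. -/
theorem IsShellTransform.exists_restriction {hm : 0 < m} {u : 𝓢'(Eucl (n + 1), ℂ)}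
    {a : ℤˣ → 𝓢'(Eucl n, ℂ)} (h : IsShellTransform hm u a) :
    ∃ u₀, HasRestriction u u₀ ∧
      distFourier n u₀ = ((2 * Real.pi)⁻¹ : ℂ) • ∑ ε : ℤˣ, a ε := by
  let φ : ℤˣ → Eucl n → ℝ := fun ε k => (2 * Real.pi)⁻¹ * (((ε : ℤ) : ℝ) * omega m k)
  have hφ : ∀ ε, (φ ε).HasTemperateGrowth := fun ε =>
    (Function.HasTemperateGrowth.const _).mul
      ((Function.HasTemperateGrowth.const _).mul (temperate_omega hm))
  let L : ℤˣ → 𝓢(Eucl n, ℂ) →L[ℂ] 𝓢(Eucl n, ℂ) := fun _ => schwartzFourierInv n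
  refine ⟨_, ⟨phasePairing a φ L, contDiff_phasePairing a L hφ, fun f g F hF => ?_, rfl⟩, ?_⟩
  · obtain ⟨h1, h2⟩ := integral_phasePairing a L hφ g f
    refine ⟨h1, ?_⟩
    obtain ⟨f₁, hf1, hf2⟩ := exists_rescaled_fourierInv f
    -- Writing the test function as a transform turns `u F` into the densities paired with `f₁(-ε
    -- ω)` times the inverse transform of `g`.
    have e : F = schwartzFourier (n + 1) (tensor f₁ (schwartzFourierInv n g)) := by
      ext x
      rw [schwartzFourier_tensor, hf1, schwartzFourier_inv, hF]
    rw [h2, e, ← distFourier_apply, h, Finset.mul_sum]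
    refine Finset.sum_congr rfl fun ε _ => ?_
    rw [← smul_eq_mul, ← map_smul]
    congr 1
    ext k
    have ht : (fun x => 𝓕 f (φ ε x)).HasTemperateGrowth := by
      exact (temperate_fourier_of_moments (moments_schwartz f)).comp (hφ ε)
    rw [smul_apply, SchwartzMap.smulLeftCLM_apply_apply ht, shellRestrict_apply, tensor_apply,
      cons_zero, tail_cons, neg_mul, hf2, smul_eq_mul, smul_eq_mul, mul_assoc]
  · ext g
    rw [distFourier_apply, phasePairing_zero, smul_apply, sum_apply, smul_eq_mul]
    simp only [L, schwartzFourierInv_fourier]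

end Restriction

/-! ### Flat functions, tame functions and the inverse of the light-cone Fourier transform. -/

section Flat
variable {d : ℕ}

variable (d) in
/-- The Schwartz functions all of whose derivatives vanish on `{p⁺ = 0}`. -/
def flatSchwartz : Submodule ℂ 𝓢(Eucl (d + 1), ℂ) where
  carrier := {h | ∀ (j : ℕ) (p : Eucl (d + 1)), p 0 = 0 → iteratedFDeriv ℝ j h p = 0}
  zero_mem' := fun j p _ => by
    simp [show ⇑(0 : 𝓢(Eucl (d + 1), ℂ)) = fun _ => 0 from rfl]
  add_mem' := by
    intro f g hf hg j p hp
    change iteratedFDeriv ℝ j (⇑f + ⇑g) p = 0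
    rw [iteratedFDeriv_add_apply (f.smooth j).contDiffAt (g.smooth j).contDiffAt, hf j p hp,
      hg j p hp, add_zero]
  smul_mem' := by
    intro c f hf j p hp
    change iteratedFDeriv ℝ j (c • ⇑f) p = 0
    rw [iteratedFDeriv_const_smul_apply (f.smooth j).contDiffAt, hf j p hp, smul_zero]

/-- Taylor's theorem off the hyperplane, iterated: every application of the mean value inequality
trades one more derivative for one more power of `|p⁺|`. -/
theorem flat_bound (h : 𝓢(Eucl (d + 1), ℂ)) (hh : h ∈ flatSchwartz d) (b l : ℕ) :
    ∀ (j : ℕ) (p : Eucl (d + 1)), ‖tail p‖ ^ b * ‖iteratedFDeriv ℝ j h p‖ ≤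
      |p 0| ^ l * SchwartzMap.seminorm ℂ b (j + l) h := by
  induction l with
  | zero =>
    intro j p
    rw [pow_zero, one_mul, add_zero]
    refine le_trans ?_ (SchwartzMap.le_seminorm ℂ b j h p)
    gcongr
    exact norm_tail_le p
  | succ l ih =>
    intro j p
    set S := SchwartzMap.seminorm ℂ b (j + 1 + l) h with hS
    have hS0 : 0 ≤ S := apply_nonneg _ _
    -- A segment in the direction of `p⁺` through `p` and its foot on the hyperplane; the weight in
    -- `p_⊥` is constant on it.
    let s : Set (Eucl (d + 1)) := (tailCLM d) ⁻¹' {tail p} ∩ (plusForm d) ⁻¹' Metric.closedBall 0 |p 0|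
    have hs : Convex ℝ s :=
      ((convex_singleton (tail p)).linear_preimage (tailCLM d).toLinearMap).inter
        ((convex_closedBall (0 : ℝ) |p 0|).linear_preimage (plusForm d).toLinearMap)
    have hmem : ∀ q, q ∈ s ↔ tail q = tail p ∧ |q 0| ≤ |p 0| := fun q => by
      simp [s, plusForm, tailCLM_apply]
    have hd : Differentiable ℝ (iteratedFDeriv ℝ j h) :=
      (h.smooth (j + 1)).differentiable_iteratedFDeriv (by exact_mod_cast Nat.lt_succ_self j)
    have hp' : cons 0 (tail p) ∈ s := (hmem _).2 ⟨rfl, by simp⟩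
    have hp : p ∈ s := (hmem _).2 ⟨rfl, le_rfl⟩
    have key := hs.norm_image_sub_le_of_norm_fderiv_le
      (f := fun q => ‖tail p‖ ^ b • iteratedFDeriv ℝ j h q) (C := |p 0| ^ l * S)
      (fun q _ => (hd q).fun_const_smul _) (fun q hq => by
        obtain ⟨h1, h2⟩ := (hmem q).1 hq
        rw [fderiv_fun_const_smul (hd q), norm_smul, norm_pow, norm_norm, norm_fderiv_iteratedFDeriv,
          ← h1]
        refine (ih (j + 1) q).trans ?_
        gcongr) hp' hp
    have e : p - cons 0 (tail p) = p 0 • EuclideanSpace.single 0 (1 : ℝ) := by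
      refine ext_tail (by simp) ?_
      ext i
      simp [tail, cons]
    rw [hh j (cons 0 (tail p)) rfl, smul_zero, sub_zero, norm_smul, norm_pow, norm_norm, e,
      norm_smul, PiLp.norm_single, norm_one, mul_one, Real.norm_eq_abs] at key
    refine key.trans_eq ?_
    rw [hS, show j + 1 + l = j + (l + 1) by ring]
    ring

/-- Non-negative powers of `|p⁺|` are covered by ordinary Schwartz decay, negative ones by flatness.
A single Schwartz seminorm suffices, which gives the continuity of `flatToSqueezed`. -/
theorem flat_decay (k : ℤ) (b j : ℕ) : ∃ i : ℕ × ℕ, ∀ h ∈ flatSchwartz d,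
    ∀ p : Eucl (d + 1), p 0 ≠ 0 → |p 0| ^ k * ‖tail p‖ ^ b * ‖iteratedFDeriv ℝ j h p‖ ≤
      schwartzSeminormFamily ℂ (Eucl (d + 1)) ℂ i h := by
  rcases Int.natAbs_eq k with hk | hk
  · refine ⟨(k.natAbs + b, j), fun h _ p _ => ?_⟩
    refine le_trans ?_ (SchwartzMap.le_seminorm ℂ (k.natAbs + b) j h p)
    rw [hk, zpow_natCast, pow_add, Int.natAbs_natCast]
    gcongr
    · exact abs_plus_le p
    · exact norm_tail_le p
  · refine ⟨(b, j + k.natAbs), fun h hh p hp => ?_⟩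
    have h0 : 0 < |p 0| := abs_pos.2 hp
    have := flat_bound h hh b k.natAbs j p
    rw [hk, zpow_neg, zpow_natCast, Int.natAbs_neg, Int.natAbs_natCast, mul_assoc,
      inv_mul_le_iff₀ (by positivity)]
    exact this

variable (d) in
/-- Flat Schwartz functions as squeezed Schwartz functions. -/
def flatToSqueezed : flatSchwartz d →L[ℂ] SqueezedSchwartz d :=
  let T : flatSchwartz d →ₗ[ℂ] SqueezedSchwartz d :=
  { toFun := fun h => ⟨h.1, h.1.smooth ⊤, fun k b j => by
      obtain ⟨i, hi⟩ := flat_decay (d := d) k b j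
      exact ⟨_, hi h.1 h.2⟩⟩
    map_add' := fun f g => rfl
    map_smul' := fun c f => rfl }
  { T with
    cont := by
      refine WithSeminorms.continuous_of_isBounded
        ((flatSchwartz d).subtype.withSeminorms_induced (schwartz_withSeminorms ℂ _ ℂ))
        SqueezedSchwartz.withSeminorms T fun i => ?_
      obtain ⟨i', hi⟩ := flat_decay (d := d) i.1 i.2.1 i.2.2
      refine ⟨{i'}, 1, fun h => ?_⟩
      rw [one_smul, Finset.sup_singleton]
      exact SqueezedSchwartz.seminorm_le _ _ _ _ (apply_nonneg _ _) (hi h.1 h.2) }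

theorem iteratedFDeriv_plus_pow {j k : ℕ} (hjk : j < k) {p : Eucl (d + 1)} (hp : p 0 = 0) :
    iteratedFDeriv ℝ j (fun q : Eucl (d + 1) => q 0 ^ k) p = 0 := by
  have h1 : ContDiff ℝ ∞ (fun t : ℝ => t ^ k) := contDiff_id.pow k
  have h2 : iteratedFDeriv ℝ j (fun t : ℝ => t ^ k) (plusForm d p) = 0 := by
    rw [← norm_eq_zero, norm_iteratedFDeriv_eq_norm_iteratedDeriv, iteratedDeriv_eq_iterate,
      iter_deriv_pow, show plusForm d p = 0 from hp, zero_pow (by omega), mul_zero, norm_zero]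
  have := ContinuousLinearMap.iteratedFDeriv_comp_right (plusForm d) h1 p (i := j)
    (by exact_mod_cast le_top)
  rw [h2] at this
  exact this.trans rfl

theorem mem_flatSchwartz_of_divisible (h : 𝓢(Eucl (d + 1), ℂ))
    (hh : ∀ k : ℕ, ∃ H : 𝓢(Eucl (d + 1), ℂ), ∀ p, h p = (p 0 ^ k) • H p) : h ∈ flatSchwartz d := by
  intro j p hp
  -- One power more than derivatives: every term of the Leibniz rule keeps a factor that vanishes at
  -- `p⁺ = 0`.
  obtain ⟨H, hH⟩ := hh (j + 1)
  have e : (h : Eucl (d + 1) → ℂ) = fun p => (p 0 ^ (j + 1)) • H p := funext hH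
  rw [e, ← norm_le_zero_iff]
  refine (norm_iteratedFDeriv_smul_le (N := ∞) ((plusForm d).contDiff.pow (j + 1)) (H.smooth ⊤) p
    (by exact_mod_cast le_top)).trans_eq ?_
  refine Finset.sum_eq_zero fun i hi => ?_
  have := Finset.mem_range.1 hi
  have h3 := iteratedFDeriv_plus_pow (show i < j + 1 by omega) hp
  change _ * ‖iteratedFDeriv ℝ i (fun q : Eucl (d + 1) => q 0 ^ (j + 1)) p‖ * _ = 0
  rw [h3, norm_zero, mul_zero, zero_mul]

/-! ### The inverse of the partial light-cone Fourier transform -/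

variable (d) in
/-- The inverse of the transposed partial light-cone Fourier transform on Schwartz functions. -/
def lcFourierTransposeInv : 𝓢(Eucl (d + 1), ℂ) →L[ℂ] 𝓢(Eucl (d + 1), ℂ) :=
  (schwartzFourierInv (d + 1)) ∘L (SchwartzMap.compCLMOfContinuousLinearEquiv ℂ (rotate d).symm)

theorem lcFourierTranspose_inv (g : 𝓢(Eucl (d + 1), ℂ)) :
    lcFourierTransposeSchwartz d (lcFourierTransposeInv d g) = g := by
  change SchwartzMap.compCLMOfContinuousLinearEquiv ℂ (rotate d) (schwartzFourier (d + 1)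
    (schwartzFourierInv (d + 1)
      (SchwartzMap.compCLMOfContinuousLinearEquiv ℂ (rotate d).symm g))) = g
  rw [schwartzFourier_inv]
  ext x
  exact congrArg g ((rotate d).symm_apply_apply x)

theorem lcFourierTransposeInv_lcFourierTranspose (h : 𝓢(Eucl (d + 1), ℂ)) :
    lcFourierTransposeInv d (lcFourierTransposeSchwartz d h) = h := by
  change schwartzFourierInv (d + 1) (SchwartzMap.compCLMOfContinuousLinearEquiv ℂ (rotate d).symm
    (SchwartzMap.compCLMOfContinuousLinearEquiv ℂ (rotate d) (schwartzFourier (d + 1) h))) = h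
  have : SchwartzMap.compCLMOfContinuousLinearEquiv ℂ (rotate d).symm
      (SchwartzMap.compCLMOfContinuousLinearEquiv ℂ (rotate d) (schwartzFourier (d + 1) h)) =
        schwartzFourier (d + 1) h := by
    ext x
    exact congrArg (schwartzFourier (d + 1) h) ((rotate d).apply_symm_apply x)
  rw [this, schwartzFourierInv_fourier]

/-- The partial derivative `∂₋` in the last coordinate. -/
abbrev lastDeriv (n : ℕ) : 𝓢(Eucl (n + 1), ℂ) →ₗ[ℂ] 𝓢(Eucl (n + 1), ℂ) :=
  (LineDeriv.lineDerivOpCLM ℂ 𝓢(Eucl (n + 1), ℂ)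
    (EuclideanSpace.single (Fin.last n) (1 : ℝ))).toLinearMap

theorem mem_tameSchwartz {n : ℕ} {g : 𝓢(Eucl (n + 1), ℂ)} :
    g ∈ tameSchwartz n ↔ ∀ k : ℕ, ∃ G, (lastDeriv n ^ k) G = g := by
  simp [tameSchwartz, Submodule.mem_iInf]

theorem lastDeriv_lcFourierTranspose (h : 𝓢(Eucl (d + 1), ℂ)) :
    lastDeriv d (lcFourierTransposeSchwartz d h) =
      lcFourierTransposeSchwartz d (Complex.I • coordMul 0 h) := by
  change ∂_{EuclideanSpace.single (Fin.last d) (1 : ℝ)}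
    (SchwartzMap.compCLMOfContinuousLinearEquiv ℂ (rotate d) (schwartzFourier (d + 1) h)) =
    SchwartzMap.compCLMOfContinuousLinearEquiv ℂ (rotate d)
      (schwartzFourier (d + 1) (Complex.I • coordMul 0 h))
  rw [SchwartzMap.lineDerivOp_compCLMOfContinuousLinearEquiv, rotate_single,
    LineDeriv.lineDerivOp_left_neg, lineDeriv_schwartzFourier, ← map_neg, neg_smul, neg_neg]

/-- The transposed transform intertwines multiplication by `i p⁺` with `∂₋`. Being a `k`-fold
`∂₋`-derivative for every `k` therefore means divisibility by all powers of `p⁺`. -/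
theorem lcFourierTransposeInv_lastDeriv_pow (k : ℕ) (G : 𝓢(Eucl (d + 1), ℂ)) (p : Eucl (d + 1)) :
    lcFourierTransposeInv d ((lastDeriv d ^ k) G) p =
      (p 0 ^ k) • (Complex.I ^ k • lcFourierTransposeInv d G) p := by
  induction k generalizing p with
  | zero => simp
  | succ k ih =>
    set G' := (lastDeriv d ^ k) G
    have h1 : (lastDeriv d ^ (k + 1)) G = lcFourierTransposeSchwartz d
        (Complex.I • coordMul 0 (lcFourierTransposeInv d G')) := by
      rw [← lastDeriv_lcFourierTranspose, lcFourierTranspose_inv, pow_succ', Module.End.mul_apply]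
    rw [h1, lcFourierTransposeInv_lcFourierTranspose, smul_apply, coordMul_apply, ih, smul_apply,
      smul_apply]
    simp only [Complex.real_smul, smul_eq_mul]
    push_cast
    ring

theorem lcFourierTransposeInv_mem_flat (g : tameSchwartz d) :
    lcFourierTransposeInv d g ∈ flatSchwartz d := by
  refine mem_flatSchwartz_of_divisible _ fun k => ?_
  obtain ⟨G, hG⟩ := mem_tameSchwartz.1 g.2 k
  exact ⟨Complex.I ^ k • lcFourierTransposeInv d G, fun p => by
    rw [← lcFourierTransposeInv_lastDeriv_pow, hG]⟩

variable (d) in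
/-- The inverse of the transposed partial light-cone Fourier transform, from `𝓢_{∂₋}` to the squeezed
Schwartz space. -/
def tameToSqueezed : tameSchwartz d →L[ℂ] SqueezedSchwartz d :=
  flatToSqueezed d ∘L ((lcFourierTransposeInv d ∘L (tameSchwartz d).subtypeL).codRestrict
    (flatSchwartz d) lcFourierTransposeInv_mem_flat)

/-- This inversion lets `lcFourier` of the tame restriction be evaluated directly on `h`. -/
theorem tameToSqueezed_lcFourierTranspose (h : SqueezedSchwartz d) :
    tameToSqueezed d (lcFourierTranspose d h) = h :=
  SqueezedSchwartz.ext fun p => congrArg (fun f : 𝓢(Eucl (d + 1), ℂ) => f p)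
    (lcFourierTransposeInv_lcFourierTranspose h.toSchwartz)

end Flat

/-! ### Existence of the tame initial datum at `x⁺ = 0`. -/

section TameRestriction
variable {d : ℕ} {m : ℝ}

/-- The composition `h ↦ h ∘ μ_ε` with a squeezing map. -/
def muPull (ε : ℤˣ) (hm : 0 < m) : SqueezedSchwartz d →L[ℂ] 𝓢(Eucl (d + 1), ℂ) :=
  squeezedPull (moderateOn_mu ε hm)
    (.of_temperate isOpen_univ (fun _ _ => le_rfl) (.const (1 : ℂ)))
    (fun p _ => mu_zero_ne ε hm p) (mu_growth ε hm)

theorem muPull_apply (ε : ℤˣ) (hm : 0 < m) (h : SqueezedSchwartz d) (k : Eucl (d + 1)) :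
    muPull ε hm h k = h (mu ε m k) := one_mul _

variable (d) in
/-- The map `(x_⊥, x⁻) ↦ (-x⁻, x_⊥)` as a linear isometry. -/
def rotateIsometry : Eucl (d + 1) ≃ₗᵢ[ℝ] Eucl (d + 1) where
  toLinearEquiv := rotateLin d
  norm_map' x := by
    change ‖rotate d x‖ = ‖x‖
    rw [← sq_eq_sq₀ (norm_nonneg _) (norm_nonneg _), EuclideanSpace.norm_sq_eq,
      EuclideanSpace.norm_sq_eq, Fin.sum_univ_succ, Fin.sum_univ_castSucc]
    simp only [rotate_zero, rotate_succ, norm_neg]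
    ring

theorem units_neg_cast (ε : ℤˣ) : (((-ε : ℤˣ) : ℤ) : ℝ) = -((ε : ℤ) : ℝ) := by simp

theorem kappa_shell_zero (ε : ℤˣ) (k : Eucl (d + 1)) :
    kappa d (cons (-((ε : ℤ) : ℝ) * omega m k) k) 0 = mu (-ε) m k 0 := by
  change kappaFun _ 0 = _
  rw [kappaFun_zero, mu_zero, units_neg_cast, ← Fin.succ_last, cons_zero, cons_succ]
  ring

/-- In light-cone coordinates a point of the sheet `k⁰ = -ε ω` has components `μ_{-ε}(𝐤)⁺`, dual to
`x⁺`, and, after rotation, `μ_ε(𝐤)`, dual to `(x_⊥, x⁻)`. -/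
theorem rotate_tail_kappa_shell (ε : ℤˣ) (k : Eucl (d + 1)) :
    rotate d (tail (kappa d (cons (-((ε : ℤ) : ℝ) * omega m k) k))) = mu ε m k := by
  ext i
  induction i using Fin.cases with
  | zero =>
    rw [rotate_zero]
    change -kappaFun _ (Fin.last d).succ = _
    rw [Fin.succ_last, kappaFun_last, mu_zero, ← Fin.succ_last, cons_zero, cons_succ]
    ring
  | succ i =>
    rw [rotate_succ]
    change kappaFun _ i.castSucc.succ = _
    rw [kappaFun_mid, mu_succ, cons_succ]

theorem temperate_mu_zero (ε : ℤˣ) (hm : 0 < m) :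
    (fun k : Eucl (d + 1) => mu ε m k 0).HasTemperateGrowth := by
  simp only [mu_zero, div_eq_mul_inv]
  exact ((temperate_coord (Fin.last d)).add
    ((Function.HasTemperateGrowth.const _).mul (temperate_omega hm))).mul (.const _)

/-- The argument of `exists_restriction` in light-cone coordinates, with `𝐤` replaced by `μ_ε(𝐤)` in
the spatial factor. That factor must be squeezed for its composition with `μ_ε` to be Schwartz,
which is why only tame test functions are admitted. -/
theorem IsShellTransform.exists_tameRestriction {hm : 0 < m} {u : 𝓢'(Eucl (d + 2), ℂ)}
    {a : ℤˣ → 𝓢'(Eucl (d + 1), ℂ)} (ha : IsShellTransform hm u a) :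
    ∃ w, HasTameRestriction (compKappaInv d u) w ∧
      ∀ h : SqueezedSchwartz d, lcFourier d w h =
        ((2 * Real.pi)⁻¹ : ℂ) * ∑ ε : ℤˣ, a ε (muPull ε hm h) := by
  -- Up to `(2π)⁻¹` this is `(ε ω - kⁿ) / √2`, the light-cone energy at `μ_ε(𝐤)`.
  let φ : ℤˣ → Eucl (d + 1) → ℝ := fun ε k => (2 * Real.pi)⁻¹ * -mu (-ε) m k 0
  have hφ : ∀ ε, (φ ε).HasTemperateGrowth := fun ε =>
    (Function.HasTemperateGrowth.const _).mul (temperate_mu_zero (-ε) hm).neg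
  let L : ℤˣ → tameSchwartz d →L[ℂ] 𝓢(Eucl (d + 1), ℂ) := fun ε => muPull ε hm ∘L tameToSqueezed d
  refine ⟨_, ⟨Set.univ, phasePairing a φ L, isOpen_univ, Set.mem_univ _,
    fun g => (contDiff_phasePairing a L hφ g).contDiffOn, fun f hf hfc _ g F hF => ?_, rfl⟩,
    fun h => ?_⟩
  · let f' : 𝓢(ℝ, ℂ) := hfc.toSchwartzMap hf
    have h2 := (integral_phasePairing a L hφ g f').2
    obtain ⟨f₁, hf1, hf2⟩ := exists_rescaled_fourierInv f'
    let h : 𝓢(Eucl (d + 1), ℂ) := lcFourierTransposeInv d g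
    let g₁ : 𝓢(Eucl (d + 1), ℂ) := SchwartzMap.compCLMOfContinuousLinearEquiv ℂ
      (rotateIsometry d).toContinuousLinearEquiv h
    -- The transposed light-cone transform is the ordinary one followed by the rotation, so rotating
    -- `h` produces an ordinary preimage of `g`.
    have hg₁ : schwartzFourier (d + 1) g₁ = g := by
      ext x
      rw [schwartzFourier_comp_isometry]
      exact congrArg (fun f : 𝓢(Eucl (d + 1), ℂ) => f x) (lcFourierTranspose_inv g.1)
    have e : SchwartzMap.compCLMOfContinuousLinearEquiv ℂ (kappa d).toContinuousLinearEquiv F.1 =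
        schwartzFourier (d + 2) (SchwartzMap.compCLMOfContinuousLinearEquiv ℂ
          (kappa d).toContinuousLinearEquiv (tensor f₁ g₁)) := by
      ext x
      rw [schwartzFourier_comp_isometry, schwartzFourier_tensor, hf1, hg₁]
      exact hF (kappa d x)
    rw [setIntegral_univ]
    change u (SchwartzMap.compCLMOfContinuousLinearEquiv ℂ (kappa d).toContinuousLinearEquiv F.1) =
      ∫ t, phasePairing a φ L t g * f' t
    rw [h2, e, ← distFourier_apply, ha, Finset.mul_sum]
    refine Finset.sum_congr rfl fun ε _ => ?_
    rw [← smul_eq_mul, ← map_smul]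
    congr 1
    ext k
    have ht : (fun x => 𝓕 f' (φ ε x)).HasTemperateGrowth := by
      exact (temperate_fourier_of_moments (moments_schwartz f')).comp (hφ ε)
    rw [smul_apply, SchwartzMap.smulLeftCLM_apply_apply ht, shellRestrict_apply]
    change f₁ (kappa d _ 0) * h (rotate d (tail (kappa d _))) =
      ((2 * Real.pi)⁻¹ : ℂ) * (𝓕 f' (φ ε k) * muPull ε hm (tameToSqueezed d g) k)
    rw [kappa_shell_zero, rotate_tail_kappa_shell, muPull_apply, ← neg_neg (mu (-ε) m k 0), hf2,
      mul_assoc]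
    rfl
  · change phasePairing a φ L 0 (lcFourierTranspose d h) = _
    rw [phasePairing_zero]
    simp only [L, ContinuousLinearMap.comp_apply, tameToSqueezed_lcFourierTranspose]

end TameRestriction

/-! ### Uniqueness of restrictions. -/

section Uniqueness

theorem integrable_mul_of_tsupport_subset {Ω : Set ℝ} {A f : ℝ → ℂ} (hA : ContinuousOn A Ω)
    (hf : Continuous f) (hfc : HasCompactSupport f) (hs : tsupport f ⊆ Ω) :
    Integrable fun t => A t * f t := by
  have h : IntegrableOn (fun t => A t * f t) (tsupport f) :=
    ((hA.mono hs).mul hf.continuousOn).integrableOn_compact hfc.isCompact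
  refine (integrableOn_iff_integrable_of_support_subset fun t ht => ?_).1 h
  exact subset_tsupport f (right_ne_zero_of_mul ht)

theorem setIntegral_mul_of_tsupport_subset {Ω : Set ℝ} {A f : ℝ → ℂ} (hs : tsupport f ⊆ Ω) :
    ∫ t in Ω, A t * f t = ∫ t, A t * f t :=
  setIntegral_eq_integral_of_forall_compl_eq_zero fun t ht => by
    rw [image_eq_zero_of_notMem_tsupport fun h => ht (hs h), mul_zero]

/-- Continuous functions which agree as distributions agree pointwise. -/
theorem eqOn_of_setIntegral_mul_eq {Ω Ω' : Set ℝ} (hΩ : IsOpen Ω) (hΩ' : IsOpen Ω') {A B : ℝ → ℂ}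
    (hA : ContinuousOn A Ω) (hB : ContinuousOn B Ω')
    (h : ∀ f : ℝ → ℂ, ContDiff ℝ ∞ f → HasCompactSupport f → tsupport f ⊆ Ω → tsupport f ⊆ Ω' →
      ∫ t in Ω, A t * f t = ∫ t in Ω', B t * f t) : Set.EqOn A B (Ω ∩ Ω') := by
  have hU := hΩ.inter hΩ'
  have hA' := hA.mono (Set.inter_subset_left (t := Ω'))
  have hB' := hB.mono (Set.inter_subset_right (s := Ω))
  refine Measure.eqOn_open_of_ae_eq (μ := volume) ?_ hU hA' hB'
  -- The fundamental lemma of the calculus of variations tests with real functions, which are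
  -- embedded into the complex ones here.
  have key := hU.ae_eq_zero_of_integral_contDiff_smul_eq_zero (μ := volume)
    (f := fun t => A t - B t) ((hA'.sub hB').locallyIntegrableOn hU.measurableSet) fun f hf hfc hs => by
      have hs' : tsupport (fun t => (f t : ℂ)) ⊆ tsupport f :=
        closure_mono fun t ht h0 => ht (by
          change ((f t : ℝ) : ℂ) = 0
          rw [h0, Complex.ofReal_zero])
      have h1 : ContDiff ℝ ∞ fun t => (f t : ℂ) := Complex.ofRealCLM.contDiff.comp hf
      have h2 : HasCompactSupport fun t => (f t : ℂ) := hfc.mono' (subset_closure.trans hs')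
      have h3 := (hs'.trans hs).trans Set.inter_subset_left
      have h4 := (hs'.trans hs).trans Set.inter_subset_right
      have := h _ h1 h2 h3 h4
      rw [setIntegral_mul_of_tsupport_subset h3, setIntegral_mul_of_tsupport_subset h4] at this
      rw [← sub_eq_zero, ← integral_sub (integrable_mul_of_tsupport_subset hA h1.continuous h2 h3)
        (integrable_mul_of_tsupport_subset hB h1.continuous h2 h4)] at this
      rw [← this]
      congr 1
      ext t
      rw [Complex.real_smul]
      ring
  rw [Filter.EventuallyEq, ae_restrict_iff' hU.measurableSet]
  filter_upwards [key] with t ht hm using sub_eq_zero.1 (ht hm)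

theorem HasRestriction.unique {n : ℕ} {u : 𝓢'(Eucl (n + 1), ℂ)} {u₀ u₁ : 𝓢'(Eucl n, ℂ)}
    (h₀ : HasRestriction u u₀) (h₁ : HasRestriction u u₁) : u₀ = u₁ := by
  obtain ⟨v, hv, hv', rfl⟩ := h₀
  obtain ⟨w, hw, hw', rfl⟩ := h₁
  ext g
  refine eqOn_of_setIntegral_mul_eq isOpen_univ isOpen_univ (hv g).continuous.continuousOn
    (hw g).continuous.continuousOn (fun f hf hfc _ _ => ?_) ⟨Set.mem_univ 0, Set.mem_univ 0⟩
  rw [setIntegral_univ, setIntegral_univ]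
  let f' : 𝓢(ℝ, ℂ) := hfc.toSchwartzMap hf
  exact (hv' f' g (tensor f' g) fun _ => rfl).2.symm.trans
    (hw' f' g (tensor f' g) fun _ => rfl).2

theorem lastDeriv_tensor {n : ℕ} (f : 𝓢(ℝ, ℂ)) (g : 𝓢(Eucl (n + 1), ℂ)) :
    lastDeriv (n + 1) (tensor f g) = tensor f (lastDeriv n g) := by
  ext x
  change (∂_{EuclideanSpace.single (Fin.last (n + 1)) (1 : ℝ)} (tensor f g)) x =
    f (x 0) * (∂_{EuclideanSpace.single (Fin.last n) (1 : ℝ)} g) (tail x)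
  rw [SchwartzMap.lineDerivOp_apply, SchwartzMap.lineDerivOp_apply, lineDeriv, lineDeriv,
    ← deriv_const_mul_field]
  congr 1
  ext t
  have h1 : (x + t • EuclideanSpace.single (Fin.last (n + 1)) (1 : ℝ)) 0 = x 0 := by
    simp [(Fin.last_pos (n := n)).ne]
  have h2 : tail (x + t • EuclideanSpace.single (Fin.last (n + 1)) (1 : ℝ)) =
      tail x + t • EuclideanSpace.single (Fin.last n) (1 : ℝ) := by
    ext i
    simp [tail, ← Fin.succ_last]
  rw [tensor_apply, h1, h2]

/-- `∂₋` differentiates only the second factor, so antiderivatives of `g` tensored with `f` serve.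
Without this the condition in `HasTameRestriction` might have no test functions. -/
theorem tensor_mem_tameSchwartz {n : ℕ} (f : 𝓢(ℝ, ℂ)) {g : 𝓢(Eucl (n + 1), ℂ)}
    (hg : g ∈ tameSchwartz n) : tensor f g ∈ tameSchwartz (n + 1) := by
  refine mem_tameSchwartz.2 fun k => ?_
  obtain ⟨G, rfl⟩ := mem_tameSchwartz.1 hg k
  refine ⟨tensor f G, ?_⟩
  clear hg
  induction k with
  | zero => rfl
  | succ k ih => rw [pow_succ', pow_succ', Module.End.mul_apply, Module.End.mul_apply, ih,
      lastDeriv_tensor]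

/-- The neighbourhoods of the two families may differ; comparison on their intersection is enough,
since it contains `0`. -/
theorem HasTameRestriction.unique {d : ℕ} {u : 𝓢'(Eucl (d + 2), ℂ)} {w₀ w₁ : TameDistribution d}
    (h₀ : HasTameRestriction u w₀) (h₁ : HasTameRestriction u w₁) : w₀ = w₁ := by
  obtain ⟨Ω, v, hΩ, h0, hv, hv', rfl⟩ := h₀
  obtain ⟨Ω', w, hΩ', h0', hw, hw', rfl⟩ := h₁
  ext g
  refine eqOn_of_setIntegral_mul_eq hΩ hΩ' (hv g).continuousOn (hw g).continuousOn
    (fun f hf hfc hs hs' => ?_) ⟨h0, h0'⟩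
  let F : tameSchwartz (d + 1) :=
    ⟨tensor (hfc.toSchwartzMap hf) g.1, tensor_mem_tameSchwartz _ g.2⟩
  exact (hv' f hf hfc hs g F fun _ => rfl).symm.trans (hw' f hf hfc hs' g F fun _ => rfl)

end Uniqueness

/-! ### Squeezing maps and cancellation of Jacobians. -/

section TransformationLaws
variable {d : ℕ} {m : ℝ}

/-- `p⁺` and the light-cone energy `ω̃` have the same sign, so on this half space `ε ω(ν(q)) = (q⁺ +
ω̃) / √2`; adding the last component `(q⁺ - ω̃) / √2` of `ν(q)` gives `√2 q⁺`. -/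
theorem mu_nu (ε : ℤˣ) {q : Eucl (d + 1)} (hq : 0 < ((ε : ℤ) : ℝ) * q 0) :
    mu ε m (nu m q) = q := by
  have hq0 : q 0 ≠ 0 := fun h => by simp [h] at hq
  have h0 : √2 ≠ 0 := by positivity
  have h1 := omegaLC_mul (m := m) hq0
  have h3 : 0 ≤ q 0 * omegaLC m q := by nlinarith [sq_nonneg ‖tail q‖, sq_nonneg m]
  have h4 : ((ε : ℤ) : ℝ) * (|q 0| + |omegaLC m q|) = q 0 + omegaLC m q := by
    rcases Int.units_eq_one_or ε with rfl | rfl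
    · have hpos : 0 < q 0 := by simpa using hq
      rw [abs_of_pos hpos, abs_of_nonneg (nonneg_of_mul_nonneg_right h3 hpos)]
      simp
    · have hneg : q 0 < 0 := by simpa using hq
      rw [abs_of_neg hneg, abs_of_nonpos (nonpos_of_mul_nonneg_right h3 hneg)]
      simp [add_comm]
  ext i
  induction i using Fin.cases with
  | succ i => rw [mu_succ, nu_castSucc]
  | zero =>
    rw [mu_zero, nu_last, omega_nu hq0, ← mul_div_assoc, h4]
    field_simp
    rw [Real.sq_sqrt (by norm_num)]
    ring

theorem heaviside_mu (ε δ : ℤˣ) (hm : 0 < m) (k : Eucl (d + 1)) :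
    0 < ((ε : ℤ) : ℝ) * mu δ m k 0 ↔ δ = ε := by
  have h1 := mu_zero_pos δ hm k
  constructor
  · intro h
    by_contra hne
    obtain rfl : δ = -ε := Int.units_ne_iff_eq_neg.1 hne
    rw [units_neg_cast] at h1
    linarith
  · rintro rfl
    exact h1

theorem omegaInvSmul_omegaSmul (hm : 0 < m) {n : ℕ} (a : 𝓢'(Eucl n, ℂ)) :
    omegaInvSmul m (omegaSmul m a) = a := by
  ext g
  change a (SchwartzMap.smulLeftCLM ℂ (fun p => ((omega m p : ℝ) : ℂ))
    (SchwartzMap.smulLeftCLM ℂ (fun p => ((1 / omega m p : ℝ) : ℂ)) g)) = a g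
  congr 1
  ext k
  have h : (fun p : Eucl n => 1 / omega m p).HasTemperateGrowth := by
    simpa only [one_div] using temperate_omega_inv hm
  rw [SchwartzMap.smulLeftCLM_apply_apply (temperate_ofReal (temperate_omega hm)),
    SchwartzMap.smulLeftCLM_apply_apply (temperate_ofReal h), smul_smul, ← Complex.ofReal_mul,
    mul_one_div_cancel (omega_pos hm k).ne', Complex.ofReal_one, one_smul]

variable {W : SqueezedDistribution d} {a : ℤˣ → 𝓢'(Eucl (d + 1), ℂ)} {hm : 0 < m} {c : ℂ}

/-- The Heaviside factor removes the other sheet, because `μ_δ` takes its values in `δ p⁺ > 0`. On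
the remaining one `|p⁺|` cancels against the Jacobian `ω / |p⁺|` and leaves `ω`. -/
theorem muStar_absHeavisideSmul (hW : ∀ h, W h = c * ∑ ε : ℤˣ, a ε (muPull ε hm h)) (ε : ℤˣ) :
    muStar ε hm (absHeavisideSmul ε W) = c • omegaSmul m (a ε) := by
  ext g
  change W (squeezedMul (moderateOn_abs_heaviside ε) (muTranspose ε hm g)) = _
  have key : ∀ δ, muPull δ hm (squeezedMul (moderateOn_abs_heaviside ε) (muTranspose ε hm g)) =
      if δ = ε then SchwartzMap.smulLeftCLM ℂ (fun p => ((omega m p : ℝ) : ℂ)) g else 0 := by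
    intro δ
    ext k
    have hne := mu_zero_ne δ hm k
    rw [muPull_apply, squeezedMul_apply _ _ hne, muTranspose_apply]
    simp only [heaviside_mu ε δ hm k]
    split_ifs with h
    · rw [SchwartzMap.smulLeftCLM_apply_apply (temperate_ofReal (temperate_omega hm)), nu_mu δ hm,
        smul_eq_mul, ← mul_assoc, ← Complex.ofReal_mul, mul_one,
        mul_div_cancel₀ _ (abs_pos.2 hne).ne']
    · rw [mul_zero]
      rfl
  rw [hW, smul_apply, omegaSmul_apply, smul_eq_mul]
  congr 1
  rw [Finset.sum_eq_single ε (fun δ _ hδ => by rw [key, if_neg hδ, map_zero])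
    (fun h => (h (Finset.mem_univ _)).elim), key, if_pos rfl]

/-- The Jacobian `|μ_ε⁺| / ω`, the factor `1 / (2 |p⁺|)` and `2ω` multiply to one. -/
theorem halfAbsInvSmul_nuStar (ε : ℤˣ) (h : SqueezedSchwartz d) :
    halfAbsInvSmul (nuStar ε hm ((2 * c) • omegaSmul m (a ε))) h = c * a ε (muPull ε hm h) := by
  change ((2 * c) • omegaSmul m (a ε)) (nuTranspose ε hm (squeezedMul moderateOn_half_abs_inv h)) = _
  rw [smul_apply, omegaSmul_apply, smul_eq_mul, mul_assoc, mul_left_comm, ← smul_eq_mul (2 : ℂ),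
    ← map_smul]
  congr 2
  ext k
  have hne := mu_zero_ne ε hm k
  have h1 : ((|mu ε m k 0| : ℝ) : ℂ) ≠ 0 := Complex.ofReal_ne_zero.2 (abs_pos.2 hne).ne'
  have h2 : ((omega m k : ℝ) : ℂ) ≠ 0 := Complex.ofReal_ne_zero.2 (omega_pos hm k).ne'
  rw [smul_apply, SchwartzMap.smulLeftCLM_apply_apply (temperate_ofReal (temperate_omega hm)),
    nuTranspose_apply, squeezedMul_apply _ _ hne, muPull_apply]
  simp only [smul_eq_mul]
  push_cast
  field_simp

end TransformationLaws

end LightCone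

end

/-! ### The theorem, with `n = d + 1`. -/

theorem mainTheorem3 (d : ℕ) (m : ℝ) (hm : 0 < m)
    (u : 𝓢'(LightCone.Eucl (d + 2), ℂ)) (hu : LightCone.IsKleinGordonSolution m u) :
    -- the three restrictions exist and are unique
    (∃! u₀ : 𝓢'(LightCone.Eucl (d + 1), ℂ), LightCone.HasRestriction u u₀) ∧
    (∃! u₁ : 𝓢'(LightCone.Eucl (d + 1), ℂ), LightCone.HasRestriction (LightCone.pd 0 u) u₁) ∧
    (∃! w : LightCone.TameDistribution d,
      LightCone.HasTameRestriction (LightCone.compKappaInv d u) w) ∧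
    -- the maps `μ_{≷0}` and `ν_{≷0}` are inverse to each other
    (∀ ε : ℤˣ,
      (∀ p : LightCone.Eucl (d + 1), 0 < ((ε : ℤ) : ℝ) * LightCone.mu ε m p 0 ∧
        LightCone.nu m (LightCone.mu ε m p) = p) ∧
      (∀ q : LightCone.Eucl (d + 1), 0 < ((ε : ℤ) : ℝ) * q 0 →
        LightCone.mu ε m (LightCone.nu m q) = q)) ∧
    -- the transformation laws
    ∀ (u₀ u₁ : 𝓢'(LightCone.Eucl (d + 1), ℂ)) (w : LightCone.TameDistribution d),
      LightCone.HasRestriction u u₀ →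
      LightCone.HasRestriction (LightCone.pd 0 u) u₁ →
      LightCone.HasTameRestriction (LightCone.compKappaInv d u) w →
      LightCone.lcFourier d w =
        LightCone.halfAbsInvSmul
          (LightCone.nuStar 1 hm (LightCone.omegaSmul m (LightCone.distFourier (d + 1) u₀) +
              Complex.I • LightCone.distFourier (d + 1) u₁) +
            LightCone.nuStar (-1) hm (LightCone.omegaSmul m (LightCone.distFourier (d + 1) u₀) -
              Complex.I • LightCone.distFourier (d + 1) u₁)) ∧
      LightCone.distFourier (d + 1) u₀ =
        LightCone.omegaInvSmul m
          (LightCone.muStar 1 hm (LightCone.absHeavisideSmul 1 (LightCone.lcFourier d w)) +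
            LightCone.muStar (-1) hm
              (LightCone.absHeavisideSmul (-1) (LightCone.lcFourier d w))) ∧
      LightCone.distFourier (d + 1) u₁ =
        (1 / Complex.I) •
          (LightCone.muStar 1 hm (LightCone.absHeavisideSmul 1 (LightCone.lcFourier d w)) -
            LightCone.muStar (-1) hm
              (LightCone.absHeavisideSmul (-1) (LightCone.lcFourier d w))) := by
  obtain ⟨a, ha⟩ := hu.exists_isShellTransform hm
  obtain ⟨v₀, hv₀, e₀⟩ := ha.exists_restriction
  obtain ⟨v₁, hv₁, e₁⟩ := ha.pd_zero.exists_restriction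
  obtain ⟨v, hv, e⟩ := ha.exists_tameRestriction
  refine ⟨⟨v₀, hv₀, fun y hy => hy.unique hv₀⟩, ⟨v₁, hv₁, fun y hy => hy.unique hv₁⟩,
    ⟨v, hv, fun y hy => hy.unique hv⟩,
    fun ε => ⟨fun p => ⟨LightCone.mu_zero_pos ε hm p, LightCone.nu_mu ε hm p⟩,
      fun q hq => LightCone.mu_nu ε hq⟩, ?_⟩
  intro u₀ u₁ w h₀ h₁ hw
  -- By uniqueness the given restrictions are the constructed ones, with known transforms in terms
  -- of `a`.
  obtain rfl := h₀.unique hv₀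
  obtain rfl := h₁.unique hv₁
  obtain rfl := hw.unique hv
  set c : ℂ := (2 * Real.pi)⁻¹
  rw [LightCone.sum_units] at e₀ e₁
  simp only [Units.val_one, Int.cast_one, Units.val_neg, Int.cast_neg, mul_one, mul_neg,
    neg_neg] at e₁
  have hI : 1 / Complex.I = -Complex.I := by rw [one_div, Complex.inv_I]
  refine ⟨?_, ?_, ?_⟩
  -- The combinations `ω û₀ ± i û₁` separate the two sheets.
  · have hp : LightCone.omegaSmul m (LightCone.distFourier (d + 1) u₀) +
        Complex.I • LightCone.distFourier (d + 1) u₁ = (2 * c) • LightCone.omegaSmul m (a 1) := by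
      rw [e₀, e₁, map_smul, map_add]
      match_scalars
      · linear_combination (-c) * Complex.I_mul_I
      · linear_combination c * Complex.I_mul_I
    have hn : LightCone.omegaSmul m (LightCone.distFourier (d + 1) u₀) -
        Complex.I • LightCone.distFourier (d + 1) u₁ =
          (2 * c) • LightCone.omegaSmul m (a (-1)) := by
      rw [e₀, e₁, map_smul, map_add]
      match_scalars
      · linear_combination c * Complex.I_mul_I
      · linear_combination (-c) * Complex.I_mul_I
    rw [hp, hn, map_add]
    ext h
    rw [add_apply, LightCone.halfAbsInvSmul_nuStar, LightCone.halfAbsInvSmul_nuStar, e,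
      LightCone.sum_units, mul_add]
  · rw [LightCone.muStar_absHeavisideSmul e, LightCone.muStar_absHeavisideSmul e, map_add, map_smul,
      map_smul, LightCone.omegaInvSmul_omegaSmul hm, LightCone.omegaInvSmul_omegaSmul hm, e₀, smul_add]
  · rw [LightCone.muStar_absHeavisideSmul e, LightCone.muStar_absHeavisideSmul e, hI, e₁]
    module
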